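/- Let $K$ be a number field with algebraic closure $\bar K$, and let $C$ be a curve over $K$, that is, a smooth, projective, geometrically irreducible scheme over $K$ of dimension one. Let $S$ and $T$ be finite subsets of $C(\bar K)$ such that $S$ is disjoint from the set of $\mathrm{Gal}(\bar K/K)$-conjugates of elements of $T$. Then there exists a finite morphism $\varphi\colon C\to\mathbb{P}^1$ defined over $K$ such that - the branch locus of $\varphi$, i.e. the set of all $\varphi(P)\in\mathbb{P}^1(\bar K)$ where $P$ runs over the points of $C(\bar K)$ at which the ramification index of $\varphi$ is greater than $1$, is equal to $\{0,1,\infty\}$; - $\varphi$ is ramified at every point of $S$; - $\varphi(T)\cap\{0,1,\infty\}=\emptyset$. -/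

import Mathlib

open CategoryTheory AlgebraicGeometry

universe u

noncomputable section

namespace BelyiMap

attribute [local instance] MvPolynomial.gradedAlgebra

/-- Projective `n`-space over the field `K`, as a scheme over `Spec K`: it is `Proj` of the
polynomial ring in `n + 1` variables over `K`, graded by the degree. -/
def projectiveSpace (K : Type u) [Field K] (n : ℕ) : Over (Spec (CommRingCat.of K)) :=
  Over.mk (Proj.toSpecZero (MvPolynomial.homogeneousSubmodule (Fin (n + 1)) K) ≫
    Spec.map (CommRingCat.ofHom
      (algebraMap K (MvPolynomial.homogeneousSubmodule (Fin (n + 1)) K 0))))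

/-- A curve over `K`: a smooth, projective, geometrically irreducible scheme over `K` of
dimension one. -/
structure IsCurve {K : Type u} [Field K] (C : Over (Spec (CommRingCat.of K))) : Prop where
  smooth : SmoothOfRelativeDimension 1 C.hom
  projective : ∃ (n : ℕ) (i : C ⟶ projectiveSpace K n), IsClosedImmersion i.left
  geometricallyIrreducible : GeometricallyIrreducible C.hom

/-- `Spec L` as a scheme over `K`, for a `K`-algebra `L`. -/
def specOver (K : Type u) [Field K] (L : Type u) [Field L] [Algebra K L] :
    Over (Spec (CommRingCat.of K)) :=
  Over.mk (Spec.map (CommRingCat.ofHom (algebraMap K L)))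

/-- The set `X(L)` of `L`-rational points of a scheme `X` over `K`: the morphisms
`Spec L ⟶ X` over `K`. -/
abbrev RatPoint {K : Type u} [Field K] (X : Over (Spec (CommRingCat.of K)))
    (L : Type u) [Field L] [Algebra K L] : Type u :=
  specOver K L ⟶ X

/-- The morphism `Spec L ⟶ Spec L` over `K` induced by a `K`-automorphism `σ` of `L`. -/
def specAut {K : Type u} [Field K] {L : Type u} [Field L] [Algebra K L] (σ : L ≃ₐ[K] L) :
    specOver K L ⟶ specOver K L :=
  Over.homMk (U := specOver K L) (V := specOver K L)
    (Spec.map (CommRingCat.ofHom (σ : L →+* L))) (by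
      change Spec.map _ ≫ Spec.map _ = Spec.map _
      rw [← Spec.map_comp, ← CommRingCat.ofHom_comp]
      congr 2
      ext x
      exact σ.commutes x)

/-- The conjugate of an `L`-rational point of `X` by a `K`-automorphism `σ` of `L`. For a
subscheme `X` of a projective space this is the coordinatewise action of `σ`. -/
def RatPoint.conj {K : Type u} [Field K] {X : Over (Spec (CommRingCat.of K))}
    {L : Type u} [Field L] [Algebra K L] (σ : L ≃ₐ[K] L) (P : RatPoint X L) : RatPoint X L :=
  specAut σ ≫ P

/-- The point of the underlying space of `X` at which an `L`-rational point of `X` is located. -/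
def RatPoint.center {K : Type u} [Field K] {X : Over (Spec (CommRingCat.of K))}
    {L : Type u} [Field L] [Algebra K L] (P : RatPoint X L) : X.left :=
  P.left (IsLocalRing.closedPoint L : Spec (CommRingCat.of L))

/-- Evaluation of polynomials over `K` at a vector `v` of elements of `L`, with the value
regarded as a global function on `Spec L`. -/
def evalHom (K : Type u) [Field K] {L : Type u} [Field L] [Algebra K L] {n : ℕ}
    (v : Fin (n + 1) → L) :
    MvPolynomial (Fin (n + 1)) K →+* Γ(Spec (CommRingCat.of L), ⊤) :=
  (Scheme.ΓSpecIso (CommRingCat.of L)).inv.hom.comp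
    (MvPolynomial.aeval v : MvPolynomial (Fin (n + 1)) K →ₐ[K] L).toRingHom

lemma map_evalHom {K : Type u} [Field K] {L : Type u} [Field L] [Algebra K L] {n : ℕ}
    {v : Fin (n + 1) → L} (hv : v ≠ 0) :
    (HomogeneousIdeal.irrelevant
      (MvPolynomial.homogeneousSubmodule (Fin (n + 1)) K)).toIdeal.map (evalHom K v) = ⊤ := by
  obtain ⟨i, hi⟩ := Function.ne_iff.mp hv
  refine Ideal.eq_top_of_isUnit_mem _ (Ideal.mem_map_of_mem _ (?_ : MvPolynomial.X i ∈ _)) ?_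
  · rw [HomogeneousIdeal.mem_iff, HomogeneousIdeal.mem_irrelevant_iff,
      GradedRing.proj_apply,
      DirectSum.decompose_of_mem_ne _ (MvPolynomial.isHomogeneous_X K i) one_ne_zero]
  · simp only [evalHom, RingHom.comp_apply]
    refine IsUnit.map _ ?_
    simpa using hi

lemma fromOfGlobalSections_evalHom_comp {K : Type u} [Field K] {L : Type u} [Field L] [Algebra K L]
    {n : ℕ} {v : Fin (n + 1) → L} (hv : v ≠ 0) :
    Proj.fromOfGlobalSections (MvPolynomial.homogeneousSubmodule (Fin (n + 1)) K) (evalHom K v)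
      (map_evalHom hv) ≫ Proj.toSpecZero (MvPolynomial.homogeneousSubmodule (Fin (n + 1)) K) ≫
      Spec.map (CommRingCat.ofHom
        (algebraMap K (MvPolynomial.homogeneousSubmodule (Fin (n + 1)) K 0))) =
      Spec.map (CommRingCat.ofHom (algebraMap K L)) := by
  rw [Proj.fromOfGlobalSections_toSpecZero_assoc, ← SpecMap_ΓSpecIso_hom,
    ← Spec.map_comp, ← Spec.map_comp]
  congr 1
  ext x
  simp only [CommRingCat.hom_comp, CommRingCat.hom_ofHom, RingHom.comp_apply, evalHom]
  erw [CommRingCat.inv_hom_apply]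
  exact (MvPolynomial.aeval v : MvPolynomial (Fin (n + 1)) K →ₐ[K] L).commutes x

/-- The `L`-rational point `[v 0 : ... : v n]` of projective `n`-space over `K` with given
homogeneous coordinates in `L`. -/
def coordPoint (K : Type u) [Field K] {L : Type u} [Field L] [Algebra K L] {n : ℕ}
    (v : Fin (n + 1) → L) (hv : v ≠ 0) : RatPoint (projectiveSpace K n) L :=
  Over.homMk (U := specOver K L) (V := projectiveSpace K n) (Proj.fromOfGlobalSections
    (MvPolynomial.homogeneousSubmodule (Fin (n + 1)) K) (evalHom K v) (map_evalHom hv))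
    (fromOfGlobalSections_evalHom_comp hv)

/-- The ramification index of a morphism `φ : X ⟶ Y` at the point `x` of `X`: the length of the
local ring of `X` at `x` modulo the ideal generated by the image of the maximal ideal of the
local ring of `Y` at `φ x`. If these local rings are discrete valuation rings, it is
the valuation at `x` of the pullback of a uniformizer at `φ x`. -/
def ramificationIndex {X Y : Scheme.{u}} (φ : X ⟶ Y) (x : X) : ℕ∞ :=
  Module.length (X.presheaf.stalk x) (X.presheaf.stalk x ⧸
    (IsLocalRing.maximalIdeal (Y.presheaf.stalk (φ x))).map (φ.stalkMap x).hom)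

/-- A morphism `φ` over `K` is ramified at the `L`-rational point `P` if its ramification index
at `P` exceeds one. (Since fields of characteristic zero are perfect, ramification indices do not
change under base change from such a field `K` to an algebraic closure.) -/
def IsRamifiedAt {K : Type u} [Field K] {X Y : Over (Spec (CommRingCat.of K))} (φ : X ⟶ Y)
    {L : Type u} [Field L] [Algebra K L] (P : RatPoint X L) : Prop :=
  1 < ramificationIndex φ.left P.center

/-- The branch locus of `φ`, as a set of geometric points of `Y`: the set of images under `φ` of
the geometric points of `X` at which `φ` is ramified. -/
def branchLocus {K : Type u} [Field K] {X Y : Over (Spec (CommRingCat.of K))} (φ : X ⟶ Y) :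
    Set (RatPoint Y (AlgebraicClosure K)) :=
  {Q | ∃ P : RatPoint X (AlgebraicClosure K), IsRamifiedAt φ P ∧ P ≫ φ = Q}

/-- The subset `{0, 1, ∞}` of the set of geometric points of the projective line over `K`, where
`a` stands for `[a : 1]` and `∞` for `[1 : 0]`. -/
def zeroOneInfty (K : Type u) [Field K] :
    Set (RatPoint (projectiveSpace K 1) (AlgebraicClosure K)) :=
  {coordPoint K ![0, 1] (by simp), coordPoint K ![1, 1] (by simp), coordPoint K ![1, 0] (by simp)}

end BelyiMap

end

/-! Embed the curve in a projective space. Two forms F, G over K of the same positive degree without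
common zeros on the curve define a finite morphism [F : G] to the projective line. In characteristic
zero it is ramified at a geometric point exactly when the Wronskian F dG − G dF vanishes along a
nonzero tangent vector there (`Chart.mapsMaximalIdeal_iff`). So it suffices to find suitable forms,
and `CurveData` isolates what this search needs: values and first derivatives of forms at geometric
points, separation of closed points, existence and finiteness of zeros.

The search is Belyi's argument, modified so that T can be followed and kept off the branch locus.

Simple poles (`exists_pencil_simple_zeros`). A Bertini argument gives a function F/G all of whose
poles are simple, with poles at T and none in S; this is where S must avoid the conjugates of T.
Then ∞ is not a branch point and T lies over it.

Rational branch points (`IsPrepared.reduce`). Composing with the minimal polynomial p of a branch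
value, as Belyi does, would ramify over ∞. Instead, with m = deg p, one composes with y ↦ (y − c)^m
/ ((y − c)^m − p(y)). For general c this fixes ∞ and is unramified there; it sends the roots of p to
1 and its critical point c to 0, and its other critical points are roots of a polynomial of degree
less than m. Repetition makes all branch values and the images of S rational, with T still over ∞.

Three branch points (`exists_isBelyi_of_finset`). A Möbius map moves ∞ to 0. Let u be a set of at
least three nonzero rationals containing the branch values and the image of S. Take the product of
(x − a)^(2 e_a) over a in u, with integers e_a proportional to the nodal weights 1/∏_{b ≠ a} (a −
b). By partial fractions its logarithmic derivative is a nonzero constant divided by ∏ (x − a), so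
there are no critical points outside u and ∞. The sums of e_a and of a·e_a vanish, so ∞ is a
ramification point with value 1; the factor 2 makes every zero and pole ramified. The points of T go
to ∏ (−a)^(2 e_a), which is not 1 because the Möbius map is chosen such that exactly one a has
p-adic absolute value different from 1, for some prime p. -/

noncomputable section

namespace BelyiMap

attribute [local instance] MvPolynomial.gradedAlgebra

/-! ### Maps from affine schemes to Proj through a basic open subset -/

section ProjSpec

open HomogeneousLocalization

variable {A σ : Type u} [CommRing A] [SetLike σ A] [AddSubgroupClass σ A]
  (𝒜 : ℕ → σ) [GradedRing 𝒜]

/-- The ring homomorphism `(A_r)₀ → R` induced by a ring homomorphism `A → R` mapping `r`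
to a unit. -/
def awayLift {R : Type u} [CommRing R] (f : A →+* R) {r : A} (hr : IsUnit (f r)) :
    Away 𝒜 r →+* R :=
  (IsLocalization.Away.lift r hr : Localization.Away r →+* R).comp
    (algebraMap (Away 𝒜 r) (Localization.Away r))

lemma awayLift_mk_mul {R : Type u} [CommRing R] (f : A →+* R) {r : A} (hr : IsUnit (f r))
    {d : ℕ} (hd : r ∈ 𝒜 d) (n : ℕ) (a : A) (ha : a ∈ 𝒜 (n • d)) :
    awayLift 𝒜 f hr (Away.mk 𝒜 hd n a ha) * f r ^ n = f a := by
  rw [awayLift, RingHom.comp_apply, HomogeneousLocalization.algebraMap_apply, Away.val_mk,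
    Localization.mk_eq_mk', ← map_pow]
  have := IsLocalization.Away.lift_eq r hr (S := Localization.Away r)
  rw [← this (r ^ n), ← map_mul]
  exact (congrArg _ (IsLocalization.mk'_spec (M := Submonoid.powers r) (Localization.Away r) a
    ⟨r ^ n, n, rfl⟩)).trans (this a)

lemma comp_awayLift {R R' : Type u} [CommRing R] [CommRing R'] (f : A →+* R) {r : A}
    (hr : IsUnit (f r)) (ρ : R →+* R') :
    ρ.comp (awayLift 𝒜 f hr) = awayLift 𝒜 (ρ.comp f) (hr.map ρ) := by
  rw [awayLift, awayLift, ← RingHom.comp_assoc]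
  congr 1
  apply IsLocalization.ringHom_ext (Submonoid.powers r)
  ext x
  simp

/-- Since `g r` is a unit, `ψ` lands where `f r` is invertible, and there the morphism to Proj is by
construction induced by a ring homomorphism on the degree-zero part of the localization at `r`. -/
lemma comp_fromOfGlobalSections {X : Scheme.{u}} (f : A →+* Γ(X, ⊤))
    (hf : (HomogeneousIdeal.irrelevant 𝒜).toIdeal.map f = ⊤) {R : Type u} [CommRing R]
    (ψ : Spec (.of R) ⟶ X) (g : A →+* R)
    (hg : g = (ψ.appTop ≫ (Scheme.ΓSpecIso (.of R)).hom).hom.comp f)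
    {r : A} {d : ℕ} (h0 : 0 < d) (hd : r ∈ 𝒜 d) (hr : IsUnit (g r)) :
    ψ ≫ Proj.fromOfGlobalSections 𝒜 f hf =
      Spec.map (CommRingCat.ofHom (awayLift 𝒜 g hr)) ≫ Proj.awayι 𝒜 r hd h0 := by
  have hψ : ψ ⁻¹ᵁ (X.basicOpen (f r)) = ⊤ := by
    rw [Scheme.preimage_basicOpen]
    refine Scheme.basicOpen_of_isUnit _ ?_
    have h2 : IsUnit ((Scheme.ΓSpecIso (.of R)).hom (ψ.appTop (f r))) := by
      rw [hg] at hr; exact hr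
    exact (MulEquiv.isUnit_map (Scheme.ΓSpecIso (.of R)).commRingCatIsoToRingEquiv).mp h2
  have hrange : Set.range ψ ⊆ Set.range (X.basicOpen (f r)).ι := by
    rintro _ ⟨x, rfl⟩
    rw [Scheme.Opens.range_ι]
    exact (hψ.ge : _) (Set.mem_univ x)
  set ψ' := IsOpenImmersion.lift (X.basicOpen (f r)).ι ψ hrange with hψ'
  have h1 : ψ' ≫ (X.basicOpen (f r)).ι = ψ := IsOpenImmersion.lift_fac _ _ _
  have h3 : (X.basicOpen (f r)).ι ≫ Proj.fromOfGlobalSections 𝒜 f hf =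
      Proj.toBasicOpenOfGlobalSections 𝒜 f rfl h0 hd ≫ (Proj.basicOpen 𝒜 r).ι := by
    rw [← Proj.fromOfGlobalSections_resLE 𝒜 f hf h0 hd, Scheme.Hom.resLE_comp_ι]
  rw [← h1, Category.assoc, h3, Proj.toBasicOpenOfGlobalSections]
  simp only [Category.assoc, Proj.basicOpenIsoSpec_inv_ι]
  have h4 : ψ' ≫ (X.isoOfEq (X.toSpecΓ_preimage_basicOpen (f r))).inv ≫
      X.toSpecΓ ∣_ (PrimeSpectrum.basicOpen (f r)) ≫ (basicOpenIsoSpecAway (f r)).hom =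
      Spec.map (CommRingCat.ofHom (IsLocalization.Away.lift (S := Localization.Away (f r)) (f r)
        (g := (ψ.appTop ≫ (Scheme.ΓSpecIso (.of R)).hom).hom) (by rw [hg] at hr; exact hr))) := by
    rw [← cancel_mono (Spec.map (CommRingCat.ofHom (algebraMap Γ(X, ⊤)
      (Localization.Away (f r)))))]
    simp only [Category.assoc, basicOpenIsoSpecAway_hom_SpecMap, ← Spec.map_comp]
    have h5 : (X.isoOfEq (X.toSpecΓ_preimage_basicOpen (f r))).inv ≫
      X.toSpecΓ ∣_ (PrimeSpectrum.basicOpen (f r)) ≫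
        Scheme.Opens.ι (X := Spec Γ(X, ⊤)) (PrimeSpectrum.basicOpen (f r)) =
        (X.basicOpen (f r)).ι ≫ X.toSpecΓ := by
      rw [← Scheme.isoOfEq_inv_ι_assoc X (X.toSpecΓ_preimage_basicOpen (f r))]
      exact congrArg (_ ≫ ·) (morphismRestrict_ι _ _)
    refine (congrArg (ψ' ≫ ·) h5).trans ?_
    rw [reassoc_of% h1, Scheme.toSpecΓ_naturality,
      ← SpecMap_ΓSpecIso_hom, ← Spec.map_comp, ← CommRingCat.ofHom_comp,
      IsLocalization.Away.lift_comp]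
    rfl
  rw [reassoc_of% h4, ← Spec.map_comp_assoc, ← CommRingCat.ofHom_comp]
  congr 3
  rw [awayLift, ← RingHom.comp_assoc]
  congr 1
  apply IsLocalization.ringHom_ext (Submonoid.powers r)
  ext x
  simp [hg]

end ProjSpec

/-! ### Homogeneous coordinates of morphisms to projective space -/

section ProjectiveCoordinates

open HomogeneousLocalization MvPolynomial

lemma aeval_mul_of_isHomogeneous {K R ι : Type*} [CommRing K] [CommRing R] [Algebra K R]
    {H : MvPolynomial ι K} {m : ℕ} (hH : H.IsHomogeneous m) (c : R) (v : ι → R) :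
    aeval (fun i => c * v i) H = c ^ m * aeval v H := by
  rw [aeval_def, aeval_def, eval₂_eq, eval₂_eq, Finset.mul_sum]
  refine Finset.sum_congr rfl fun d hd => ?_
  have h1 : ∑ i ∈ d.support, d i = m := by
    have := hH (mem_support_iff.mp hd)
    rwa [Finsupp.weight_apply, Finsupp.sum, Finset.sum_congr rfl fun i _ => by
      rw [Pi.one_apply, smul_eq_mul, mul_one]] at this
  rw [← h1]
  simp only [mul_pow, Finset.prod_mul_distrib, Finset.prod_pow_eq_pow_sum]
  ring

variable {K : Type u} [Field K] {n : ℕ}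

variable (K n) in
/-- The grading by the degree of the polynomial ring in `n + 1` variables over `K`. -/
abbrev gradingByDegree : ℕ → Submodule K (MvPolynomial (Fin (n + 1)) K) :=
  homogeneousSubmodule (Fin (n + 1)) K

variable (K n) in
/-- The structure morphism of projective space. -/
abbrev projHom : Proj (gradingByDegree K n) ⟶ Spec (CommRingCat.of K) :=
  Proj.toSpecZero (gradingByDegree K n) ≫ Spec.map (CommRingCat.ofHom
    (algebraMap K (gradingByDegree K n 0)))

lemma X_mem_grading (j : Fin (n + 1)) : (X j : MvPolynomial (Fin (n + 1)) K) ∈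
    gradingByDegree K n 1 := isHomogeneous_X K j

lemma X_mem_grading_smul (j : Fin (n + 1)) : (X j : MvPolynomial (Fin (n + 1)) K) ∈
    gradingByDegree K n (1 • 1) := isHomogeneous_X K j

lemma mk_pow_eq {A : Type*} [CommRing A] (r a : A) (m : ℕ) :
    Localization.mk a (⟨r ^ m, m, rfl⟩ : Submonoid.powers r) =
      IsLocalization.Away.invSelf (S := Localization.Away r) r ^ m * algebraMap A _ a := by
  rw [Localization.mk_eq_mk', IsLocalization.mk'_eq_iff_eq_mul]
  simp only [map_pow]
  rw [mul_right_comm, ← mul_pow, mul_comm _ (algebraMap A _ r),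
    IsLocalization.Away.mul_invSelf, one_pow, one_mul]

/-- Dehomogenization: the ratios X_k/X_j generate the ring of the chart, so a homomorphism over K
out of it is determined by their images. -/
lemma aeval_away (j : Fin (n + 1)) [Algebra K (Away (gradingByDegree K n) (X j))]
    (hK : ∀ c : K, (algebraMap K (Away (gradingByDegree K n) (X j)) c).val =
      algebraMap K (Localization.Away (X j : MvPolynomial (Fin (n + 1)) K)) c)
    (a : MvPolynomial (Fin (n + 1)) K) (m : ℕ) (ha : a ∈ gradingByDegree K n (m • 1)) :
    aeval (fun k => Away.mk (gradingByDegree K n) (X_mem_grading j) 1 (X k)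
      (X_mem_grading_smul k)) a = Away.mk (gradingByDegree K n) (X_mem_grading j) m a ha := by
  apply HomogeneousLocalization.val_injective
  obtain ⟨ν, hν⟩ : ∃ ν : Away (gradingByDegree K n) (X j) →ₐ[K]
      Localization.Away (X j : MvPolynomial (Fin (n + 1)) K), ∀ z, ν z = z.val :=
    ⟨{ algebraMap (Away (gradingByDegree K n) (X j)) (Localization.Away (X j)) with
      commutes' := hK }, fun _ => rfl⟩
  have ha' : a.IsHomogeneous m := by simpa using ha
  set c : Localization.Away (X j : MvPolynomial (Fin (n + 1)) K) :=
    IsLocalization.Away.invSelf (X j : MvPolynomial (Fin (n + 1)) K) with hc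
  rw [← hν, comp_aeval_apply]
  have e3 (i : Fin (n + 1)) : ν (Away.mk (gradingByDegree K n) (X_mem_grading j) 1 (X i)
      (X_mem_grading_smul i)) = c * algebraMap (MvPolynomial (Fin (n + 1)) K) _ (X i) := by
    rw [hν, Away.val_mk, mk_pow_eq, pow_one]
  simp_rw [e3]
  rw [aeval_mul_of_isHomogeneous ha', Away.val_mk, mk_pow_eq]
  have e4 : (aeval fun i => algebraMap (MvPolynomial (Fin (n + 1)) K)
      (Localization.Away (X j : MvPolynomial (Fin (n + 1)) K)) (X i)) =
      IsScalarTower.toAlgHom K (MvPolynomial (Fin (n + 1)) K) _ := by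
    ext i
    simp
  rw [e4, IsScalarTower.toAlgHom_apply]

lemma irrelevant_map_eq_top {R : Type u} [CommRing R] (f : MvPolynomial (Fin (n + 1)) K →+* R)
    (hf : Ideal.span (Set.range fun j => f (X j)) = ⊤) :
    (HomogeneousIdeal.irrelevant (gradingByDegree K n)).toIdeal.map f = ⊤ := by
  rw [← top_le_iff, ← hf, Ideal.span_le]
  rintro _ ⟨j, rfl⟩
  refine Ideal.mem_map_of_mem _ ?_
  rw [HomogeneousIdeal.mem_iff, HomogeneousIdeal.mem_irrelevant_iff,
      GradedRing.proj_apply,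
      DirectSum.decompose_of_mem_ne _ (MvPolynomial.isHomogeneous_X K j) one_ne_zero]

section

variable {R : Type u} [CommRing R] [Algebra K R]

/-- The homomorphism from the homogeneous coordinate ring to the global functions of `Spec R`
corresponding to a homomorphism to `R`. -/
def globalEval (f : MvPolynomial (Fin (n + 1)) K →ₐ[K] R) :
    MvPolynomial (Fin (n + 1)) K →+* Γ(Spec (CommRingCat.of R), ⊤) :=
  (Scheme.ΓSpecIso (CommRingCat.of R)).inv.hom.comp f.toRingHom

lemma irrelevant_map_globalEval (f : MvPolynomial (Fin (n + 1)) K →ₐ[K] R)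
    (hf : Ideal.span (Set.range fun j => f (X j)) = ⊤) :
    (HomogeneousIdeal.irrelevant (gradingByDegree K n)).toIdeal.map (globalEval f) = ⊤ := by
  rw [globalEval, ← Ideal.map_map]
  have := irrelevant_map_eq_top f.toRingHom hf
  rw [this, Ideal.map_top]

/-- The morphism from `Spec R` to projective space with homogeneous coordinates `f (X j)`. -/
def toProj (f : MvPolynomial (Fin (n + 1)) K →ₐ[K] R)
    (hf : Ideal.span (Set.range fun j => f (X j)) = ⊤) :
    Spec (CommRingCat.of R) ⟶ Proj (gradingByDegree K n) :=
  Proj.fromOfGlobalSections (gradingByDegree K n) (globalEval f) (irrelevant_map_globalEval f hf)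

lemma map_toProj_eq_awayι {R' : Type u} [CommRing R'] [Algebra K R']
    (f : MvPolynomial (Fin (n + 1)) K →ₐ[K] R)
    (hf : Ideal.span (Set.range fun j => f (X j)) = ⊤) (ρ : R →+* R')
    {r : MvPolynomial (Fin (n + 1)) K} {d : ℕ} (h0 : 0 < d) (hd : r ∈ gradingByDegree K n d)
    (hr : IsUnit ((ρ.comp f.toRingHom) r)) :
    Spec.map (CommRingCat.ofHom ρ) ≫ toProj f hf =
      Spec.map (CommRingCat.ofHom (awayLift (gradingByDegree K n) (ρ.comp f.toRingHom) hr)) ≫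
        Proj.awayι (gradingByDegree K n) r hd h0 := by
  refine comp_fromOfGlobalSections _ _ _ _ _ ?_ _ _ _
  have := Scheme.ΓSpecIso_naturality (CommRingCat.ofHom ρ)
  rw [Scheme.Hom.appTop, this, globalEval, ← RingHom.comp_assoc]
  congr 1
  ext x
  simp

lemma toProj_eq_awayι (f : MvPolynomial (Fin (n + 1)) K →ₐ[K] R)
    (hf : Ideal.span (Set.range fun j => f (X j)) = ⊤)
    {r : MvPolynomial (Fin (n + 1)) K} {d : ℕ} (h0 : 0 < d) (hd : r ∈ gradingByDegree K n d)
    (hr : IsUnit (f.toRingHom r)) :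
    toProj f hf = Spec.map (CommRingCat.ofHom (awayLift (gradingByDegree K n) f.toRingHom hr)) ≫
        Proj.awayι (gradingByDegree K n) r hd h0 := by
  have := map_toProj_eq_awayι f hf (RingHom.id R) h0 hd (by simpa using hr)
  simpa using this

lemma hom_ext_of_span_eq_top {Z : Scheme.{u}} {ι : Type*} (s : ι → R)
    (hs : Ideal.span (Set.range s) = ⊤) (α β : Spec (CommRingCat.of R) ⟶ Z)
    (h : ∀ i, Spec.map (CommRingCat.ofHom (algebraMap R (Localization.Away (s i)))) ≫ α =
      Spec.map (CommRingCat.ofHom (algebraMap R (Localization.Away (s i)))) ≫ β) : α = β :=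
  (Scheme.affineOpenCoverOfSpanRangeEqTop (R := CommRingCat.of R) s hs).openCover.hom_ext _ _ h

lemma span_map_eq_top {R' : Type*} [CommRing R'] {ι : Type*} {s : ι → R}
    (hs : Ideal.span (Set.range s) = ⊤) (ρ : R →+* R') :
    Ideal.span (Set.range fun i => ρ (s i)) = ⊤ := by
  have := congrArg (Ideal.map ρ) hs
  rwa [Ideal.map_span, Ideal.map_top, ← Set.range_comp] at this

/-- Proportional homogeneous coordinates define the same morphism to projective space. -/
lemma toProj_eq_of_proportional {f f' : MvPolynomial (Fin (n + 1)) K →ₐ[K] R}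
    (hf : Ideal.span (Set.range fun j => f (X j)) = ⊤)
    (hf' : Ideal.span (Set.range fun j => f' (X j)) = ⊤) {c : R} (hc : IsUnit c)
    (h : ∀ j, f' (X j) = c * f (X j)) : toProj f hf = toProj f' hf' := by
  refine hom_ext_of_span_eq_top (fun j => f (X j)) hf _ _ fun j => ?_
  set ρ := algebraMap R (Localization.Away (f (X j)))
  have h1 : IsUnit ((ρ.comp f.toRingHom) (X j)) :=
    IsLocalization.Away.algebraMap_isUnit (S := Localization.Away (f (X j))) (f (X j))
  have h2 : IsUnit ((ρ.comp f'.toRingHom) (X j)) := by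
    have : (ρ.comp f'.toRingHom) (X j) = ρ c * (ρ.comp f.toRingHom) (X j) := by
      simp [h]
    rw [this]
    exact (hc.map ρ).mul h1
  rw [map_toProj_eq_awayι f hf ρ one_pos (X_mem_grading j) h1,
    map_toProj_eq_awayι f' hf' ρ one_pos (X_mem_grading j) h2]
  congr 3
  refine RingHom.ext fun z => ?_
  obtain ⟨m, a, ha, rfl⟩ := Away.mk_surjective (gradingByDegree K n) (X_mem_grading j) z
  have e1 := awayLift_mk_mul (gradingByDegree K n) _ h1 (X_mem_grading j) m a ha
  have e2 := awayLift_mk_mul (gradingByDegree K n) _ h2 (X_mem_grading j) m a ha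
  have ha' : a.IsHomogeneous m := by simpa using ha
  have e3 : f' a = c ^ m * f a := by
    rw [aeval_unique f, aeval_unique f', ← aeval_mul_of_isHomogeneous ha']
    congr 1
    ext i
    simp [h]
  have e4 : (ρ.comp f'.toRingHom) (X j) = ρ c * (ρ.comp f.toRingHom) (X j) := by simp [h]
  have e5 : (ρ.comp f'.toRingHom) a = ρ c ^ m * (ρ.comp f.toRingHom) a := by simp [e3]
  rw [e5, ← e1] at e2
  have h3 := h2.pow m
  refine h3.mul_right_cancel ?_
  rw [e2, e4]
  ring

lemma map_toProj {R' : Type u} [CommRing R'] [Algebra K R']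
    (f : MvPolynomial (Fin (n + 1)) K →ₐ[K] R)
    (hf : Ideal.span (Set.range fun j => f (X j)) = ⊤) (ρ : R →ₐ[K] R') :
    Spec.map (CommRingCat.ofHom ρ.toRingHom) ≫ toProj f hf =
      toProj (ρ.comp f) (by simpa using span_map_eq_top hf ρ.toRingHom) := by
  refine hom_ext_of_span_eq_top (fun j => ρ (f (X j))) (span_map_eq_top hf ρ.toRingHom)
    _ _ fun j => ?_
  set τ := algebraMap R' (Localization.Away (ρ (f (X j))))
  have h1 : IsUnit ((τ.comp (ρ.comp f).toRingHom) (X j)) :=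
    IsLocalization.Away.algebraMap_isUnit (S := Localization.Away (ρ (f (X j)))) (ρ (f (X j)))
  rw [map_toProj_eq_awayι (ρ.comp f) _ τ one_pos (X_mem_grading j) h1, ← Spec.map_comp_assoc,
    ← CommRingCat.ofHom_comp, map_toProj_eq_awayι f hf _ one_pos (X_mem_grading j) h1]
  rfl

lemma toProj_comp_hom (f : MvPolynomial (Fin (n + 1)) K →ₐ[K] R)
    (hf : Ideal.span (Set.range fun j => f (X j)) = ⊤) :
    toProj f hf ≫ projHom K n = Spec.map (CommRingCat.ofHom (algebraMap K R)) := by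
  rw [toProj, projHom]
  rw [Proj.fromOfGlobalSections_toSpecZero_assoc, ← SpecMap_ΓSpecIso_hom,
    ← Spec.map_comp, ← Spec.map_comp]
  congr 1
  ext x
  simp only [CommRingCat.hom_comp, CommRingCat.hom_ofHom, RingHom.comp_apply, globalEval]
  erw [CommRingCat.inv_hom_apply]
  exact f.commutes x

lemma toProj_mem_basicOpen_iff (f : MvPolynomial (Fin (n + 1)) K →ₐ[K] R)
    (hf : Ideal.span (Set.range fun j => f (X j)) = ⊤) (p : PrimeSpectrum R)
    {r : MvPolynomial (Fin (n + 1)) K} {d : ℕ} (h0 : 0 < d) (hd : r ∈ gradingByDegree K n d) :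
    toProj f hf p ∈ Proj.basicOpen (gradingByDegree K n) r ↔ f r ∉ p.asIdeal := by
  have h1 := Proj.fromOfGlobalSections_preimage_basicOpen (gradingByDegree K n) (globalEval f)
    (irrelevant_map_globalEval f hf) h0 hd
  have h2 : (Spec (CommRingCat.of R)).basicOpen (globalEval f r) = PrimeSpectrum.basicOpen (f r) :=
    basicOpen_eq_of_affine (R := CommRingCat.of R) (f r)
  rw [h2] at h1
  exact (Iff.of_eq (congrArg (p ∈ ·) h1))

/-- The coordinates of a morphism to projective space are unique up to a unit, if one of them
is a unit. -/
lemma proportional_of_toProj_eq {f f' : MvPolynomial (Fin (n + 1)) K →ₐ[K] R}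
    (hf : Ideal.span (Set.range fun j => f (X j)) = ⊤)
    (hf' : Ideal.span (Set.range fun j => f' (X j)) = ⊤) {j : Fin (n + 1)}
    (hj : IsUnit (f (X j))) (h : toProj f hf = toProj f' hf') :
    ∃ c : R, IsUnit c ∧ ∀ (m : ℕ) (H : MvPolynomial (Fin (n + 1)) K), H.IsHomogeneous m →
      f' H = c ^ m * f H := by
  -- Equal morphisms pull back the same basic open sets, so `f' (X j)` lies in no maximal ideal.
  have hj' : IsUnit (f' (X j)) := by
    by_contra hcon
    obtain ⟨M, hM, hjM⟩ := exists_max_ideal_of_mem_nonunits hcon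
    have h1 := toProj_mem_basicOpen_iff f hf ⟨M, hM.isPrime⟩ one_pos (X_mem_grading j)
    have h2 := toProj_mem_basicOpen_iff f' hf' ⟨M, hM.isPrime⟩ one_pos (X_mem_grading j)
    rw [h, h2] at h1
    exact h1.mpr (fun h3 => hM.ne_top (Ideal.eq_top_of_isUnit_mem _ h3 hj)) hjM
  rw [toProj_eq_awayι f hf one_pos (X_mem_grading j) hj,
    toProj_eq_awayι f' hf' one_pos (X_mem_grading j) hj', cancel_mono] at h
  have h1 := congrArg CommRingCat.Hom.hom (Spec.map_injective h)
  simp only [CommRingCat.hom_ofHom] at h1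
  obtain ⟨u, hu⟩ := id hj
  obtain ⟨u', hu'⟩ := id hj'
  refine ⟨u' * ↑u⁻¹, Units.isUnit (u' * u⁻¹), fun m H hH => ?_⟩
  have ha : H ∈ gradingByDegree K n (m • 1) := by simpa using hH
  have e1 := awayLift_mk_mul (gradingByDegree K n) f.toRingHom hj (X_mem_grading j) m H ha
  have e2 := awayLift_mk_mul (gradingByDegree K n) f'.toRingHom hj'
    (X_mem_grading j) m H ha
  rw [← h1] at e2
  generalize awayLift (gradingByDegree K n) f.toRingHom hj
    (Away.mk (gradingByDegree K n) (X_mem_grading j) m H ha) = w at e1 e2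
  have e1' : w * (u : R) ^ m = f H := by rw [hu]; exact e1
  have e2' : w * (u' : R) ^ m = f' H := by rw [hu']; exact e2
  rw [← e1', ← e2', mul_pow, mul_comm, mul_assoc]
  congr 1
  rw [mul_comm, mul_assoc, ← mul_pow, Units.mul_inv, one_pow, mul_one]

/-- A morphism over `K` from `Spec R` to a standard affine open subset of projective space is
given by homogeneous coordinates. -/
lemma exists_toProj_eq (ψ : Spec (CommRingCat.of R) ⟶ Proj (gradingByDegree K n))
    (hψ : ψ ≫ projHom K n = Spec.map (CommRingCat.ofHom (algebraMap K R)))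
    (j : Fin (n + 1))
    (hj : ∀ p, ψ p ∈ Proj.basicOpen (gradingByDegree K n) (X j)) :
    ∃ (f : MvPolynomial (Fin (n + 1)) K →ₐ[K] R)
      (hf : Ideal.span (Set.range fun j => f (X j)) = ⊤), f (X j) = 1 ∧ ψ = toProj f hf := by
  have hr : Set.range ψ ⊆ Set.range
      (Proj.awayι (gradingByDegree K n) (X j) (X_mem_grading j) one_pos) := by
    rintro _ ⟨p, rfl⟩
    have := Proj.opensRange_awayι (gradingByDegree K n) (X j) (X_mem_grading j) one_pos
    exact (this.ge : _) (hj p)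
  obtain ⟨θ, hθ⟩ := Spec.map_surjective (IsOpenImmersion.lift
    (Proj.awayι (gradingByDegree K n) (X j) (X_mem_grading j) one_pos) ψ hr)
  have hθ' : Spec.map θ ≫ Proj.awayι (gradingByDegree K n) (X j) (X_mem_grading j) one_pos = ψ := by
    rw [hθ, IsOpenImmersion.lift_fac]
  let y (k : Fin (n + 1)) : Away (gradingByDegree K n) (X j) :=
    Away.mk (gradingByDegree K n) (X_mem_grading j) 1 (X k) (X_mem_grading_smul k)
  -- The coordinates are the pullbacks of the ratios X_k/X_j.
  let f : MvPolynomial (Fin (n + 1)) K →ₐ[K] R := aeval fun k => θ.hom (y k)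
  have hy : y j = 1 := by
    ext
    simp [y]
  have hfj : f (X j) = 1 := by simp [f, hy]
  have hf : Ideal.span (Set.range fun j => f (X j)) = ⊤ :=
    Ideal.eq_top_of_isUnit_mem _ (Ideal.subset_span ⟨j, rfl⟩) (by simp [hfj])
  refine ⟨f, hf, hfj, ?_⟩
  have hu : IsUnit (f.toRingHom (X j)) := by
    change IsUnit (f (X j))
    rw [hfj]; exact isUnit_one
  rw [toProj_eq_awayι f hf one_pos (X_mem_grading j) hu, ← hθ']
  congr 2
  let _ : Algebra K (Away (gradingByDegree K n) (X j)) :=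
    ((fromZeroRingHom (gradingByDegree K n) (Submonoid.powers (X j))).comp
      (algebraMap K (gradingByDegree K n 0))).toAlgebra
  have hK : ∀ c : K, θ.hom (algebraMap K (Away (gradingByDegree K n) (X j)) c) =
      algebraMap K R c := by
    rw [← hθ', projHom, Category.assoc, Proj.awayι_toSpecZero_assoc, ← Spec.map_comp,
      ← Spec.map_comp] at hψ
    exact fun c => congrArg (fun φ => φ.hom c) (Spec.map_injective hψ)
  ext z
  obtain ⟨m, a, ha, rfl⟩ := Away.mk_surjective (gradingByDegree K n) (X_mem_grading j) z
  have e1 := awayLift_mk_mul (gradingByDegree K n) _ hu (X_mem_grading j) m a ha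
  rw [show f.toRingHom (X j) = 1 from hfj, one_pow, mul_one] at e1
  change _ = awayLift (gradingByDegree K n) f.toRingHom hu _
  rw [e1]
  let θ' : Away (gradingByDegree K n) (X j) →ₐ[K] R := { θ.hom with commutes' := hK }
  have e2 : f = θ'.comp (aeval y) := by
    ext k
    simp only [f, AlgHom.comp_apply, aeval_X]
    rfl
  change _ = f a
  rw [e2]
  change θ.hom _ = θ.hom (aeval y a)
  congr 1
  have hK' : ∀ c : K, (algebraMap K (Away (gradingByDegree K n) (X j)) c).val =
      algebraMap K (Localization.Away (X j : MvPolynomial (Fin (n + 1)) K)) c :=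
    fun c => Localization.mk_algebraMap (A := K) (R := MvPolynomial (Fin (n + 1)) K) c
  exact (aeval_away j hK' a m ha).symm

end

end ProjectiveCoordinates

/-! ### Tangent vectors as homomorphisms to the dual numbers -/

section DualNumbers

open TrivSqZeroExt

lemma snd_aeval {K L : Type*} [CommRing K] [CommRing L] [Algebra K L] (x : DualNumber L)
    (h : Polynomial K) :
    snd (Polynomial.aeval x h) = Polynomial.aeval (fst x) (Polynomial.derivative h) * snd x := by
  induction h using Polynomial.induction_on' with
  | add p q hp hq => simp [hp, hq, add_mul]
  | monomial n a =>
    rw [Polynomial.derivative_monomial, Polynomial.aeval_monomial, Polynomial.aeval_monomial,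
      snd_mul, snd_pow]
    have h1 : fst ((algebraMap K (DualNumber L)) a) = algebraMap K L a := rfl
    have h2 : snd ((algebraMap K (DualNumber L)) a) = 0 := rfl
    rw [h1, h2]
    simp
    ring

lemma fst_aeval {K L : Type*} [CommRing K] [CommRing L] [Algebra K L] (x : DualNumber L)
    (h : Polynomial K) :
    fst (Polynomial.aeval x h) = Polynomial.aeval (fst x) h :=
  (Polynomial.aeval_algHom_apply (fstHom K L L) x h).symm

/-- The homomorphism to the dual numbers given by a point and a derivation. -/
def tangentHom {K R L : Type*} [CommRing K] [CommRing R] [CommRing L] [Algebra K R] [Algebra K L]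
    (e : R →ₐ[K] L) (D : Derivation K R R) : R →ₐ[K] DualNumber L where
  toFun r := inl (e r) + inr (e (D r))
  map_one' := by simp
  map_mul' x y := by
    ext
    · simp
    · simp
      ring
  map_zero' := by simp
  map_add' x y := by
    ext <;> simp
  commutes' c := by
    ext
    · simp; rfl
    · simp; rfl

@[simp]
lemma fst_tangentHom {K R L : Type*} [CommRing K] [CommRing R] [CommRing L] [Algebra K R]
    [Algebra K L] (e : R →ₐ[K] L) (D : Derivation K R R) (r : R) :
    fst (tangentHom e D r) = e r := by
  simp [tangentHom]

@[simp]
lemma snd_tangentHom {K R L : Type*} [CommRing K] [CommRing R] [CommRing L] [Algebra K R]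
    [Algebra K L] (e : R →ₐ[K] L) (D : Derivation K R R) (r : R) :
    snd (tangentHom e D r) = e (D r) := by
  simp [tangentHom]

open IsLocalRing in
/-- A homomorphism to a local ring is unramified in terms of a tangent vector. -/
lemma map_comap_maximalIdeal_eq_iff {K O L R₀ : Type*} [Field K] [CharZero K] [CommRing O]
    [IsLocalRing O] [Field L] [Algebra K O] [Algebra K L] [Algebra.IsAlgebraic K L] [CommRing R₀]
    [Algebra K R₀] (τ : O →ₐ[K] DualNumber L) (h0 : ∀ a, fst (τ a) = 0 ↔ a ∈ maximalIdeal O)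
    (h1 : ∃ a ∈ maximalIdeal O, snd (τ a) ≠ 0)
    (h2 : ∀ a ∈ maximalIdeal O, snd (τ a) ≠ 0 → maximalIdeal O = Ideal.span {a})
    (θ : R₀ →ₐ[K] O) :
    ((maximalIdeal O).comap θ).map θ = maximalIdeal O ↔ ∃ z, snd (τ (θ z)) ≠ 0 := by
  constructor
  · intro h
    -- If all derivatives of elements of `R₀` vanish, then by the Leibniz rule so do those of the
    -- whole maximal ideal, which these elements generate.
    by_contra! hcon
    obtain ⟨a, ha, hane⟩ := h1
    rw [← h] at ha
    apply hane
    clear hane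
    induction ha using Submodule.span_induction with
    | mem x hx => obtain ⟨q, -, rfl⟩ := hx; exact hcon q
    | zero => simp
    | add x y _ _ hx hy => simp [hx, hy]
    | smul r x hx hx' =>
      have : x ∈ maximalIdeal O := by
        rw [← h]; exact hx
      simp [hx', (h0 x).mpr this]
  · rintro ⟨z, hz⟩
    refine le_antisymm Ideal.map_comap_le ?_
    -- The element `z` need not vanish at the point, but its minimal polynomial evaluated at `z`
    -- does, and separability keeps the derivative nonzero. This is a uniformizer coming from `R₀`.
    set y := fst (τ (θ z)) with hy
    have hint : IsIntegral K y := Algebra.IsIntegral.isIntegral y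
    have hq : fst (τ (θ (Polynomial.aeval z (minpoly K y)))) = 0 := by
      rw [← Polynomial.aeval_algHom_apply, ← Polynomial.aeval_algHom_apply, fst_aeval, ← hy,
        minpoly.aeval]
    have hq' : snd (τ (θ (Polynomial.aeval z (minpoly K y)))) ≠ 0 := by
      rw [← Polynomial.aeval_algHom_apply, ← Polynomial.aeval_algHom_apply, snd_aeval, ← hy]
      exact mul_ne_zero ((minpoly.irreducible hint).separable.aeval_derivative_ne_zero
        (minpoly.aeval K y)) hz
    have hmem := (h0 _).mp hq
    have hmem' := Ideal.mem_map_of_mem θ (Ideal.mem_comap.mpr hmem)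
    refine (h2 _ hmem hq').le.trans ?_
    rwa [Ideal.span_singleton_le_iff_mem]

end DualNumbers

/-! ### Homogenization of polynomials in one variable -/

section HomogenizedEvaluation

/-- The value at `(x, y)` of the homogenization of `h`. -/
def homogEval {K R : Type*} [CommSemiring K] [CommSemiring R] [Algebra K R] (h : Polynomial K)
    (x y : R) : R :=
  ∑ i ∈ Finset.range (h.natDegree + 1), algebraMap K R (h.coeff i) * x ^ i * y ^ (h.natDegree - i)

lemma map_homogEval {K R R' : Type*} [CommSemiring K] [CommSemiring R] [Algebra K R]
    [CommSemiring R'] [Algebra K R'] (φ : R →ₐ[K] R') (h : Polynomial K) (x y : R) :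
    φ (homogEval h x y) = homogEval h (φ x) (φ y) := by
  simp [homogEval]

lemma homogEval_mul {K R : Type*} [CommSemiring K] [CommSemiring R] [Algebra K R]
    (h : Polynomial K) (x y : R) :
    homogEval h (x * y) y = y ^ h.natDegree * Polynomial.aeval x h := by
  rw [homogEval, Polynomial.aeval_eq_sum_range, Finset.mul_sum]
  refine Finset.sum_congr rfl fun i hi => ?_
  obtain ⟨j, hj⟩ : ∃ j, h.natDegree = i + j :=
    ⟨h.natDegree - i, by rw [Finset.mem_range] at hi; omega⟩
  rw [Algebra.smul_def, hj, Nat.add_sub_cancel_left]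
  ring

lemma homogEval_zero {K R : Type*} [CommSemiring K] [CommSemiring R] [Algebra K R]
    {h : Polynomial K} (hh : h.Monic) (x : R) : homogEval h x 0 = x ^ h.natDegree := by
  rw [homogEval, Finset.sum_eq_single h.natDegree]
  · simp [hh]
  · intro i hi hne
    rw [Finset.mem_range] at hi
    rw [zero_pow (by omega), mul_zero]
  · simp

lemma homogEval_zero_left {K R : Type*} [CommSemiring K] [CommSemiring R] [Algebra K R]
    (h : Polynomial K) (y : R) :
    homogEval h 0 y = algebraMap K R (h.coeff 0) * y ^ h.natDegree := by
  rw [homogEval, Finset.sum_eq_single 0]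
  · simp
  · intro i _ hne
    rw [zero_pow hne]; simp
  · simp

lemma isHomogeneous_homogEval {K ι : Type*} [CommRing K] {F G : MvPolynomial ι K} {d : ℕ}
    (hF : F.IsHomogeneous d) (hG : G.IsHomogeneous d) (h : Polynomial K) :
    (homogEval h F G).IsHomogeneous (h.natDegree * d) := by
  refine MvPolynomial.IsHomogeneous.sum _ _ _ fun i hi => ?_
  have := (((MvPolynomial.isHomogeneous_C ι (h.coeff i)).mul (hF.pow i)).mul
    (hG.pow (h.natDegree - i)))
  have hd : h.natDegree * d = 0 + d * i + d * (h.natDegree - i) := by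
    obtain ⟨j, hj⟩ : ∃ j, h.natDegree = i + j :=
      ⟨h.natDegree - i, by rw [Finset.mem_range] at hi; omega⟩
    rw [hj, Nat.add_sub_cancel_left]
    ring
  rw [hd]
  exact this

end HomogenizedEvaluation

/-! ### Nowhere vanishing derivations and orders of vanishing -/

section TangentDerivation

open TensorProduct

/-- A derivation of the coordinate ring of a smooth affine curve which does not vanish anywhere. -/
structure IsTangentDerivation {K R : Type*} [CommRing K] [CommRing R] [Algebra K R]
    (D : Derivation K R R) : Prop where
  exists_notMem (m : Ideal R) [m.IsMaximal] : ∃ a ∈ m, D a ∉ m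
  mem_sq (m : Ideal R) [m.IsMaximal] {a : R} (ha : a ∈ m) (hDa : D a ∈ m) : a ∈ m ^ 2

/-- The residue field at m is finite and separable over K, hence étale. So in the conormal sequence
the map from m/m² to (R/m) ⊗ Ω is bijective: injective since it splits by smoothness, surjective
since the differentials of the residue field vanish. -/
lemma isTangentDerivation_of_equiv {K R : Type u} [Field K] [CharZero K] [CommRing R] [Algebra K R]
    [Algebra.FiniteType K R] [Algebra.FormallySmooth K R] (φ : Ω[R⁄K] ≃ₗ[R] R) :
    IsTangentDerivation (φ.toLinearMap.compDer (KaehlerDifferential.D K R)) := by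
  have key (m : Ideal R) [m.IsMaximal] :
      Function.Injective (KaehlerDifferential.kerCotangentToTensor K R (R ⧸ m)) ∧
      Function.Surjective (KaehlerDifferential.kerCotangentToTensor K R (R ⧸ m)) := by
    let _ : Field (R ⧸ m) := Ideal.Quotient.field m
    have hfin : Module.Finite K (R ⧸ m) := finite_of_finite_type_of_isJacobsonRing K (R ⧸ m)
    have hsurj : Function.Surjective (algebraMap R (R ⧸ m)) := Ideal.Quotient.mk_surjective
    have : Algebra.FormallyEtale K (R ⧸ m) := Algebra.FormallyEtale.of_isSeparable K (R ⧸ m)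
    have : Algebra.FormallySmooth K (R ⧸ m) := inferInstance
    have : Algebra.FormallyUnramified K (R ⧸ m) :=
      Algebra.FormallyUnramified.of_isSeparable K (R ⧸ m)
    constructor
    · obtain ⟨l, hl⟩ := (Algebra.FormallySmooth.iff_split_injection (R := K) hsurj).mp ‹_›
      exact Function.LeftInverse.injective (g := l) (LinearMap.congr_fun hl)
    · intro x
      refine (KaehlerDifferential.exact_kerCotangentToTensor_mapBaseChange K R (R ⧸ m) hsurj
        x).mp (Subsingleton.elim _ _)
  let Ψ (m : Ideal R) : (R ⧸ m) ⊗[R] Ω[R⁄K] ≃ₗ[R] (R ⧸ m) :=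
    (TensorProduct.congr (LinearEquiv.refl R _) φ) ≪≫ₗ (TensorProduct.rid R (R ⧸ m))
  have hΨ (m : Ideal R) (a : R) : Ψ m (1 ⊗ₜ KaehlerDifferential.D K R a) =
      Ideal.Quotient.mk m (φ (KaehlerDifferential.D K R a)) := by
    simp only [Ψ, LinearEquiv.trans_apply, TensorProduct.congr_tmul, LinearEquiv.refl_apply,
      TensorProduct.rid_tmul]
    rw [Algebra.smul_def, mul_one]
    rfl
  refine ⟨fun m hm => ?_, fun m hm a ha hDa => ?_⟩
  · obtain ⟨x, hx⟩ := (key m).2 ((Ψ m).symm 1)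
    obtain ⟨⟨a, ha⟩, rfl⟩ := Ideal.toCotangent_surjective _ x
    refine ⟨a, ?_, fun hcon => ?_⟩
    · simpa [RingHom.mem_ker, Ideal.Quotient.eq_zero_iff_mem] using ha
    · rw [KaehlerDifferential.kerCotangentToTensor_toCotangent, LinearEquiv.eq_symm_apply, hΨ,
        Ideal.Quotient.eq_zero_iff_mem.mpr (show φ (KaehlerDifferential.D K R a) ∈ m from hcon)]
        at hx
      exact zero_ne_one hx
  · have hker : RingHom.ker (algebraMap R (R ⧸ m)) = m := Ideal.mk_ker
    have ha' : a ∈ RingHom.ker (algebraMap R (R ⧸ m)) := by rwa [hker]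
    have h1 : KaehlerDifferential.kerCotangentToTensor K R (R ⧸ m)
        (Ideal.toCotangent _ ⟨a, ha'⟩) = 0 := by
      rw [KaehlerDifferential.kerCotangentToTensor_toCotangent, ← (Ψ m).map_eq_zero_iff, hΨ]
      exact Ideal.Quotient.eq_zero_iff_mem.mpr hDa
    rw [← map_zero (KaehlerDifferential.kerCotangentToTensor K R (R ⧸ m))] at h1
    have h2 := (Ideal.toCotangent_eq_zero _ _).mp ((key m).1 h1)
    change a ∈ _ at h2
    rwa [hker] at h2

namespace IsTangentDerivation

variable {K R : Type u} [Field K] [CommRing R] [Algebra K R]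
  {D : Derivation K R R}

/-- Differentiating `s * a ^ (k + 1) = 0` and multiplying by `s` gives a relation of the same kind
with exponent `k`. No domain hypothesis may be made here, as the lemma serves to prove reducedness.
-/
lemma mul_pow_ne_zero [CharZero K] (m : Ideal R) [m.IsMaximal] {a : R} (hDa : D a ∉ m) (k : ℕ) :
    ∀ s ∉ m, s * a ^ k ≠ 0 := by
  induction k with
  | zero =>
    intro s hs h
    apply hs
    rw [pow_zero, mul_one] at h
    rw [h]
    exact m.zero_mem
  | succ k ih =>
    intro s hs h
    have h1 := congrArg D h
    rw [map_zero, Derivation.leibniz, Derivation.leibniz_pow, Nat.add_sub_cancel] at h1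
    simp only [smul_eq_mul, nsmul_eq_mul] at h1
    have hk : ((k + 1 : ℕ) : R) ∉ m := by
      intro hk
      have h2 : algebraMap K R ((k + 1 : ℕ) : K) ∈ m := by simpa using hk
      exact ‹m.IsMaximal›.ne_top (Ideal.eq_top_of_isUnit_mem _ h2
        ((IsUnit.mk0 _ (Nat.cast_ne_zero.mpr k.succ_ne_zero)).map _))
    have hp := ‹m.IsMaximal›.isPrime
    refine ih (s * s * ((k + 1 : ℕ) : R) * D a) ?_ ?_
    · intro hmem
      rcases hp.mem_or_mem hmem with h3 | h3
      · rcases hp.mem_or_mem h3 with h4 | h4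
        · exact (hp.mem_or_mem h4).elim hs hs
        · exact hk h4
      · exact hDa h3
    · linear_combination s * h1 - D s * h

variable (hD : IsTangentDerivation D)

include hD

/-- Subtracting from `b` a multiple of `a` with the same derivative modulo `m` leaves an element of
`m ^ 2`. -/
lemma le_sup (m : Ideal R) [m.IsMaximal] {a : R} (ha : a ∈ m) (hDa : D a ∉ m) :
    m ≤ Ideal.span {a} ⊔ m ^ 2 := by
  intro b hb
  obtain ⟨r, t, ht, hr⟩ := Ideal.IsMaximal.exists_inv ‹m.IsMaximal› hDa
  have h1 : b - (D b * r) * a ∈ m ^ 2 := by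
    refine hD.mem_sq m (m.sub_mem hb (m.mul_mem_left _ ha)) ?_
    rw [map_sub, Derivation.leibniz, smul_eq_mul, smul_eq_mul]
    have h2 : D b - (D b * r * D a + a * D (D b * r)) = D b * t - a * D (D b * r) := by
      have : t = 1 - r * D a := by rw [← hr]; ring
      rw [this]; ring
    rw [h2]
    exact m.sub_mem (m.mul_mem_left _ ht) (m.mul_mem_right _ ha)
  have h2 : b = (D b * r) * a + (b - (D b * r) * a) := by ring
  rw [h2]
  exact add_mem (Ideal.mem_sup_left (Ideal.mul_mem_left _ _ (Ideal.mem_span_singleton_self a)))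
    (Ideal.mem_sup_right h1)

-- Nakayama's lemma applied to `le_sup`.
open IsLocalRing in
lemma maximalIdeal_eq_span [IsNoetherianRing R] (m : Ideal R) [m.IsMaximal] {O : Type*} [CommRing O]
    [IsLocalRing O] [Algebra R O] [IsLocalization.AtPrime O m] {a : R} (ha : a ∈ m)
    (hDa : D a ∉ m) : maximalIdeal O = Ideal.span {algebraMap R O a} := by
  have : IsNoetherianRing O := IsLocalization.isNoetherianRing m.primeCompl O inferInstance
  have h1 := Ideal.map_mono (f := algebraMap R O) (hD.le_sup m ha hDa)
  rw [Ideal.map_sup, Ideal.map_pow, IsLocalization.AtPrime.map_eq_maximalIdeal m O,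
    Ideal.map_span, Set.image_singleton] at h1
  refine le_antisymm ?_ ?_
  · refine Submodule.le_of_le_smul_of_le_jacobson_bot (I := maximalIdeal O)
      (IsNoetherian.noetherian _) (IsLocalRing.jacobson_eq_maximalIdeal ⊥ bot_ne_top).ge ?_
    rwa [smul_eq_mul, ← pow_two]
  · rw [Ideal.span_singleton_le_iff_mem, ← IsLocalization.AtPrime.map_eq_maximalIdeal m O]
    exact Ideal.mem_map_of_mem _ ha

/-- By Krull's intersection theorem a nonzero element of the local ring has a finite order `k`, and
the maximal ideal is generated by `a`. The factors outside `m` clear denominators. -/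
lemma exists_eq_mul_pow [IsNoetherianRing R] (m : Ideal R) [m.IsMaximal] {a : R} (ha : a ∈ m)
    (hDa : D a ∉ m) {r : R} (hr : ∀ s ∉ m, s * r ≠ 0) :
    ∃ k, ∃ s ∉ m, ∃ t ∉ m, s * r = t * a ^ k := by
  let O := Localization.AtPrime m
  have : IsNoetherianRing O := IsLocalization.isNoetherianRing m.primeCompl O inferInstance
  have hspan : IsLocalRing.maximalIdeal O = _ := hD.maximalIdeal_eq_span m (O := O) ha hDa
  set π := algebraMap R O a with hπ
  have hr0 : algebraMap R O r ≠ 0 := by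
    intro h
    obtain ⟨⟨s, hs⟩, h1⟩ := (IsLocalization.map_eq_zero_iff m.primeCompl O r).mp h
    exact hr s hs h1
  have h1 : ∃ k, algebraMap R O r ∉ IsLocalRing.maximalIdeal O ^ k := by
    by_contra! hcon
    have h2 : algebraMap R O r ∈ ⨅ k, IsLocalRing.maximalIdeal O ^ k := by
      simpa [Submodule.mem_iInf] using hcon
    rw [Ideal.iInf_pow_eq_bot_of_isLocalRing _ (IsLocalRing.maximalIdeal.isMaximal O).ne_top] at h2
    exact hr0 h2
  classical
  obtain ⟨k, hk⟩ : ∃ k, Nat.find h1 = k + 1 := by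
    refine Nat.exists_eq_succ_of_ne_zero fun h0 => ?_
    have := Nat.find_spec h1
    rw [h0] at this
    simp at this
  have h3 : algebraMap R O r ∈ IsLocalRing.maximalIdeal O ^ k := by
    by_contra hcon
    have := Nat.find_min' h1 hcon
    omega
  have h4 : algebraMap R O r ∉ IsLocalRing.maximalIdeal O ^ (k + 1) := by
    have := Nat.find_spec h1
    rwa [hk] at this
  rw [hspan, Ideal.span_singleton_pow, Ideal.mem_span_singleton'] at h3
  obtain ⟨w, hw⟩ := h3
  obtain ⟨⟨t, s⟩, hts⟩ := IsLocalization.surj m.primeCompl w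
  have ht : t ∉ m := by
    intro ht
    apply h4
    have h5 : w ∈ IsLocalRing.maximalIdeal O := by
      have h6 : algebraMap R O t ∈ IsLocalRing.maximalIdeal O := by
        rw [← IsLocalization.AtPrime.map_eq_maximalIdeal m O]
        exact Ideal.mem_map_of_mem _ ht
      rw [← hts] at h6
      exact ((IsLocalRing.maximalIdeal.isMaximal O).isPrime.mem_or_mem h6).resolve_right
        fun h7 => (IsLocalRing.mem_maximalIdeal _).mp h7 (IsLocalization.map_units O s)
    rw [← hw, pow_succ', hspan, Ideal.span_singleton_pow]
    rw [hspan] at h5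
    exact Ideal.mul_mem_mul h5 (Ideal.mem_span_singleton_self _)
  have h5 : algebraMap R O (s * r) = algebraMap R O (t * a ^ k) := by
    rw [map_mul, map_mul, map_pow, ← hts, ← hw]
    ring
  obtain ⟨⟨c, hc⟩, h6⟩ := (IsLocalization.eq_iff_exists m.primeCompl O).mp h5
  have hp := ‹m.IsMaximal›.isPrime
  refine ⟨k, c * s, fun h => (hp.mem_or_mem h).elim hc s.2, c * t,
    fun h => (hp.mem_or_mem h).elim hc ht, ?_⟩
  simp only at h6
  linear_combination h6

/-- A nonzero nilpotent element survives at a maximal ideal containing its annihilator. There it is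
a unit times a power of a uniformizer, and such powers are not nilpotent. -/
lemma isReduced [CharZero K] [IsNoetherianRing R] : IsReduced R := by
  refine ⟨fun r hr => ?_⟩
  by_contra hr0
  obtain ⟨m, hm, hle⟩ := Ideal.exists_le_maximal (Submodule.annihilator (Ideal.span {r})) (by
    intro h
    rw [Submodule.annihilator_eq_top_iff, Ideal.span_singleton_eq_bot] at h
    exact hr0 h)
  obtain ⟨a, ha, hDa⟩ := hD.exists_notMem m
  obtain ⟨k, s, hs, t, ht, h⟩ := hD.exists_eq_mul_pow m ha hDa (r := r) (by
    intro s hs h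
    exact hs (hle (Submodule.mem_annihilator_span_singleton _ _ |>.mpr h)))
  obtain ⟨N, hN⟩ := hr
  have h1 := congrArg (· ^ N) h
  simp only [mul_pow, hN, mul_zero, ← pow_mul] at h1
  exact mul_pow_ne_zero m hDa (k * N) (t ^ N)
    (fun h => ht (hm.isPrime.mem_of_pow_mem N h)) h1.symm

/-- A prime contained in m and containing `r` contains a uniformizer at m, hence all of m. So m is
one of the finitely many minimal primes over `r`. -/
lemma finite_setOf_mem [IsNoetherianRing R] [IsDomain R] {r : R} (hr : r ≠ 0) :
    {m : Ideal R | m.IsMaximal ∧ r ∈ m}.Finite := by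
  refine (Ideal.finite_minimalPrimes_of_isNoetherianRing R (Ideal.span {r})).subset ?_
  rintro m ⟨hm, hrm⟩
  refine ⟨⟨hm.isPrime, by rwa [Ideal.span_singleton_le_iff_mem]⟩, ?_⟩
  rintro q ⟨hq, hrq⟩ hqm
  rw [Ideal.span_singleton_le_iff_mem] at hrq
  obtain ⟨a, ha, hDa⟩ := hD.exists_notMem m
  have hne {x : R} (hx : x ≠ 0) : ∀ s ∉ m, s * x ≠ 0 := fun s hs h =>
    (mul_eq_zero.mp h).elim (fun h => hs (h ▸ m.zero_mem)) hx
  obtain ⟨k, s, hs, t, ht, h⟩ := hD.exists_eq_mul_pow m ha hDa (hne hr)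
  have haq : a ∈ q := by
    have h1 : t * a ^ k ∈ q := h ▸ q.mul_mem_left _ hrq
    exact hq.mem_of_pow_mem k ((hq.mem_or_mem h1).resolve_left fun h2 => ht (hqm h2))
  intro b hb
  rcases eq_or_ne b 0 with rfl | hb0
  · exact q.zero_mem
  obtain ⟨k', s', hs', t', ht', h'⟩ := hD.exists_eq_mul_pow m ha hDa (hne hb0)
  have hk' : k' ≠ 0 := by
    rintro rfl
    rw [pow_zero, mul_one] at h'
    exact ht' (h' ▸ m.mul_mem_left _ hb)
  have h2 : s' * b ∈ q := by
    rw [h']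
    exact q.mul_mem_left _ (q.pow_mem_of_mem haq _ (Nat.pos_of_ne_zero hk'))
  exact (hq.mem_or_mem h2).resolve_left fun h3 => hs' (hqm h3)

/-- The hypothesis `h` says that r / y^d has derivative zero. In characteristic zero differentiation
lowers a positive order of vanishing by exactly one, so a nonzero function vanishing at m has
nonzero derivative. -/
lemma eq_zero_of_mem [CharZero K] [IsNoetherianRing R] [IsDomain R] (m : Ideal R) [m.IsMaximal]
    {y r : R} (hy : y ∉ m) {d : ℕ} (h : y * D r = d * r * D y) (hr : r ∈ m) : r = 0 := by
  by_contra hr0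
  obtain ⟨a, ha, hDa⟩ := hD.exists_notMem m
  have hne {x : R} (hx : x ≠ 0) : ∀ s ∉ m, s * x ≠ 0 := fun s hs h =>
    (mul_eq_zero.mp h).elim (fun h => hs (h ▸ m.zero_mem)) hx
  obtain ⟨k, s, hs, t, ht, hst⟩ := hD.exists_eq_mul_pow m ha hDa (hne hr0)
  obtain ⟨k, rfl⟩ : ∃ k', k = k' + 1 := Nat.exists_eq_succ_of_ne_zero (by
    rintro rfl
    rw [pow_zero, mul_one] at hst
    exact ht (hst ▸ m.mul_mem_left _ hr))
  have h1 := congrArg D hst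
  rw [Derivation.leibniz, Derivation.leibniz, Derivation.leibniz_pow, Nat.add_sub_cancel] at h1
  simp only [smul_eq_mul, nsmul_eq_mul] at h1
  have ha0 : a ^ k ≠ 0 := by
    intro h0
    exact mul_pow_ne_zero m hDa k 1 (fun h => ‹m.IsMaximal›.ne_top
      ((Ideal.eq_top_iff_one _).mpr h)) (by rw [h0, mul_zero])
  have h2 : s * y * t * ((k + 1 : ℕ) : R) * D a =
      a * ((y * D s + s * d * D y) * t - s * y * D t) := by
    apply mul_right_cancel₀ ha0
    linear_combination s ^ 2 * h - s * y * h1 + (y * D s + s * d * D y) * hst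
  have hk : ((k + 1 : ℕ) : R) ∉ m := by
    intro hk
    have h2 : algebraMap K R ((k + 1 : ℕ) : K) ∈ m := by simpa using hk
    exact ‹m.IsMaximal›.ne_top (Ideal.eq_top_of_isUnit_mem _ h2
      ((IsUnit.mk0 _ (Nat.cast_ne_zero.mpr k.succ_ne_zero)).map _))
  have h3 : s * y * t * ((k + 1 : ℕ) : R) * D a ∈ m := h2 ▸ m.mul_mem_right _ ha
  have hp := ‹m.IsMaximal›.isPrime
  simp only [hp.mul_mem_iff_mem_or_mem] at h3
  tauto

/-- A function with vanishing differential is constant. -/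
lemma exists_homogEval_eq_zero [CharZero K] [Algebra.FiniteType K R] [IsDomain R] {x y : R}
    (hy : y ≠ 0) (h : x * D y = y * D x) :
    ∃ g : Polynomial K, g.Monic ∧ Irreducible g ∧ homogEval g x y = 0 := by
  have : IsNoetherianRing R := Algebra.FiniteType.isNoetherianRing K R
  have : IsJacobsonRing R := isJacobsonRing_of_finiteType (A := K)
  -- In a Jacobson domain the maximal ideals intersect in zero.
  obtain ⟨m, hm, hym⟩ : ∃ m : Ideal R, m.IsMaximal ∧ y ∉ m := by
    by_contra! hcon
    have h1 : y ∈ (⊥ : Ideal R).jacobson := by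
      rw [Ideal.jacobson, Ideal.mem_sInf]
      intro I hI
      exact hcon I hI.2
    rw [IsJacobsonRing.out ‹_› (Ideal.isPrime_bot (α := R)).isRadical] at h1
    exact hy h1
  let _ : Field (R ⧸ m) := Ideal.Quotient.field m
  have hfin : Module.Finite K (R ⧸ m) := finite_of_finite_type_of_isJacobsonRing K (R ⧸ m)
  let q := Ideal.Quotient.mkₐ K m
  have hqy : q y ≠ 0 := fun h => hym (Ideal.Quotient.eq_zero_iff_mem.mp h)
  set z := q x / q y with hz
  have hint : IsIntegral K z := Algebra.IsIntegral.isIntegral z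
  -- Here `z` is the value of x/y at `m`. The minimal polynomial of `z` applied to x/y vanishes at
  -- `m` and has derivative zero, so it is zero.
  refine ⟨minpoly K z, minpoly.monic hint, minpoly.irreducible hint, ?_⟩
  set g := minpoly K z
  refine hD.eq_zero_of_mem m hym (d := g.natDegree) ?_ ?_
  · have hpow (v : R) (hv : v * D y = y * D v) (i : ℕ) : y * D (v ^ i) = i * v ^ i * D y := by
      rcases i with _ | i
      · simp
      · rw [Derivation.leibniz_pow, Nat.add_sub_cancel]
        simp only [smul_eq_mul, nsmul_eq_mul]
        linear_combination -(((i + 1 : ℕ) : R) * v ^ i) * hv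
    rw [homogEval, map_sum, Finset.mul_sum, Finset.mul_sum, Finset.sum_mul]
    refine Finset.sum_congr rfl fun i hi => ?_
    obtain ⟨j, hj⟩ : ∃ j, g.natDegree = i + j :=
      ⟨g.natDegree - i, by rw [Finset.mem_range] at hi; omega⟩
    rw [hj, Nat.add_sub_cancel_left, mul_assoc (algebraMap K R _), ← Algebra.smul_def,
      Derivation.map_smul, Algebra.smul_def, Algebra.smul_def, Derivation.leibniz]
    simp only [smul_eq_mul]
    push_cast
    linear_combination (algebraMap K R (g.coeff i)) * (x ^ i * hpow y rfl j + y ^ j * hpow x h i)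
  · rw [← Ideal.Quotient.eq_zero_iff_mem]
    change q _ = 0
    rw [map_homogEval, show q x = z * q y by rw [hz, div_mul_cancel₀ _ hqy], homogEval_mul,
      minpoly.aeval, mul_zero]

end IsTangentDerivation

end TangentDerivation

/-! ### Affine charts of a smooth projective curve -/

section Charts

open MvPolynomial HomogeneousLocalization

/-- Locally the module of differentials is free of rank one, and a generator turns the universal
derivation into a nowhere vanishing one. -/
lemma exists_chart_of_smooth {K : Type u} [Field K] [CharZero K] {X : Scheme.{u}}
    (f : X ⟶ Spec (CommRingCat.of K)) [SmoothOfRelativeDimension 1 f] (W : X.Opens) (x : X)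
    (hx : x ∈ W) :
    ∃ (R : Type u) (_ : CommRing R) (_ : Algebra K R) (_ : Algebra.FiniteType K R)
      (D : Derivation K R R) (_ : IsTangentDerivation D)
      (g : Spec (CommRingCat.of R) ⟶ X) (_ : IsOpenImmersion g),
      g ≫ f = Spec.map (CommRingCat.ofHom (algebraMap K R)) ∧ x ∈ Set.range g ∧
      Set.range g ⊆ W := by
  have hW : SmoothOfRelativeDimension (0 + 1) (W.ι ≫ f) := inferInstance
  obtain ⟨U, hU, V, hV, hxV, e, hsm⟩ :=
    hW.exists_isStandardSmoothOfRelativeDimension ⟨x, hx⟩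
  obtain rfl : U = ⊤ := by
    refine top_le_iff.mp fun y _ => ?_
    have := e hxV
    rwa [Subsingleton.elim y ((W.ι ≫ f) ⟨x, hx⟩)]
  let h : CommRingCat.of K ⟶ Γ(W, V) := (Scheme.ΓSpecIso _).inv ≫ (W.ι ≫ f).appLE ⊤ V e
  have hh : h.hom.IsStandardSmoothOfRelativeDimension 1 := by
    exact RingHom.isStandardSmoothOfRelativeDimension_respectsIso.right _
      (Scheme.ΓSpecIso (CommRingCat.of K)).symm.commRingCatIsoToRingEquiv hsm
  let _ : Algebra K Γ(W, V) := h.hom.toAlgebra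
  have : Algebra.IsStandardSmoothOfRelativeDimension 1 K Γ(W, V) := hh
  have : Algebra.IsStandardSmooth K Γ(W, V) := this.isStandardSmooth
  have hnt : Nontrivial Γ(W, V) := by
    have : Nonempty V := ⟨⟨x, hx⟩, hxV⟩
    infer_instance
  have hrk := Algebra.IsStandardSmoothOfRelativeDimension.rank_kaehlerDifferential (R := K)
    (S := Γ(W, V)) 1
  have hfr : Module.finrank Γ(W, V) Ω[Γ(W, V)⁄K] = 1 := by
    rw [Module.finrank, hrk]; simp
  let φ : Ω[Γ(W, V)⁄K] ≃ₗ[Γ(W, V)] Γ(W, V) :=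
    LinearEquiv.ofFinrankEq _ _ (by rw [hfr, Module.finrank_self])
  refine ⟨Γ(W, V), inferInstance, inferInstance, inferInstance, _,
    isTangentDerivation_of_equiv φ, hV.fromSpec ≫ W.ι, inferInstance, ?_, ?_, ?_⟩
  · have h1 := IsAffineOpen.SpecMap_appLE_fromSpec (W.ι ≫ f) hU hV e
    have h2 : hU.fromSpec = Spec.map (Scheme.ΓSpecIso (CommRingCat.of K)).inv := by
      rw [← Scheme.isoSpec_Spec_inv]
      exact IsAffineOpen.fromSpec_top
    rw [Category.assoc, ← h1, h2, ← Spec.map_comp]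
    rfl
  · have : (⟨x, hx⟩ : W) ∈ Set.range hV.fromSpec := by rwa [hV.range_fromSpec]
    obtain ⟨y, hy⟩ := this
    refine ⟨y, ?_⟩
    rw [Scheme.Hom.comp_apply, hy]
    rfl
  · rintro _ ⟨y, rfl⟩
    rw [Scheme.Hom.comp_apply]
    exact (hV.fromSpec y).2

variable {K : Type u} [Field K] {n : ℕ}

lemma exists_mem_basicOpen_X (y : Proj (gradingByDegree K n)) :
    ∃ j : Fin (n + 1), y ∈ Proj.basicOpen (gradingByDegree K n) (X j) := by
  have h := Proj.iSup_basicOpen_eq_top (gradingByDegree K n) (fun j : Fin (n + 1) => X j) (by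
    intro p hp
    rw [HomogeneousIdeal.mem_iff, HomogeneousIdeal.mem_irrelevant_iff, GradedRing.proj_apply] at hp
    rw [← Set.image_univ, mem_ideal_span_X_image]
    intro d hd
    by_contra! hcon
    have hd0 : d = 0 := by
      ext i
      exact hcon i (Set.mem_univ i)
    subst hd0
    rw [mem_support_iff] at hd
    apply hd
    have h1 := congrArg (coeff 0) hp
    rwa [show ((DirectSum.decompose (gradingByDegree K n) p 0 : gradingByDegree K n 0) :
      MvPolynomial _ K) =
      homogeneousComponent 0 p from decomposition.decompose'_apply p 0,
      coeff_homogeneousComponent, if_pos (by simp)] at h1)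
  exact TopologicalSpace.Opens.mem_iSup.mp (h.ge (Set.mem_univ y))

/-- Proj is proper over the spectrum of the degree-zero part, and the latter consists of constants.
-/
instance isProper_projHom : IsProper (projHom K n) := by
  have h1 : Algebra.FiniteType (gradingByDegree K n 0) (MvPolynomial (Fin (n + 1)) K) :=
    have : IsScalarTower K (gradingByDegree K n 0) (MvPolynomial (Fin (n + 1)) K) :=
      ⟨fun a b c => smul_mul_assoc a (b : MvPolynomial (Fin (n + 1)) K) c⟩
    Algebra.FiniteType.of_restrictScalars_finiteType K _ _
  have h2 : IsClosedImmersion (Spec.map (CommRingCat.ofHom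
    (algebraMap K (gradingByDegree K n 0)))) := by
    refine IsClosedImmersion.spec_of_surjective _ ?_
    rintro ⟨p, hp⟩
    have hp' : p.totalDegree = 0 :=
      Nat.le_zero.mp (IsHomogeneous.totalDegree_le hp)
    refine ⟨coeff 0 p, Subtype.ext ?_⟩
    exact (totalDegree_eq_zero_iff_eq_C.mp hp').symm
  infer_instance

/-- An affine chart of a smooth curve in projective space: a smooth affine open subscheme on which
some coordinate has no zero, together with a nowhere vanishing derivation. -/
structure Chart {X : Scheme.{u}} (ι : X ⟶ Proj (gradingByDegree K n)) where
  /-- the coordinate ring of the chart -/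
  ring : Type u
  [commRing : CommRing ring]
  [algebra : Algebra K ring]
  [isDomain : IsDomain ring]
  [finiteType : Algebra.FiniteType K ring]
  /-- a nowhere vanishing derivation -/
  der : Derivation K ring ring
  isTangentDerivation : IsTangentDerivation der
  /-- the inclusion of the chart -/
  map : Spec (CommRingCat.of ring) ⟶ X
  [isOpenImmersion : IsOpenImmersion map]
  /-- evaluation of polynomials on the chart -/
  eval : MvPolynomial (Fin (n + 1)) K →ₐ[K] ring
  /-- the index of a coordinate without zeros -/
  index : Fin (n + 1)
  eval_index : eval (MvPolynomial.X index) = 1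
  span_eval : Ideal.span (Set.range fun j => eval (MvPolynomial.X j)) = ⊤
  map_comp : map ≫ ι = toProj eval span_eval

attribute [instance] Chart.commRing Chart.algebra Chart.isDomain Chart.finiteType
  Chart.isOpenImmersion

variable [CharZero K] {X : Scheme.{u}} (ι : X ⟶ Proj (gradingByDegree K n))
  [SmoothOfRelativeDimension 1 (ι ≫ projHom K n)] [IrreducibleSpace X]

/-- The chart ring is a domain because it is reduced, by the derivation, and its spectrum is open in
an irreducible space. -/
lemma exists_chart (x : X) : ∃ c : Chart ι, x ∈ Set.range c.map := by
  obtain ⟨j, hj⟩ := exists_mem_basicOpen_X (ι x)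
  obtain ⟨R, _, _, _, D, hD, g, _, hg, hx, hgW⟩ := exists_chart_of_smooth (ι ≫ projHom K n)
    (ι ⁻¹ᵁ Proj.basicOpen (gradingByDegree K n) (MvPolynomial.X j)) x hj
  have : IsNoetherianRing R := Algebra.FiniteType.isNoetherianRing K R
  have : IsReduced R := hD.isReduced
  have : Nonempty (Spec (CommRingCat.of R)) := by
    obtain ⟨y, -⟩ := hx
    exact ⟨y⟩
  have hirr : IrreducibleSpace (Spec (CommRingCat.of R)) := g.isOpenEmbedding.irreducibleSpace
  have : IsDomain R := by
    have h1 := PrimeSpectrum.irreducibleSpace_iff_isPrime_nilradical.mp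
      (show IrreducibleSpace (PrimeSpectrum R) from hirr)
    rw [nilradical_eq_zero] at h1
    exact IsDomain.of_bot_isPrime R
  obtain ⟨a, ha, haj, h⟩ := exists_toProj_eq (g ≫ ι) (by rw [Category.assoc, hg]) j (fun p => by
    rw [Scheme.Hom.comp_apply]
    exact hgW ⟨p, rfl⟩)
  exact ⟨⟨R, D, hD, g, a, j, haj, ha, h⟩, hx⟩

lemma exists_finite_charts [CompactSpace X] :
    ∃ c : X → Chart ι, (Set.range c).Finite ∧ ∀ x : X, x ∈ Set.range (c x).map := by
  choose c hc using exists_chart ι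
  obtain ⟨t, ht⟩ := CompactSpace.elim_nhds_subcover (fun x => Set.range (c x).map) fun x =>
    ((c x).map.isOpenEmbedding.isOpen_range).mem_nhds (hc x)
  have h (x : X) : ∃ y ∈ t, x ∈ Set.range (c y).map := by
    simpa using ht.ge (Set.mem_univ x)
  choose k hk hkx using h
  refine ⟨fun x => c (k x), (t.finite_toSet.image c).subset ?_, hkx⟩
  rintro _ ⟨x, rfl⟩
  exact ⟨k x, hk x, rfl⟩

end Charts

/-! ### Geometric points and forms on charts -/

section ChartPoints

open MvPolynomial HomogeneousLocalization

section

variable {K : Type u} [Field K] {n : ℕ} {L : Type u} [Field L] [Algebra K L]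

/-- Algebraic points are closed, so an inclusion between their homogeneous ideals is an equality.
Concretely, homogenizing the minimal polynomial of a ratio of two forms at `α` gives a form
vanishing at `α`, hence at `β`. -/
lemma eq_zero_of_forall_isHomogeneous [Algebra.IsAlgebraic K L]
    {α β : MvPolynomial (Fin (n + 1)) K →ₐ[K] L} (hα : ∃ j, α (MvPolynomial.X j) ≠ 0)
      (hβ : ∃ j, β (MvPolynomial.X j) ≠ 0)
    (h : ∀ (d : ℕ) (F : MvPolynomial (Fin (n + 1)) K), F.IsHomogeneous d → α F = 0 → β F = 0)
    {d : ℕ} {F : MvPolynomial (Fin (n + 1)) K} (hF : F.IsHomogeneous d) (h0 : β F = 0) :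
    α F = 0 := by
  obtain ⟨j, hj⟩ := hα
  obtain ⟨k, hk⟩ := hβ
  have key {m : ℕ} {G H : MvPolynomial (Fin (n + 1)) K} (hG : G.IsHomogeneous m)
      (hH : H.IsHomogeneous m) (hH0 : α H ≠ 0) :
      homogEval (minpoly K (α G / α H)) (β G) (β H) = 0 := by
    rw [← map_homogEval]
    refine h _ _ (isHomogeneous_homogEval hG hH _) ?_
    rw [map_homogEval]
    have h1 := homogEval_mul (minpoly K (α G / α H)) (α G / α H) (α H)
    rwa [div_mul_cancel₀ _ hH0, minpoly.aeval, mul_zero] at h1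
  have hint (x : L) : IsIntegral K x := Algebra.IsIntegral.isIntegral x
  -- If `X j` vanished at `β`, only the leading term of the homogenized polynomial would remain,
  -- forcing `β (X k) = 0`.
  have hjβ : β (MvPolynomial.X j) ≠ 0 := by
    intro hjβ
    have h1 := key (isHomogeneous_X K k) (isHomogeneous_X K j) hj
    rw [hjβ, homogEval_zero (minpoly.monic (hint _))] at h1
    exact hk (pow_eq_zero_iff (minpoly.natDegree_pos (hint _)).ne' |>.mp h1)
  by_contra hcon
  -- As `F` vanishes at `β`, only the constant term remains; it is nonzero if `α F ≠ 0`.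
  have h1 := key hF (by simpa using (isHomogeneous_X K j).pow d) (by
    rw [map_pow]; exact pow_ne_zero d hj)
  rw [h0, homogEval_zero_left, mul_eq_zero] at h1
  rcases h1 with h1 | h1
  · rw [map_eq_zero] at h1
    exact minpoly.coeff_zero_ne_zero (hint _) (div_ne_zero hcon (by
      rw [map_pow]; exact pow_ne_zero d hj)) h1
  · exact pow_ne_zero _ (by rw [map_pow]; exact pow_ne_zero d hjβ) h1

/-- Components of degree zero are not covered by the hypothesis; multiplication by a coordinate that
does not vanish at `y` raises the degree. -/
lemma eq_of_mem_basicOpen_iff {x y : Proj (gradingByDegree K n)}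
    (h : ∀ (d : ℕ) (_ : 0 < d) (F : MvPolynomial (Fin (n + 1)) K), F.IsHomogeneous d →
      (x ∈ Proj.basicOpen (gradingByDegree K n) F ↔ y ∈ Proj.basicOpen (gradingByDegree K n) F)) :
    x = y := by
  suffices key : ∀ x y : Proj (gradingByDegree K n), (∀ (d : ℕ) (_ : 0 < d)
      (F : MvPolynomial (Fin (n + 1)) K), F.IsHomogeneous d →
      (x ∈ Proj.basicOpen (gradingByDegree K n) F ↔ y ∈ Proj.basicOpen (gradingByDegree K n) F)) →
      x.asHomogeneousIdeal.toIdeal ≤ y.asHomogeneousIdeal.toIdeal by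
    refine ProjectiveSpectrum.ext (HomogeneousIdeal.toIdeal_injective (le_antisymm (key x y h)
      (key y x fun d hd F hF => (h d hd F hF).symm)))
  intro x y h F hF
  obtain ⟨j, hj⟩ := exists_mem_basicOpen_X y
  have hF' (i : ℕ) : homogeneousComponent i F ∈ x.asHomogeneousIdeal.toIdeal := by
    have := x.asHomogeneousIdeal.isHomogeneous i hF
    rwa [show ((DirectSum.decompose (gradingByDegree K n) F i : gradingByDegree K n i) :
      MvPolynomial _ K) = homogeneousComponent i F from decomposition.decompose'_apply F i] at this
  rw [← sum_homogeneousComponent F]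
  refine sum_mem fun i _ => ?_
  have hi := homogeneousComponent_isHomogeneous i F
  by_contra hcon
  have h1 := (h (i + 1) (Nat.succ_pos i) _ (hi.mul (isHomogeneous_X K j))).mpr (by
    intro hmem
    exact (y.isPrime.mem_or_mem hmem).elim hcon hj)
  exact h1 (Ideal.mul_mem_right _ _ (hF' i))

end

variable {K : Type u} [Field K] {n : ℕ} {X : Scheme.{u}} {ι : X ⟶ Proj (gradingByDegree K n)}
  {L : Type u} [Field L] [Algebra K L]

instance (c : Chart ι) : IsNoetherianRing c.ring := Algebra.FiniteType.isNoetherianRing K c.ring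

namespace Chart

lemma isUnit_eval_index (c : Chart ι) : IsUnit (c.eval (MvPolynomial.X c.index)) := by
  rw [c.eval_index]; exact isUnit_one

/-- The `L`-rational point of a chart given by a homomorphism from its coordinate ring. -/
def point (c : Chart ι) (e : c.ring →ₐ[K] L) : Spec (CommRingCat.of L) ⟶ X :=
  Spec.map (CommRingCat.ofHom e.toRingHom) ≫ c.map

lemma exists_eq_point (c : Chart ι) (P : Spec (CommRingCat.of L) ⟶ X)
    (hP : P ≫ ι ≫ projHom K n = Spec.map (CommRingCat.ofHom (algebraMap K L)))
    (h : P (IsLocalRing.closedPoint L) ∈ Set.range c.map) :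
    ∃ e : c.ring →ₐ[K] L, P = c.point e := by
  have h1 : Set.range P ⊆ Set.range c.map := by
    rintro _ ⟨x, rfl⟩
    have : Subsingleton (PrimeSpectrum L) := inferInstance
    rwa [show x = IsLocalRing.closedPoint L from Subsingleton.elim (α := PrimeSpectrum L) _ _]
  have h2 := IsOpenImmersion.lift_fac c.map P h1
  set Q := IsOpenImmersion.lift c.map P h1 with hQ
  obtain ⟨e, he⟩ := Spec.map_surjective Q
  have h3 : Spec.map (CommRingCat.ofHom (algebraMap K L)) =
      Spec.map e ≫ Spec.map (CommRingCat.ofHom (algebraMap K c.ring)) := by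
    rw [← hP, ← h2, ← he, Category.assoc, ← Category.assoc c.map, c.map_comp, toProj_comp_hom]
  rw [← Spec.map_comp] at h3
  have h4 := Spec.map_injective h3
  refine ⟨{ e.hom with commutes' := fun r => ?_ }, ?_⟩
  · exact (congr($(h4).hom r)).symm
  · rw [← h2, ← he]
    rfl

lemma ker_isMaximal [Algebra.IsAlgebraic K L] (c : Chart ι) (e : c.ring →ₐ[K] L) :
    (RingHom.ker e).IsMaximal := by
  have h1 : Algebra.IsIntegral K (c.ring ⧸ RingHom.ker e) :=
    Algebra.IsIntegral.of_injective (Ideal.kerLiftAlg e) (Ideal.kerLiftAlg_injective e)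
  have := RingHom.ker_isPrime e
  exact Ideal.Quotient.maximal_of_isField _
    (isField_of_isIntegral_of_isField' (R := K) (Field.toIsField K))

lemma point_closedPoint (c : Chart ι) (e : c.ring →ₐ[K] L) :
    c.point e (IsLocalRing.closedPoint L) =
      c.map (⟨RingHom.ker e, RingHom.ker_isPrime e⟩ : PrimeSpectrum c.ring) := by
  refine congrArg c.map (PrimeSpectrum.ext ?_)
  change (IsLocalRing.maximalIdeal L).comap e.toRingHom = _
  rw [IsLocalRing.maximalIdeal_eq_bot]
  rfl

lemma mem_basicOpen_iff (c : Chart ι) (p : PrimeSpectrum c.ring) {F : MvPolynomial (Fin (n + 1)) K}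
    {d : ℕ} (hd : 0 < d) (hF : F.IsHomogeneous d) :
    ι (c.map p) ∈ Proj.basicOpen (gradingByDegree K n) F ↔ c.eval F ∉ p.asIdeal := by
  have h := toProj_mem_basicOpen_iff c.eval c.span_eval p hd hF
  rw [← c.map_comp] at h
  exact h

/-- Nonempty open subsets of an irreducible space meet, so vanishing identically does not depend on
the chart. -/
lemma eval_ne_zero [IrreducibleSpace X] (c c' : Chart ι) {F : MvPolynomial (Fin (n + 1)) K}
    {d : ℕ} (hd : 0 < d) (hF : F.IsHomogeneous d) (h : c.eval F ≠ 0) : c'.eval F ≠ 0 := by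
  let U := ι ⁻¹ᵁ Proj.basicOpen (gradingByDegree K n) F
  have hU : (U : Set X).Nonempty :=
    ⟨c.map (⊥ : PrimeSpectrum c.ring), (c.mem_basicOpen_iff ⊥ hd hF).mpr (by simpa using h)⟩
  have hV : (Set.range c'.map).Nonempty := ⟨c'.map (⊥ : PrimeSpectrum c'.ring), ⟨_, rfl⟩⟩
  obtain ⟨_, hx, p, rfl⟩ := nonempty_preirreducible_inter U.2
    c'.map.isOpenEmbedding.isOpen_range hU hV
  intro h0
  exact (c'.mem_basicOpen_iff p hd hF).mp hx (by rw [h0]; exact zero_mem _)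

/-- Only finitely many maximal ideals contain `r`, and each residue field, being finite over K, has
finitely many embeddings into `L`. -/
lemma finite_setOf_apply_eq_zero [Algebra.IsAlgebraic K L] [CharZero K] (c : Chart ι)
    {r : c.ring} (hr : r ≠ 0) : {e : c.ring →ₐ[K] L | e r = 0}.Finite := by
  refine Set.Finite.subset (Set.Finite.biUnion (c.isTangentDerivation.finite_setOf_mem hr)
    (t := fun m => {e : c.ring →ₐ[K] L | RingHom.ker e = m}) ?_) ?_
  · rintro m ⟨hm, -⟩
    let _ : Field (c.ring ⧸ m) := Ideal.Quotient.field m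
    have hfin : Module.Finite K (c.ring ⧸ m) := finite_of_finite_type_of_isJacobsonRing K _
    refine (Set.finite_range fun f : (c.ring ⧸ m) →ₐ[K] L => f.comp (Ideal.Quotient.mkₐ K m)).subset
      fun e he => ?_
    refine ⟨Ideal.Quotient.liftₐ m e fun a ha => ?_, ?_⟩
    · rwa [← (show RingHom.ker e = m from he)] at ha
    · ext; rfl
  · intro e he
    rw [Set.mem_iUnion₂]
    exact ⟨RingHom.ker e, ⟨c.ker_isMaximal e, he⟩, rfl⟩

/-- A closed immersion is surjective on stalks. So a uniformizer agrees, up to factors outside `m`,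
with a dehomogenized form, which then has a simple zero as well. -/
lemma exists_isHomogeneous_of_isClosedImmersion [IsClosedImmersion ι] (c : Chart ι)
    (m : Ideal c.ring) [hm : m.IsMaximal] :
    ∃ (d : ℕ) (F : MvPolynomial (Fin (n + 1)) K), F.IsHomogeneous d ∧ c.eval F ∈ m ∧
      c.der (c.eval F) ∉ m := by
  obtain ⟨a, ha, hDa⟩ := c.isTangentDerivation.exists_notMem m
  let θ := awayLift (gradingByDegree K n) c.eval.toRingHom c.isUnit_eval_index
  have h1 : c.map ≫ ι = Spec.map (CommRingCat.ofHom θ) ≫ Proj.awayι (gradingByDegree K n)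
      (MvPolynomial.X c.index) (X_mem_grading c.index) one_pos := by
    rw [c.map_comp]
    exact toProj_eq_awayι _ _ _ _ _
  have h2 : SurjectiveOnStalks (Spec.map (CommRingCat.ofHom θ) ≫ Proj.awayι (gradingByDegree K n)
      (MvPolynomial.X c.index) (X_mem_grading c.index) one_pos) := by
    rw [← h1]; infer_instance
  have h3 : SurjectiveOnStalks (Spec.map (CommRingCat.ofHom θ)) :=
    SurjectiveOnStalks.of_comp _ (Proj.awayι
      (gradingByDegree K n) (MvPolynomial.X c.index) (X_mem_grading c.index) one_pos)
  rw [SurjectiveOnStalks.Spec_iff] at h3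
  obtain ⟨x, r, s, hs, hr, h⟩ := RingHom.surjectiveOnStalks_iff_forall_maximal'.mp h3 m hm a
  obtain ⟨k, F, hF, rfl⟩ := Away.mk_surjective (gradingByDegree K n) (X_mem_grading c.index) x
  have hF' : F.IsHomogeneous k := by simpa using hF
  have hθ : θ (Away.mk (gradingByDegree K n) (X_mem_grading c.index) k F hF) = c.eval F := by
    have := awayLift_mk_mul (gradingByDegree K n) c.eval.toRingHom c.isUnit_eval_index
      (X_mem_grading c.index) k F hF
    rw [show c.eval.toRingHom (MvPolynomial.X c.index) = 1 from c.eval_index, one_pow, mul_one]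
      at this
    exact this
  change s * θ r * a = s * θ _ at h
  change θ r ∉ m at hr
  rw [hθ] at h
  have hp := hm.isPrime
  have hFm : c.eval F ∈ m := by
    have : s * c.eval F ∈ m := by rw [← h]; exact m.mul_mem_left _ ha
    exact (hp.mem_or_mem this).resolve_left hs
  refine ⟨k, F, hF', hFm, fun hD => ?_⟩
  have h4 := congrArg c.der h
  rw [Derivation.leibniz, Derivation.leibniz c.der s (c.eval F)] at h4
  simp only [smul_eq_mul] at h4
  have h5 : s * θ r * c.der a ∈ m := by
    have h6 : s * θ r * c.der a = s * c.der (c.eval F) + c.eval F * c.der s -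
      a * c.der (s * θ r) := by
      linear_combination h4
    rw [h6]
    exact m.sub_mem (m.add_mem (m.mul_mem_left _ hD) (m.mul_mem_right _ hFm)) (m.mul_mem_right _ ha)
  rcases hp.mem_or_mem h5 with h7 | h7
  · exact (hp.mem_or_mem h7).elim hs hr
  · exact hDa h7

end Chart

/-- Otherwise the same forms vanish at both points, by `eq_zero_of_forall_isHomogeneous`, and the
points have the same image under the injective `ι`. -/
lemma Chart.exists_isHomogeneous_of_ne [Algebra.IsAlgebraic K L] [IsClosedImmersion ι]
    (c c' : Chart ι) (e : c.ring →ₐ[K] L) (e' : c'.ring →ₐ[K] L)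
    (h : c.point e (IsLocalRing.closedPoint L) ≠ c'.point e' (IsLocalRing.closedPoint L)) :
    ∃ (d : ℕ) (F : MvPolynomial (Fin (n + 1)) K), F.IsHomogeneous d ∧ e (c.eval F) = 0 ∧
      e' (c'.eval F) ≠ 0 := by
  by_contra! hcon
  apply h
  have hinj : Function.Injective ι := ι.isClosedEmbedding.injective
  apply hinj
  rw [point_closedPoint, point_closedPoint]
  have hne (c : Chart ι) (e : c.ring →ₐ[K] L) : ∃ j, (e.comp c.eval) (MvPolynomial.X j) ≠ 0 :=
    ⟨c.index, by simp [c.eval_index]⟩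
  have h2 (d : ℕ) (F : MvPolynomial (Fin (n + 1)) K) (hF : F.IsHomogeneous d) :
      e (c.eval F) = 0 ↔ e' (c'.eval F) = 0 :=
    ⟨hcon d F hF, eq_zero_of_forall_isHomogeneous (α := e.comp c.eval) (β := e'.comp c'.eval)
      (hne c e) (hne c' e') hcon hF⟩
  have h3 (d : ℕ) (hd : 0 < d) (F : MvPolynomial (Fin (n + 1)) K) (hF : F.IsHomogeneous d) :
      ι (c.map (⟨RingHom.ker e, RingHom.ker_isPrime e⟩ : PrimeSpectrum c.ring)) ∈
        Proj.basicOpen (gradingByDegree K n) F ↔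
      ι (c'.map (⟨RingHom.ker e', RingHom.ker_isPrime e'⟩ : PrimeSpectrum c'.ring)) ∈
        Proj.basicOpen (gradingByDegree K n) F := by
    rw [c.mem_basicOpen_iff _ hd hF, c'.mem_basicOpen_iff _ hd hF]
    exact not_congr (h2 d F hF)
  exact eq_of_mem_basicOpen_iff h3

/-- If a form had no zero, the curve would lie in the affine complement of a hypersurface. Being
affine and proper it would be finite over K, and a chart ring would be a field, which contradicts
the existence of a uniformizer with nonzero derivative. -/
lemma Chart.exists_eval_mem [IsClosedImmersion ι]
    (ch : X → Chart ι) (hch : ∀ x, x ∈ Set.range (ch x).map) [Nonempty X]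
    {d : ℕ} (hd : 0 < d) {F : MvPolynomial (Fin (n + 1)) K} (hF : F.IsHomogeneous d) :
    ∃ (c : Chart ι) (m : Ideal c.ring), m.IsMaximal ∧ c.eval F ∈ m := by
  by_contra! hcon
  have h1 : ι ⁻¹ᵁ Proj.basicOpen (gradingByDegree K n) F = ⊤ := by
    refine top_le_iff.mp fun x _ => ?_
    obtain ⟨p, hp⟩ := hch x
    change ι x ∈ Proj.basicOpen (gradingByDegree K n) F
    rw [← hp, (ch x).mem_basicOpen_iff p hd hF]
    intro hmem
    obtain ⟨m, hm, hle⟩ := Ideal.exists_le_maximal p.asIdeal p.2.ne_top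
    exact hcon _ m hm (hle hmem)
  have h2 : IsAffineOpen (ι ⁻¹ᵁ Proj.basicOpen (gradingByDegree K n) F) :=
    (Proj.isAffineOpen_basicOpen (gradingByDegree K n) F hF hd).preimage ι
  rw [h1] at h2
  have h3 : IsAffine X := by
    have : IsAffine (⊤ : X.Opens) := h2
    exact IsAffine.of_isIso X.topIso.inv
  have h4 : IsFinite (ι ≫ projHom K n) :=
    IsFinite.iff_isProper_and_isAffineHom.mpr ⟨inferInstance, inferInstance⟩
  obtain ⟨x⟩ := ‹Nonempty X›
  let c := ch x
  have h5 : LocallyQuasiFinite (c.map ≫ ι ≫ projHom K n) := inferInstance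
  have h6 : IsLocallyArtinian (Spec (CommRingCat.of c.ring)) :=
    IsLocallyArtinian.of_locallyQuasiFinite (c.map ≫ ι ≫ projHom K n)
  have h7 : IsArtinianRing c.ring := Scheme.isLocallyArtinianScheme_Spec.mp h6
  have h8 := IsArtinianRing.isField_of_isDomain c.ring
  obtain ⟨m, hm⟩ := Ideal.exists_maximal c.ring
  obtain ⟨a, ha, hDa⟩ := c.isTangentDerivation.exists_notMem m
  have ha0 : a = 0 := by
    by_contra ha0
    obtain ⟨b, hb⟩ := h8.mul_inv_cancel ha0
    exact hm.ne_top (Ideal.eq_top_of_isUnit_mem _ ha (IsUnit.of_mul_eq_one b hb))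
  rw [ha0, map_zero] at hDa
  exact hDa m.zero_mem

end ChartPoints

/-! ### What the search for forms needs to know about the curve -/

section CurveData

open MvPolynomial TrivSqZeroExt

/-- The Wronskian of the values and the derivatives of two functions. -/
def wronskian {L : Type*} [CommRing L] (a b : DualNumber L) : L := fst a * snd b - snd a * fst b

/-- The points of a smooth curve in projective space over `K` with coordinates in an extension `L`
of `K`, together with a nonzero tangent vector at each point. -/
structure CurveData (K L : Type u) [Field K] [Field L] [Algebra K L] (n : ℕ) where
  /-- the points of the curve with coordinates in `L` -/
  Point : Type u
  /-- the closed points of the curve -/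
  Center : Type u
  /-- the closed point at which a point with coordinates in `L` is located -/
  center : Point → Center
  /-- the values and the derivatives of polynomials along a tangent vector -/
  jet : Point → (MvPolynomial (Fin (n + 1)) K →ₐ[K] DualNumber L)
  exists_coord_ne_zero (P : Point) : ∃ i, fst (jet P (X i)) ≠ 0
  fst_jet_of_center_eq {P Q : Point} (h : center P = center Q) {F} (hF : fst (jet P F) = 0) :
    fst (jet Q F) = 0
  snd_jet_of_center_eq {P Q : Point} (h : center P = center Q) {F} (hF : snd (jet P F) = 0) :
    snd (jet Q F) = 0
  exists_separating {P Q : Point} (h : center P ≠ center Q) : ∃ (d : ℕ) (F : _),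
    F.IsHomogeneous d ∧ fst (jet P F) = 0 ∧ fst (jet Q F) ≠ 0
  exists_simple_zero (P : Point) : ∃ (d : ℕ) (F : _),
    F.IsHomogeneous d ∧ fst (jet P F) = 0 ∧ snd (jet P F) ≠ 0
  exists_zero {d : ℕ} (hd : 0 < d) {F} (hF : F.IsHomogeneous d) : ∃ P, fst (jet P F) = 0
  finite_zeros {d : ℕ} (hd : 0 < d) {F} (hF : F.IsHomogeneous d) (h : ∃ P, fst (jet P F) ≠ 0) :
    {P | fst (jet P F) = 0}.Finite
  -- The two existence hypotheses say that F/G has a zero but is not identically zero, so that it is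
  -- not constant.
  finite_wronskian {d : ℕ} (hd : 0 < d) {F G} (hF : F.IsHomogeneous d) (hG : G.IsHomogeneous d)
    (h : ∃ P, fst (jet P F) ≠ 0) (h' : ∃ P, fst (jet P F) = 0 ∧ fst (jet P G) ≠ 0) :
    {P | wronskian (jet P F) (jet P G) = 0}.Finite

end CurveData

/-! ### The data attached to a smooth projective curve -/

section Construction

open TrivSqZeroExt

variable {K : Type u} [Field K] {n : ℕ} {X : Scheme.{u}} (ι : X ⟶ Proj (gradingByDegree K n))
  (L : Type u) [Field L] [Algebra K L]

/-- The points with coordinates in `L` of a subscheme of projective space over `K`. -/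
abbrev GeomPoint : Type u :=
  {P : Spec (CommRingCat.of L) ⟶ X //
    P ≫ ι ≫ projHom K n = Spec.map (CommRingCat.ofHom (algebraMap K L))}

variable {ι L}

/-- The closed point at which a point with coordinates in `L` is located. -/
def GeomPoint.center (P : GeomPoint ι L) : X := P.1 (IsLocalRing.closedPoint L)

variable (ch : X → Chart ι) (hch : ∀ x, x ∈ Set.range (ch x).map)

/-- The evaluation of functions on a chart at a point. -/
def GeomPoint.hom (P : GeomPoint ι L) : (ch P.center).ring →ₐ[K] L :=
  ((ch P.center).exists_eq_point P.1 P.2 (hch _)).choose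

lemma GeomPoint.eq_point (P : GeomPoint ι L) : P.1 = (ch P.center).point (P.hom ch hch) :=
  ((ch P.center).exists_eq_point P.1 P.2 (hch _)).choose_spec

lemma GeomPoint.center_eq (P : GeomPoint ι L) :
    P.center = (ch P.center).map (⟨RingHom.ker (P.hom ch hch), RingHom.ker_isPrime _⟩ :
      PrimeSpectrum (ch P.center).ring) := by
  rw [← Chart.point_closedPoint, ← P.eq_point ch hch]
  rfl

/-- The values and derivatives at a point of the restrictions of polynomials. -/
def GeomPoint.jet (P : GeomPoint ι L) : MvPolynomial (Fin (n + 1)) K →ₐ[K] DualNumber L :=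
  (tangentHom (P.hom ch hch) (ch P.center).der).comp (ch P.center).eval

@[simp]
lemma GeomPoint.fst_jet (P : GeomPoint ι L) (F : MvPolynomial (Fin (n + 1)) K) :
    fst (P.jet ch hch F) = P.hom ch hch ((ch P.center).eval F) := by
  simp [jet]

@[simp]
lemma GeomPoint.snd_jet (P : GeomPoint ι L) (F : MvPolynomial (Fin (n + 1)) K) :
    snd (P.jet ch hch F) = P.hom ch hch ((ch P.center).der ((ch P.center).eval F)) := by
  simp [jet]

/-- The charts are variables linked by `hc` so that the equality can be substituted; in the
applications they are the charts at the centers of `P` and `Q`. -/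
lemma GeomPoint.hom_eq_zero_iff {P Q : GeomPoint ι L} {c c' : Chart ι} (hc : c = c')
    {e : c.ring →ₐ[K] L} {e' : c'.ring →ₐ[K] L} (hP : P.1 = c.point e) (hQ : Q.1 = c'.point e')
    (h : P.center = Q.center) (f : ∀ c : Chart ι, c.ring) : e (f c) = 0 ↔ e' (f c') = 0 := by
  subst hc
  rw [center, center, hP, hQ, Chart.point_closedPoint, Chart.point_closedPoint] at h
  have h1 := c.map.isOpenEmbedding.injective h
  have h2 : RingHom.ker e = RingHom.ker e' := congrArg PrimeSpectrum.asIdeal h1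
  exact SetLike.ext_iff.mp h2 (f c)

lemma GeomPoint.fst_jet_eq_zero_iff (P : GeomPoint ι L) {F : MvPolynomial (Fin (n + 1)) K} {d : ℕ}
    (hd : 0 < d) (hF : F.IsHomogeneous d) : fst (P.jet ch hch F) = 0 ↔
      ι P.center ∉ Proj.basicOpen (gradingByDegree K n) F := by
  rw [P.center_eq ch hch, Chart.mem_basicOpen_iff _ _ hd hF, fst_jet, not_not]
  rfl

lemma GeomPoint.finite_setOf [CharZero K] [Algebra.IsAlgebraic K L] (hfin : (Set.range ch).Finite)
    (f : ∀ c : Chart ι, c.ring) (hf : ∀ c ∈ Set.range ch, f c ≠ 0) :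
    {P : GeomPoint ι L | P.hom ch hch (f (ch P.center)) = 0}.Finite := by
  refine Set.Finite.of_finite_image (f := Subtype.val) ?_ Subtype.val_injective.injOn
  refine (hfin.biUnion fun c hc => ((c.finite_setOf_apply_eq_zero (L := L) (hf c hc)).image
    c.point)).subset ?_
  rintro _ ⟨P, hP, rfl⟩
  rw [Set.mem_iUnion₂]
  exact ⟨_, ⟨P.center, rfl⟩, P.hom ch hch, hP, (P.eq_point ch hch).symm⟩

lemma GeomPoint.exists_fst_jet_eq_zero [IsAlgClosed L] [IsClosedImmersion ι] [Nonempty X] {d : ℕ}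
    (hd : 0 < d) {F : MvPolynomial (Fin (n + 1)) K} (hF : F.IsHomogeneous d) :
    ∃ P : GeomPoint ι L, fst (P.jet ch hch F) = 0 := by
  obtain ⟨c, m, hm, hFm⟩ := Chart.exists_eval_mem ch hch hd hF
  let _ : Field (c.ring ⧸ m) := Ideal.Quotient.field m
  have hfin : Module.Finite K (c.ring ⧸ m) := finite_of_finite_type_of_isJacobsonRing K _
  let e : c.ring →ₐ[K] L := (IsAlgClosed.lift : (c.ring ⧸ m) →ₐ[K] L).comp (Ideal.Quotient.mkₐ K m)
  have hker : e (c.eval F) = 0 := by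
    have : Ideal.Quotient.mk m (c.eval F) = 0 := Ideal.Quotient.eq_zero_iff_mem.mpr hFm
    simp [e, this]
  refine ⟨⟨c.point e, ?_⟩, ?_⟩
  · rw [Chart.point, Category.assoc, ← Category.assoc c.map, c.map_comp, toProj_comp_hom,
      ← Spec.map_comp, ← CommRingCat.ofHom_comp]
    congr 2
    exact e.comp_algebraMap
  · rw [fst_jet_eq_zero_iff ch hch _ hd hF, center]
    rw [Chart.point_closedPoint, Chart.mem_basicOpen_iff _ _ hd hF, not_not]
    exact hker

/-- If the Wronskian were zero, F/G would be a root of an irreducible polynomial g over K. As F/G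
takes the value 0 at the given point, g = X and F is identically zero. -/
lemma Chart.mul_der_ne [CharZero K] [IrreducibleSpace X] [Algebra.IsAlgebraic K L] (c : Chart ι)
    {d : ℕ} (hd : 0 < d)
    {F G : MvPolynomial (Fin (n + 1)) K} (hF : F.IsHomogeneous d) (hG : G.IsHomogeneous d)
    (h : c.eval F ≠ 0) (c' : Chart ι) (e : c'.ring →ₐ[K] L) (h0 : e (c'.eval F) = 0)
    (h1 : e (c'.eval G) ≠ 0) :
    c.eval F * c.der (c.eval G) - c.der (c.eval F) * c.eval G ≠ 0 := by
  intro hW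
  have hG0 : c.eval G ≠ 0 := c'.eval_ne_zero c hd hG fun h2 => h1 (by rw [h2, map_zero])
  obtain ⟨g, hg, hirr, hg0⟩ := c.isTangentDerivation.exists_homogEval_eq_zero hG0
    (x := c.eval F) (by linear_combination hW)
  rw [← map_homogEval] at hg0
  have h2 : c'.eval (homogEval g F G) = 0 := by
    by_contra hcon
    exact c'.eval_ne_zero c (Nat.mul_pos hirr.natDegree_pos hd)
      (isHomogeneous_homogEval hF hG g) hcon hg0
  have h3 := congrArg e h2
  rw [map_homogEval, map_homogEval, h0, homogEval_zero_left, map_zero, mul_eq_zero,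
    map_eq_zero] at h3
  have h4 := h3.resolve_right (pow_ne_zero _ h1)
  rw [← Polynomial.X_dvd_iff] at h4
  have h5 : g = Polynomial.X :=
    (Polynomial.eq_of_monic_of_associated Polynomial.monic_X hg
      (Polynomial.irreducible_X.associated_of_dvd hirr h4)).symm
  rw [h5, map_homogEval] at hg0
  simp [homogEval, Finset.sum_range_succ] at hg0
  exact h hg0

/-- The points of a smooth curve in projective space with coordinates in an algebraically closed
field. -/
def GeomPoint.curveData [CharZero K] [Algebra.IsAlgebraic K L] [IsAlgClosed L] [IsClosedImmersion ι]
    [IrreducibleSpace X] (hfin : (Set.range ch).Finite) : CurveData K L n where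
  Point := GeomPoint ι L
  Center := X
  center := GeomPoint.center
  jet P := P.jet ch hch
  exists_coord_ne_zero P := ⟨(ch P.center).index, by simp [Chart.eval_index]⟩
  fst_jet_of_center_eq {P Q} h {F} hF := by
    rw [fst_jet] at hF ⊢
    exact (hom_eq_zero_iff (congrArg ch h) (P.eq_point ch hch) (Q.eq_point ch hch) h
      fun c => c.eval F).mp hF
  snd_jet_of_center_eq {P Q} h {F} hF := by
    rw [snd_jet] at hF ⊢
    exact (hom_eq_zero_iff (congrArg ch h) (P.eq_point ch hch) (Q.eq_point ch hch) h
      fun c => c.der (c.eval F)).mp hF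
  exists_separating {P Q} h := by
    simp only [fst_jet]
    refine Chart.exists_isHomogeneous_of_ne _ _ _ _ ?_
    rwa [← P.eq_point, ← Q.eq_point]
  exists_simple_zero P := by
    simp only [fst_jet, snd_jet]
    have := (ch P.center).ker_isMaximal (P.hom ch hch)
    exact (ch P.center).exists_isHomogeneous_of_isClosedImmersion (RingHom.ker (P.hom ch hch))
  exists_zero hd _ hF := exists_fst_jet_eq_zero ch hch hd hF
  finite_zeros hd F hF := by
    rintro ⟨P, hP⟩
    simp only [fst_jet] at hP ⊢
    refine finite_setOf ch hch hfin (fun c => c.eval F) fun c _ => ?_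
    exact (ch P.center).eval_ne_zero c hd hF fun h => hP (by rw [h, map_zero])
  finite_wronskian hd F G hF hG := by
    rintro ⟨P, hP⟩ ⟨Q, hQ, hQ'⟩
    simp only [fst_jet, wronskian, snd_jet, ← map_mul, ← map_sub] at hP hQ hQ' ⊢
    refine finite_setOf ch hch hfin (fun c => c.eval F * c.der (c.eval G) -
      c.der (c.eval F) * c.eval G) fun c _ => ?_
    refine c.mul_der_ne hd hF hG ?_ _ _ hQ hQ'
    exact (ch P.center).eval_ne_zero c hd hF fun h => hP (by rw [h, map_zero])

end Construction

/-! ### General members of linear systems over an infinite field -/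

section GenericChoice

lemma exists_forall_add_mul_ne_zero {K L : Type*} [Field K] [Infinite K] [Field L] [Algebra K L]
    {s : Set (L × L)} (hs : s.Finite) (h0 : 0 ∉ s) :
    ∃ c : K, ∀ x ∈ s, x.1 + algebraMap K L c * x.2 ≠ 0 := by
  have h1 : (⋃ x ∈ s, {c : K | x.1 + algebraMap K L c * x.2 = 0}).Finite := by
    refine hs.biUnion fun x hx => Set.Subsingleton.finite fun c hc c' hc' => ?_
    change _ = _ at hc hc'
    have h2 : (algebraMap K L c - algebraMap K L c') * x.2 = 0 := by linear_combination hc - hc'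
    rcases mul_eq_zero.mp h2 with h3 | h3
    · exact (algebraMap K L).injective (sub_eq_zero.mp h3)
    · rw [h3, mul_zero, add_zero] at hc
      exact absurd (show (0 : L × L) ∈ s from (Prod.ext hc h3 : x = 0) ▸ hx) h0
  obtain ⟨c, hc⟩ := h1.exists_notMem
  simp only [Set.mem_iUnion, not_exists] at hc
  exact ⟨c, fun x hx => hc x hx⟩

/-- A vector space over an infinite field is not a finite union of proper subspaces. -/
lemma exists_mem_forall_ne_zero {K L M : Type*} [Field K] [Infinite K] [Field L] [Algebra K L]
    [AddCommGroup M] [Module K M] (U : Submodule K M) {N : Set (M →ₗ[K] L)} (hN : N.Finite)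
    (h : ∀ ν ∈ N, ∃ x ∈ U, ν x ≠ 0) : ∃ x ∈ U, ∀ ν ∈ N, ν x ≠ 0 := by
  induction N, hN using Set.Finite.induction_on with
  | empty => exact ⟨0, U.zero_mem, by simp⟩
  | @insert μ N _ hN ih =>
    obtain ⟨x, hx, hxN⟩ := ih fun ν hν => h ν (Set.mem_insert_of_mem _ hν)
    obtain ⟨y, hy, hyμ⟩ := h μ (Set.mem_insert _ _)
    obtain ⟨c, hc⟩ := exists_forall_add_mul_ne_zero (K := K)
      (((hN.insert μ).image fun ν => (ν x, ν y))) (by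
        rintro ⟨ν, hν, h0⟩
        rcases Set.mem_insert_iff.mp hν with rfl | hν
        · exact hyμ (congrArg Prod.snd h0)
        · exact hxN ν hν (congrArg Prod.fst h0))
    refine ⟨x + c • y, U.add_mem hx (U.smul_mem c hy), fun ν hν => ?_⟩
    have := hc _ ⟨ν, hν, rfl⟩
    rwa [← Algebra.smul_def, ← map_smul, ← map_add] at this

end GenericChoice

/-! ### A pencil with simple poles, by a Bertini argument -/

namespace CurveData

open MvPolynomial TrivSqZeroExt

variable {K L : Type u} [Field K] [Field L] [Algebra K L] {n : ℕ} (V : CurveData K L n)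

/-- The value of polynomials at a point, as a linear map. -/
def valueMap (P : V.Point) : MvPolynomial (Fin (n + 1)) K →ₗ[K] L :=
  (fstHom K L L).toLinearMap ∘ₗ (V.jet P).toLinearMap

/-- The derivative of polynomials at a point, as a linear map. -/
def derivMap (P : V.Point) : MvPolynomial (Fin (n + 1)) K →ₗ[K] L :=
  ((sndHom L L).restrictScalars K) ∘ₗ (V.jet P).toLinearMap

@[simp]
lemma valueMap_apply (P : V.Point) (F) : V.valueMap P F = fst (V.jet P F) := rfl

@[simp]
lemma derivMap_apply (P : V.Point) (F) : V.derivMap P F = snd (V.jet P F) := rfl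

/-- The homogeneous polynomials of degree `d` vanishing on a set of points. -/
def vanishing (T : Set V.Point) (d : ℕ) : Submodule K (MvPolynomial (Fin (n + 1)) K) :=
  homogeneousSubmodule _ K d ⊓ ⨅ t ∈ T, LinearMap.ker (V.valueMap t)

variable {V}

lemma mem_vanishing {T : Set V.Point} {d : ℕ} {F : MvPolynomial (Fin (n + 1)) K} :
    F ∈ V.vanishing T d ↔ F.IsHomogeneous d ∧ ∀ t ∈ T, fst (V.jet t F) = 0 := by
  simp [vanishing]

lemma mul_mem_vanishing {T T' : Set V.Point} {d e : ℕ} {F G : MvPolynomial (Fin (n + 1)) K}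
    (hF : F ∈ V.vanishing T d) (hG : G ∈ V.vanishing T' e) :
    F * G ∈ V.vanishing (T ∪ T') (d + e) := by
  rw [mem_vanishing] at *
  refine ⟨hF.1.mul hG.1, ?_⟩
  rintro t (ht | ht)
  · simp [hF.2 t ht]
  · simp [hG.2 t ht]

variable [Infinite K]

lemma exists_linear_ne_zero {Z : Set V.Point} (hZ : Z.Finite) :
    ∃ ℓ : MvPolynomial (Fin (n + 1)) K, ℓ.IsHomogeneous 1 ∧ ∀ z ∈ Z, fst (V.jet z ℓ) ≠ 0 := by
  obtain ⟨ℓ, hℓ, h⟩ := exists_mem_forall_ne_zero (homogeneousSubmodule (Fin (n + 1)) K 1)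
    (hZ.image V.valueMap) (by
      rintro _ ⟨z, -, rfl⟩
      obtain ⟨i, hi⟩ := V.exists_coord_ne_zero z
      exact ⟨X i, isHomogeneous_X K i, hi⟩)
  exact ⟨ℓ, hℓ, fun z hz => h _ ⟨z, hz, rfl⟩⟩

omit [Infinite K] in
lemma mul_pow_mem_vanishing {T : Set V.Point} {d e : ℕ} {F ℓ : MvPolynomial (Fin (n + 1)) K}
    (hF : F ∈ V.vanishing T d) (hℓ : ℓ.IsHomogeneous 1) (hde : d ≤ e) :
    F * ℓ ^ (e - d) ∈ V.vanishing T e := by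
  have h1 : ℓ ^ (e - d) ∈ V.vanishing ∅ (e - d) :=
    mem_vanishing.mpr ⟨by simpa using hℓ.pow (e - d), by simp⟩
  have h2 := mul_mem_vanishing hF h1
  rwa [Set.union_empty, Nat.add_sub_cancel' hde] at h2

omit [Infinite K] in
lemma exists_mem_vanishing_ne_zero {T : Set V.Point} (hT : T.Finite) {P : V.Point}
    (hP : ∀ t ∈ T, V.center t ≠ V.center P) :
    ∃ (d : ℕ) (F : _), F ∈ V.vanishing T d ∧ fst (V.jet P F) ≠ 0 := by
  induction T, hT using Set.Finite.induction_on with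
  | empty => exact ⟨0, 1, mem_vanishing.mpr ⟨isHomogeneous_one _ _, by simp⟩, by simp⟩
  | @insert t T _ hT ih =>
    obtain ⟨d, F, hF, hFP⟩ := ih fun s hs => hP s (Set.mem_insert_of_mem _ hs)
    obtain ⟨e, G, hG, hGt, hGP⟩ := V.exists_separating (hP t (Set.mem_insert _ _))
    refine ⟨e + d, G * F, ?_, by simpa using ⟨hGP, hFP⟩⟩
    rw [Set.insert_eq]
    exact mul_mem_vanishing (mem_vanishing.mpr ⟨hG, by simpa using hGt⟩) hF

/-- Products of separating forms handle each `z` alone; powers of a linear form without zeros on `Z`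
equalize the degrees, and a general member handles all `z` at once. -/
lemma exists_mem_vanishing_forall_ne_zero {T Z : Set V.Point} (hT : T.Finite) (hZ : Z.Finite)
    (h : ∀ t ∈ T, ∀ z ∈ Z, V.center t ≠ V.center z) :
    ∃ d₀, ∀ d ≥ d₀, ∃ F ∈ V.vanishing T d, ∀ z ∈ Z, fst (V.jet z F) ≠ 0 := by
  have h1 (z : Z) := exists_mem_vanishing_ne_zero hT (P := z.1) fun t ht => h t ht z z.2
  choose e F hF hFz using h1
  have : Finite Z := hZ
  obtain ⟨ℓ, hℓ, hℓZ⟩ := exists_linear_ne_zero hZ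
  obtain ⟨d₀, hd₀⟩ := (Set.finite_range e).bddAbove
  refine ⟨d₀, fun d hd => ?_⟩
  obtain ⟨G, hG, h2⟩ := exists_mem_forall_ne_zero (V.vanishing T d) (hZ.image V.valueMap) (by
    rintro _ ⟨z, hz, rfl⟩
    refine ⟨_, mul_pow_mem_vanishing (hF ⟨z, hz⟩) hℓ ((hd₀ ⟨_, rfl⟩).trans hd), ?_⟩
    simpa using ⟨hFz ⟨z, hz⟩, fun h => absurd h (hℓZ z hz)⟩)
  exact ⟨G, hG, fun z hz => h2 _ ⟨z, hz, rfl⟩⟩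

/-- For each `t`, multiply a form with a simple zero at `t` by one vanishing on the rest of `T` but
not at `t`. Points of `T` conjugate to `t` belong to the first factor, whose coefficients lie in K.
Then take a general member. -/
lemma exists_mem_vanishing_simple {T : Set V.Point} (hT : T.Finite) {P : V.Point}
    (hP : ∀ t ∈ T, V.center t ≠ V.center P) :
    ∃ (d : ℕ) (F : _), F ∈ V.vanishing T d ∧ fst (V.jet P F) ≠ 0 ∧
      ∀ t ∈ T, snd (V.jet t F) ≠ 0 := by
  have h1 (t : T) : ∃ (d : ℕ) (F : _), F ∈ V.vanishing T d ∧ snd (V.jet t.1 F) ≠ 0 := by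
    obtain ⟨d, F, hF, hFt⟩ := exists_mem_vanishing_ne_zero
      (T := {s ∈ T | V.center s ≠ V.center t.1})
      (hT.subset (Set.sep_subset _ _)) (P := t.1) fun s hs => hs.2
    obtain ⟨e, G, hG, hGt, hGt'⟩ := V.exists_simple_zero t.1
    refine ⟨e + d, G * F, ?_, by simpa [hGt] using ⟨hGt', hFt⟩⟩
    have h2 := mul_mem_vanishing (T := {s | V.center s = V.center t.1}) (mem_vanishing.mpr ⟨hG,
      fun s hs => V.fst_jet_of_center_eq (Eq.symm hs) hGt⟩) hF
    rw [mem_vanishing] at h2 ⊢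
    refine ⟨h2.1, fun s hs => h2.2 s ?_⟩
    by_cases h3 : V.center s = V.center t.1
    · exact Or.inl h3
    · exact Or.inr ⟨hs, h3⟩
  choose e F hF hFt using h1
  obtain ⟨k, G, hG, hGP⟩ := exists_mem_vanishing_ne_zero hT hP
  have : Finite T := hT
  obtain ⟨ℓ, hℓ, hℓT⟩ := exists_linear_ne_zero (hT.insert P)
  obtain ⟨d₀, hd₀⟩ := (Set.finite_range e).bddAbove
  set d := d₀ + k
  obtain ⟨H, hH, h2⟩ := exists_mem_forall_ne_zero (V.vanishing T d)
    ((hT.image V.derivMap).insert (V.valueMap P)) (by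
      intro ν hν
      rcases Set.mem_insert_iff.mp hν with rfl | ⟨t, ht, rfl⟩
      · refine ⟨_, mul_pow_mem_vanishing hG hℓ (Nat.le_add_left k d₀), ?_⟩
        simpa using ⟨hGP, fun h => absurd h (hℓT P (Set.mem_insert _ _))⟩
      · refine ⟨_, mul_pow_mem_vanishing (hF ⟨t, ht⟩) hℓ
          ((hd₀ ⟨_, rfl⟩).trans (Nat.le_add_right d₀ k)), ?_⟩
        have h3 := (mem_vanishing.mp (hF ⟨t, ht⟩)).2 t ht
        simpa [h3] using ⟨hFt ⟨t, ht⟩, fun h => absurd h (hℓT t (Set.mem_insert_of_mem _ ht))⟩)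
  exact ⟨d, H, hH, h2 _ (Set.mem_insert _ _), fun t ht =>
    h2 _ (Set.mem_insert_of_mem _ ⟨t, ht, rfl⟩)⟩

variable (V) in
/-- Two forms of the same positive degree without common zeros on a curve. -/
structure IsPencil (d : ℕ) (F G : MvPolynomial (Fin (n + 1)) K) : Prop where
  pos : 0 < d
  left : F.IsHomogeneous d
  right : G.IsHomogeneous d
  ne_zero (P : V.Point) (hF : fst (V.jet P F) = 0) : fst (V.jet P G) ≠ 0

omit [Infinite K] in
lemma fst_jet_add_smul (P : V.Point) (F G : MvPolynomial (Fin (n + 1)) K) (c : K) :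
    fst (V.jet P (F + c • G)) = fst (V.jet P F) + algebraMap K L c * fst (V.jet P G) := by
  rw [map_add, map_smul, fst_add, fst_smul, Algebra.smul_def]

omit [Infinite K] in
lemma snd_jet_add_smul (P : V.Point) (F G : MvPolynomial (Fin (n + 1)) K) (c : K) :
    snd (V.jet P (F + c • G)) = snd (V.jet P F) + algebraMap K L c * snd (V.jet P G) := by
  rw [map_add, map_smul, snd_add, snd_smul, Algebra.smul_def]

/-- There is a pencil whose second member vanishes on `T`, has no zeros in `S`, and has only simple
zeros. -/
lemma exists_pencil_simple_zeros {S T : Set V.Point} (hS : S.Finite) (hT : T.Finite)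
    (hST : ∀ t ∈ T, ∀ s ∈ S, V.center t ≠ V.center s) :
    ∃ (d : ℕ) (F G : _), V.IsPencil d F G ∧ (∀ t ∈ T, fst (V.jet t G) = 0) ∧
      (∀ s ∈ S, fst (V.jet s G) ≠ 0) ∧
      (∀ P, fst (V.jet P G) = 0 → snd (V.jet P G) ≠ 0) := by
  have hcenter {P Q : V.Point} {F : MvPolynomial (Fin (n + 1)) K} (hP : fst (V.jet P F) = 0)
      (hQ : fst (V.jet Q F) ≠ 0) : V.center Q ≠ V.center P := fun h =>
    hQ (V.fst_jet_of_center_eq h.symm hP)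
  -- The points `P₀` and `P₁` are auxiliary: `A` below is nonzero at `P₀`, hence not identically
  -- zero, and `A * ℓ₁` vanishes at `P₁` while `B` will not, so that the quotient is not constant.
  obtain ⟨ℓ₀, hℓ₀, hℓ₀T⟩ := exists_linear_ne_zero hT
  obtain ⟨P₀, hP₀⟩ := V.exists_zero one_pos hℓ₀
  obtain ⟨ℓ₁, hℓ₁, hℓ₁T⟩ := exists_linear_ne_zero (hT.insert P₀)
  obtain ⟨P₁, hP₁⟩ := V.exists_zero one_pos hℓ₁
  obtain ⟨k, A, hA, hAP₀, hAT⟩ := exists_mem_vanishing_simple hT (P := P₀) fun t ht =>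
    hcenter hP₀ (hℓ₀T t ht)
  set Z := {P | fst (V.jet P (A * ℓ₁)) = 0 ∧ ∀ t ∈ T, V.center t ≠ V.center P} with hZ
  have hAℓ : (A * ℓ₁).IsHomogeneous (k + 1) := (mem_vanishing.mp hA).1.mul hℓ₁
  have hZfin : Z.Finite := (V.finite_zeros (Nat.succ_pos k) hAℓ
    ⟨P₀, by simpa using ⟨hAP₀, hℓ₁T P₀ (Set.mem_insert _ _)⟩⟩).subset fun P hP => hP.1
  have hP₁Z : P₁ ∈ Z := ⟨by simp [hP₁], fun t ht =>
    hcenter hP₁ (hℓ₁T t (Set.mem_insert_of_mem _ ht))⟩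
  obtain ⟨d₀, hd₀⟩ := exists_mem_vanishing_forall_ne_zero hT (hZfin.union hS) (by
    rintro t ht z (hz | hz)
    · exact hz.2 t ht
    · exact hST t ht z hz)
  set d := d₀ + (k + 1) with hd
  have hdpos : 0 < d := by omega
  obtain ⟨B, hB, hBZ⟩ := hd₀ d (Nat.le_add_right _ _)
  set A' := A * ℓ₁ ^ (d - k) with hA'
  have hA'T : A' ∈ V.vanishing T d := mul_pow_mem_vanishing hA hℓ₁ (by omega)
  have hA'P₀ : fst (V.jet P₀ A') ≠ 0 := by
    simpa [hA'] using ⟨hAP₀, fun h => absurd h (hℓ₁T P₀ (Set.mem_insert _ _))⟩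
  have hA'P₁ : fst (V.jet P₁ A') = 0 := by
    simp [hA', hP₁, show d - k ≠ 0 by omega]
  have hA'zero (P : V.Point) (hP : fst (V.jet P A') = 0) : fst (V.jet P (A * ℓ₁)) = 0 := by
    simp only [hA', map_mul, map_pow, fst_mul, fst_pow, mul_eq_zero] at hP ⊢
    exact hP.imp_right fun h => eq_zero_of_pow_eq_zero h
  have hA't (t : V.Point) (ht : t ∈ T) : snd (V.jet t A') ≠ 0 := by
    have h1 : fst (V.jet t A) = 0 := (mem_vanishing.mp hA).2 t ht
    simpa [hA', h1] using
      ⟨hAT t ht, fun h => absurd h (hℓ₁T t (Set.mem_insert_of_mem _ ht))⟩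
  have hWfin := V.finite_wronskian hdpos (mem_vanishing.mp hA'T).1 (mem_vanishing.mp hB).1
    ⟨P₀, hA'P₀⟩ ⟨P₁, hA'P₁, hBZ P₁ (Or.inl hP₁Z)⟩
  -- A multiple zero of `A' + c • B` not conjugate to a point of `T` is a critical point of A'/B
  -- with value −c, and there are finitely many critical points. The choice of `c` also avoids zeros
  -- at `S` and `P₁` and multiple zeros at `T`.
  obtain ⟨c, hc⟩ := exists_forall_add_mul_ne_zero (K := K)
    ((((hWfin.subset (Set.sep_subset _ fun P => fst (V.jet P B) ≠ 0)).union
      (hS.insert P₁)).image fun P => (fst (V.jet P A'), fst (V.jet P B))).union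
      (hT.image fun P => (snd (V.jet P A'), snd (V.jet P B)))) (by
        rintro (⟨P, hP, h⟩ | ⟨P, hP, h⟩)
        · have h2 : fst (V.jet P B) = 0 := congrArg Prod.snd h
          rcases hP with hP | hP | hP
          · exact hP.2 h2
          · exact hBZ P₁ (Or.inl hP₁Z) (hP ▸ h2)
          · exact hBZ P (Or.inr hP) h2
        · exact hA't P hP (congrArg Prod.fst h))
  set G := A' + c • B with hG
  have hGT : G ∈ V.vanishing T d := Submodule.add_mem _ hA'T (Submodule.smul_mem _ c hB)
  rw [mem_vanishing] at hGT
  have hc1 (P : V.Point) (h1 : wronskian (V.jet P A') (V.jet P B) = 0)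
      (h2 : fst (V.jet P B) ≠ 0) : fst (V.jet P G) ≠ 0 := by
    rw [fst_jet_add_smul]
    exact hc _ (Or.inl ⟨P, Or.inl ⟨h1, h2⟩, rfl⟩)
  have hc2 (P : V.Point) (hP : P ∈ insert P₁ S) : fst (V.jet P G) ≠ 0 := by
    rw [fst_jet_add_smul]
    exact hc _ (Or.inl ⟨P, Or.inr hP, rfl⟩)
  have hc3 (t : V.Point) (ht : t ∈ T) : snd (V.jet t G) ≠ 0 := by
    rw [snd_jet_add_smul]
    exact hc _ (Or.inr ⟨t, ht, rfl⟩)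
  obtain ⟨ℓ, hℓ, hℓG⟩ := exists_linear_ne_zero (V.finite_zeros hdpos hGT.1
    ⟨P₁, hc2 P₁ (Set.mem_insert _ _)⟩)
  refine ⟨d, ℓ ^ d, G, ⟨hdpos, by simpa using hℓ.pow d, hGT.1, fun P hP hP' => ?_⟩, hGT.2,
    fun s hs => hc2 s (Set.mem_insert_of_mem _ hs), fun P hP hP' => ?_⟩
  · rw [map_pow, fst_pow] at hP
    exact hℓG P hP' (eq_zero_of_pow_eq_zero hP)
  · by_cases hPT : ∃ t ∈ T, V.center t = V.center P
    · obtain ⟨t, ht, htP⟩ := hPT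
      exact hc3 t ht (V.snd_jet_of_center_eq htP.symm hP')
    · push Not at hPT
      have hPB : fst (V.jet P B) ≠ 0 := by
        intro h
        rw [fst_jet_add_smul, h, mul_zero, add_zero] at hP
        exact hBZ P (Or.inl ⟨hA'zero P hP, hPT⟩) h
      refine hc1 P ?_ hPB hP
      rw [fst_jet_add_smul] at hP
      rw [snd_jet_add_smul] at hP'
      rw [wronskian]
      linear_combination snd (V.jet P B) * hP - fst (V.jet P B) * hP'

end CurveData

/-! ### The rational function that lowers the degree of branch values -/

section DegreeReduction

open TrivSqZeroExt Polynomial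

lemma homogEval_map {k K R : Type*} [Field k] [Field K] [CommRing R] [Algebra k K] [Algebra K R]
    [Algebra k R] [IsScalarTower k K R] (p : k[X]) (x y : R) :
    homogEval (p.map (algebraMap k K)) x y = homogEval p x y := by
  simp [homogEval, ← IsScalarTower.algebraMap_apply]

variable {k L : Type*} [Field k] [Field L] [Algebra k L]

lemma wronskian_mul (a b c : DualNumber L) :
    wronskian (a * c) (b * c) = fst c ^ 2 * wronskian a b := by
  simp [wronskian]
  ring

lemma exists_eq_mul_of_fst_ne_zero (a : DualNumber L) {b : DualNumber L} (hb : fst b ≠ 0) :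
    ∃ y : DualNumber L, a = y * b := by
  refine ⟨inl (fst a / fst b) + inr ((snd a * fst b - fst a * snd b) / fst b ^ 2), ?_⟩
  ext
  · simp [hb]
  · simp
    field_simp
    ring

lemma wronskian_mul_self (y b : DualNumber L) :
    wronskian (y * b) b = - snd y * fst b ^ 2 := by
  simp [wronskian]
  ring

lemma wronskian_aeval (y : DualNumber L) (f g : k[X]) : wronskian (aeval y f) (aeval y g) =
    (aeval (fst y) f * aeval (fst y) (derivative g) -
      aeval (fst y) (derivative f) * aeval (fst y) g) * snd y := by
  rw [wronskian, fst_aeval, fst_aeval, snd_aeval, snd_aeval]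
  ring

lemma fst_homogEval_mul (y b : DualNumber L) (p : k[X]) :
    fst (homogEval p (y * b) b) = fst b ^ p.natDegree * aeval (fst y) p := by
  rw [homogEval_mul, fst_mul, fst_pow, fst_aeval]

/-- The polynomial whose roots are the new critical points in the degree reduction step. -/
def reductionCritical (p : k[X]) (c : k) : k[X] :=
  C (p.natDegree : k) * p - (X - C c) * derivative p

/-- This is the chain rule: with m = deg p, the Wronskian of (y − c)^m and (y − c)^m − p(y) is (y −
c)^(m−1) (m p(y) − (y − c) p'(y)) dy. -/
lemma wronskian_reduction {p : k[X]} (hp : p.natDegree ≠ 0) (c : k) (y : DualNumber L)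
    {b : DualNumber L} (hb : fst b ≠ 0) :
    wronskian ((y * b - c • b) ^ p.natDegree)
      ((y * b - c • b) ^ p.natDegree - homogEval p (y * b) b) =
    - (fst b ^ (2 * p.natDegree) * (fst y - algebraMap k L c) ^ (p.natDegree - 1) *
      aeval (fst y) (reductionCritical p c)) * wronskian (y * b) b / fst b ^ 2 := by
  have h1 : y * b - c • b = aeval y (X - C c) * b := by
    simp [sub_mul, Algebra.smul_def]
  rw [homogEval_mul, h1, mul_pow, ← map_pow, mul_comm (b ^ _), ← sub_mul, ← map_sub,
    wronskian_mul, wronskian_aeval, wronskian_mul_self]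
  obtain ⟨N, hN⟩ := Nat.exists_eq_succ_of_ne_zero hp
  rw [fst_pow, reductionCritical, hN, Nat.succ_eq_add_one, Nat.add_sub_cancel]
  field_simp
  rw [derivative_sub, derivative_X_sub_C_pow]
  simp
  ring

/-- A dual number with value zero has square zero, so only two terms survive. -/
lemma homogEval_of_fst_eq_zero {p : k[X]} (hp : p.Monic) {N : ℕ} (hN : p.natDegree = N + 1)
    (a : DualNumber L) {b : DualNumber L} (hb : fst b = 0) :
    homogEval p a b = a ^ (N + 1) + algebraMap k _ (p.coeff N) * a ^ N * b := by
  have hb2 : b ^ 2 = 0 := by ext <;> simp [hb, pow_two]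
  rw [homogEval, hN, Finset.sum_range_succ, Finset.sum_range_succ, Finset.sum_eq_zero]
  · have : p.coeff (N + 1) = 1 := by rw [← hN]; exact hp
    simp [this]
    ring
  · intro i hi
    rw [Finset.mem_range] at hi
    rw [show N + 1 - i = 2 + (N - 1 - i) by omega, pow_add, hb2]
    ring

/-- Behaviour at poles: up to sign, the constant is the coefficient of y^N in (y − c)^(N+1) − p(y).
If it is nonzero, the rational function is unramified at ∞. -/
lemma wronskian_reduction_of_fst_eq_zero {p : k[X]} (hp : p.Monic) {N : ℕ}
    (hN : p.natDegree = N + 1) (c : k)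
    (a : DualNumber L) {b : DualNumber L} (hb : fst b = 0) :
    wronskian ((a - c • b) ^ p.natDegree) ((a - c • b) ^ p.natDegree - homogEval p a b) =
    - (algebraMap k L ((N + 1) * c + p.coeff N) * fst a ^ (2 * N)) * wronskian a b := by
  rw [homogEval_of_fst_eq_zero hp hN a hb, hN]
  have h1 (c : k) : fst (algebraMap k (DualNumber L) c) = algebraMap k L c := rfl
  simp [wronskian, hb, Algebra.smul_def, h1]
  ring

/-- The rational function used in the degree reduction step. -/
def reductionMap (p : k[X]) (c : k) (y : L) : L :=
  (y - algebraMap k L c) ^ p.natDegree /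
    ((y - algebraMap k L c) ^ p.natDegree - aeval y p)

/-- The value lies in the field generated by `y`. -/
lemma natDegree_minpoly_reductionMap_le [Algebra.IsAlgebraic k L] (p : k[X]) (c : k) (y : L) :
    (minpoly k (reductionMap p c y)).natDegree ≤ (minpoly k y).natDegree := by
  have hy : IsIntegral k y := Algebra.IsIntegral.isIntegral y
  have := IntermediateField.adjoin.finiteDimensional hy
  have h1 : reductionMap p c y = algebraMap (IntermediateField.adjoin k {y}) L
      (reductionMap p c (IntermediateField.AdjoinSimple.gen k y)) := by
    have h2 : algebraMap (IntermediateField.adjoin k {y}) L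
        (IntermediateField.AdjoinSimple.gen k y) = y :=
      IntermediateField.AdjoinSimple.algebraMap_gen k y
    rw [reductionMap, reductionMap, map_div₀, map_sub, map_pow, map_sub,
      ← aeval_algebraMap_apply, h2, ← IsScalarTower.algebraMap_apply]
  rw [h1, minpoly.algebraMap_eq (algebraMap (IntermediateField.adjoin k {y}) L).injective,
    ← IntermediateField.adjoin.finrank hy]
  exact minpoly.natDegree_le _

/-- The first condition keeps ∞ unramified, the second keeps the points of `Y` from being sent to ∞.
Each excludes finitely many `c`. -/
lemma exists_reduction_center [CharZero k] (p : k[X]) (hp : p.natDegree ≠ 0) (Y : Finset L) :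
    ∃ c : k, p.natDegree * c + p.coeff (p.natDegree - 1) ≠ 0 ∧
      ∀ y ∈ Y, (y - algebraMap k L c) ^ p.natDegree ≠ aeval y p := by
  classical
  have h0 : (p.natDegree : k) ≠ 0 := Nat.cast_ne_zero.mpr hp
  have h1 : ({c : k | p.natDegree * c + p.coeff (p.natDegree - 1) = 0} ∪
      ⋃ y ∈ Y, {c : k | (y - algebraMap k L c) ^ p.natDegree = aeval y p}).Finite := by
    refine Set.Finite.union (Set.Subsingleton.finite fun c hc c' hc' => ?_)
      (Y.finite_toSet.biUnion fun y _ => ?_)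
    · change _ = _ at hc hc'
      exact mul_left_cancel₀ h0 (by linear_combination hc - hc')
    · refine Set.Finite.of_finite_image (f := fun c => y - algebraMap k L c)
        ((nthRoots p.natDegree (aeval y p)).toFinset.finite_toSet.subset ?_) ?_
      · rintro _ ⟨c, hc, rfl⟩
        simp only [Finset.mem_coe, Multiset.mem_toFinset]
        exact (mem_nthRoots (Nat.pos_of_ne_zero hp)).mpr hc
      · intro c _ c' _ h
        exact (algebraMap k L).injective (sub_right_injective h)
  obtain ⟨c, hc⟩ := h1.exists_notMem
  simp only [Set.mem_union, Set.mem_iUnion, not_or, not_exists] at hc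
  exact ⟨c, hc.1, fun y hy => hc.2 y hy⟩

/-- The terms of degree N + 1 cancel. This drop is what makes new branch values have smaller degree.
-/
lemma natDegree_reductionCritical_le {p : k[X]} {N : ℕ} (hN : p.natDegree = N + 1)
    {c : k} : (reductionCritical p c).natDegree ≤ N := by
  rw [natDegree_le_iff_coeff_eq_zero]
  intro i hi
  rw [reductionCritical, coeff_sub, coeff_C_mul, sub_mul, coeff_sub, coeff_C_mul,
    coeff_derivative]
  rcases i with _ | i
  · omega
  rw [coeff_X_mul, coeff_derivative, hN]
  rcases Nat.lt_or_ge i (N + 1) with h | h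
  · obtain rfl : i = N := by omega
    rw [coeff_eq_zero_of_natDegree_lt (n := i + 1 + 1) (by omega)]
    push_cast
    ring
  · rw [coeff_eq_zero_of_natDegree_lt (n := i + 1 + 1) (by omega),
      coeff_eq_zero_of_natDegree_lt (n := i + 1) (by omega)]
    ring

/-- The same constant as at ∞: the condition on `c` that keeps ∞ unramified also makes this
polynomial nonzero. -/
lemma coeff_reductionCritical {p : k[X]} (hp : p.Monic) {N : ℕ} (hN : p.natDegree = N + 1)
    {c : k} : (reductionCritical p c).coeff N = (N + 1) * c + p.coeff N := by
  have h1 : p.coeff (N + 1) = 1 := by rw [← hN]; exact hp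
  rw [reductionCritical, coeff_sub, coeff_C_mul, sub_mul, coeff_sub, coeff_C_mul,
    coeff_derivative, hN]
  rcases N with _ | N
  · rw [coeff_X_mul_zero, h1]
    push_cast
    ring
  · rw [coeff_X_mul, coeff_derivative, h1]
    push_cast
    ring

end DegreeReduction

/-! ### Making all branch values rational -/

namespace CurveData

open TrivSqZeroExt Polynomial

variable {K L : Type u} [Field K] [Field L] [Algebra K L] {n : ℕ} (V : CurveData K L n)

/-- A pencil whose ramification is concentrated in the fibres over a finite set `B` of points
of the affine line and in whose fibre at infinity `T` lies, while `S` lies over `B`. -/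
structure IsPrepared (S T : Set V.Point) (B : Set L) (d : ℕ)
    (F G : MvPolynomial (Fin (n + 1)) K) : Prop where
  pencil : V.IsPencil d F G
  eq_zero (t : V.Point) (ht : t ∈ T) : fst (V.jet t G) = 0
  mem (P : V.Point) (hP : wronskian (V.jet P F) (V.jet P G) = 0 ∨ P ∈ S) :
    fst (V.jet P G) ≠ 0 ∧ fst (V.jet P F) / fst (V.jet P G) ∈ B

variable {V} {k : Type*} [Field k] [CharZero k] [Algebra k K] [Algebra k L] [IsScalarTower k K L]
  [Algebra.IsAlgebraic k L]

lemma IsPrepared.reduce {S T : Set V.Point} {B : Finset L} {d : ℕ}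
    {F G : MvPolynomial (Fin (n + 1)) K} (h : V.IsPrepared S T B d F G) {α : L} {N : ℕ}
    (hα : (minpoly k α).natDegree = N + 2) (hB : ∀ y ∈ B, (minpoly k y).natDegree ≤ N + 2)
    (hαB : α ∈ B) :
    ∃ (d' : ℕ) (F' G' : _) (B' : Finset L), V.IsPrepared S T B' d' F' G' ∧
      (∀ y ∈ B', (minpoly k y).natDegree ≤ N + 2) ∧
      (B'.filter fun y => (minpoly k y).natDegree = N + 2).card <
        (B.filter fun y => (minpoly k y).natDegree = N + 2).card := by
  classical
  have hint (x : L) : IsIntegral k x := Algebra.IsIntegral.isIntegral x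
  set p := minpoly k α
  have hmonic : p.Monic := minpoly.monic (hint α)
  have hirr : Irreducible p := minpoly.irreducible (hint α)
  -- With m = deg p, a critical point y ≠ c sent to ∞ satisfies m p(y) = (y − c) p'(y) and (y − c)^m
  -- = p(y). Eliminating c gives E(y) = 0. As `E` does not involve `c`, its finitely many roots can
  -- be avoided by the choice of `c`.
  set E : k[X] := derivative p ^ p.natDegree - C ((p.natDegree : k) ^ p.natDegree) *
    p ^ (p.natDegree - 1) with hE
  have hE0 : E ≠ 0 := by
    intro h0
    have h1 := congrArg (aeval α) h0
    have h2 : aeval α p = 0 := minpoly.aeval k α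
    rw [hE, hα] at h1
    simp [h2] at h1
    exact hirr.separable.aeval_derivative_ne_zero h2 h1
  obtain ⟨c, hc, hcY⟩ := exists_reduction_center p (by omega) (B ∪ (E.aroots L).toFinset)
  have hN : p.natDegree = N + 1 + 1 := hα
  have hpc (y : L) (hy : aeval y p = 0) : y ≠ algebraMap k L c := by
    rintro rfl
    rw [aeval_algebraMap_apply_eq_algebraMap_eval, FaithfulSMul.algebraMap_eq_zero_iff] at hy
    have h1 : p.natDegree = 1 :=
      natDegree_eq_of_degree_eq_some (degree_eq_one_of_irreducible_of_root hirr hy)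
    omega
  have hroot (y : L) (hy : aeval y (reductionCritical p c) = 0) :
      (y - algebraMap k L c) ^ p.natDegree ≠ aeval y p := by
    intro hcon
    refine hcY y (Finset.mem_union_right _ ?_) hcon
    rw [Multiset.mem_toFinset, mem_aroots]
    refine ⟨hE0, ?_⟩
    have h1 : aeval y p ≠ 0 := fun h0 => by
      rw [h0] at hcon
      exact hpc y h0 (sub_eq_zero.mp (eq_zero_of_pow_eq_zero hcon))
    rw [reductionCritical] at hy
    simp only [map_sub, map_mul, aeval_C, aeval_X, map_natCast] at hy
    have h2 : (p.natDegree : L) * aeval y p =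
        (y - algebraMap k L c) * aeval y (derivative p) := by linear_combination hy
    have h3 := congrArg (· ^ p.natDegree) h2
    simp only [mul_pow] at h3
    rw [hcon, hN] at h3
    simp only [hE, map_sub, map_pow, map_mul, map_natCast, hN, Nat.add_sub_cancel]
    refine mul_left_cancel₀ h1 ?_
    linear_combination -h3
  set r := reductionCritical p c with hr
  have hr0 : r ≠ 0 := by
    intro h0
    have h1 := coeff_reductionCritical hmonic hN (c := c)
    rw [← hr, h0, coeff_zero] at h1
    rw [hN] at hc
    exact hc (by rw [Nat.add_sub_cancel]; push_cast at h1 ⊢; exact h1.symm)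
  -- The value 0 comes from the critical point y = c.
  set B' : Finset L := insert 0 ((B ∪ (r.aroots L).toFinset).image (reductionMap p c)) with hB'
  have hne (y : L) (hy : y ∈ B ∪ (r.aroots L).toFinset) :
      (y - algebraMap k L c) ^ p.natDegree ≠ aeval y p := by
    rcases Finset.mem_union.mp hy with hy | hy
    · exact hcY y (Finset.mem_union_left _ hy)
    · rw [Multiset.mem_toFinset, mem_aroots] at hy
      exact hroot y hy.2
  have hrdeg (y : L) (hy : y ∈ (r.aroots L).toFinset) : (minpoly k y).natDegree ≤ N + 1 := by
    rw [Multiset.mem_toFinset, mem_aroots] at hy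
    exact (natDegree_le_of_dvd (minpoly.dvd k y hy.2) hr0).trans
      (natDegree_reductionCritical_le hN)
  have hdeg0 : (minpoly k (0 : L)).natDegree = 1 := by simp
  have hα1 : reductionMap p c α = 1 := by
    have h2 : aeval α p = 0 := minpoly.aeval k α
    rw [reductionMap, h2, sub_zero, div_self]
    exact pow_ne_zero _ (sub_ne_zero.mpr (hpc α h2))
  set Q := homogEval (p.map (algebraMap k K)) F G with hQ
  have hQhom : Q.IsHomogeneous (d * p.natDegree) := by
    have := isHomogeneous_homogEval h.pencil.left h.pencil.right (p.map (algebraMap k K))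
    rwa [natDegree_map, mul_comm] at this
  set F' := (F - algebraMap k K c • G) ^ p.natDegree with hF'
  have hF'hom : F'.IsHomogeneous (d * p.natDegree) := by
    refine MvPolynomial.IsHomogeneous.pow (h.pencil.left.sub ?_) _
    rw [MvPolynomial.smul_eq_C_mul]
    exact h.pencil.right.C_mul _
  have hjF (P : V.Point) : V.jet P F' = (V.jet P F - c • V.jet P G) ^ p.natDegree := by
    rw [hF', map_pow, map_sub, map_smul, algebraMap_smul]
  have hjQ (P : V.Point) : V.jet P Q = homogEval p (V.jet P F) (V.jet P G) := by
    rw [hQ, map_homogEval, homogEval_map]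
  have hjG (P : V.Point) : V.jet P (F' - Q) = (V.jet P F - c • V.jet P G) ^ p.natDegree -
      homogEval p (V.jet P F) (V.jet P G) := by
    rw [map_sub, hjF, hjQ]
  have hval (P : V.Point) (hP : fst (V.jet P G) ≠ 0) :
      fst (V.jet P F') = fst (V.jet P G) ^ p.natDegree *
        (fst (V.jet P F) / fst (V.jet P G) - algebraMap k L c) ^ p.natDegree ∧
      fst (V.jet P (F' - Q)) = fst (V.jet P G) ^ p.natDegree *
        ((fst (V.jet P F) / fst (V.jet P G) - algebraMap k L c) ^ p.natDegree -
        aeval (fst (V.jet P F) / fst (V.jet P G)) p) := by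
    obtain ⟨y, hy⟩ := exists_eq_mul_of_fst_ne_zero (V.jet P F) hP
    have h1 : fst (V.jet P F) / fst (V.jet P G) = fst y := by
      rw [hy, fst_mul, mul_div_cancel_right₀ _ hP]
    have h2 : fst (V.jet P F') = fst (V.jet P G) ^ p.natDegree *
        (fst y - algebraMap k L c) ^ p.natDegree := by
      rw [hjF, hy, fst_pow, fst_sub, fst_mul, fst_smul, Algebra.smul_def, ← mul_pow]
      ring
    rw [h1, map_sub, fst_sub, h2, hjQ, hy, fst_homogEval_mul]
    exact ⟨rfl, by ring⟩
  have hmap (P : V.Point) (hP : fst (V.jet P G) ≠ 0)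
      (hy : fst (V.jet P F) / fst (V.jet P G) ∈ B ∪ (r.aroots L).toFinset) :
      fst (V.jet P (F' - Q)) ≠ 0 ∧ fst (V.jet P F') / fst (V.jet P (F' - Q)) ∈ B' := by
    obtain ⟨h1, h2⟩ := hval P hP
    have h3 := hne _ hy
    refine ⟨?_, ?_⟩
    · rw [h2]
      exact mul_ne_zero (pow_ne_zero _ hP) (sub_ne_zero.mpr h3)
    · rw [h1, h2, mul_div_mul_left _ _ (pow_ne_zero _ hP)]
      exact Finset.mem_insert_of_mem (Finset.mem_image_of_mem _ hy)
  have hinf (P : V.Point) (hP : fst (V.jet P G) = 0) :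
      fst (V.jet P F') ≠ 0 ∧ fst (V.jet P (F' - Q)) = 0 ∧
      wronskian (V.jet P F') (V.jet P (F' - Q)) ≠ 0 := by
    have hF0 : fst (V.jet P F) ≠ 0 := fun h0 => h.pencil.ne_zero P h0 hP
    refine ⟨?_, ?_, ?_⟩
    · rw [hjF]
      simp [hP, hF0]
    · rw [hjG, homogEval_of_fst_eq_zero hmonic hN _ hP, hN]
      simp [hP]
    · rw [hjF, hjG, wronskian_reduction_of_fst_eq_zero hmonic hN c _ hP]
      refine mul_ne_zero (neg_ne_zero.mpr (mul_ne_zero ?_ (pow_ne_zero _ hF0))) fun h0 => ?_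
      · rw [_root_.map_ne_zero]
        rw [hN, Nat.add_sub_cancel] at hc
        push_cast at hc ⊢
        exact hc
      · exact (h.mem P (Or.inl h0)).1 hP
  refine ⟨d * p.natDegree, F', F' - Q, B', ⟨⟨?_, hF'hom, hF'hom.sub hQhom, ?_⟩, ?_, ?_⟩, ?_, ?_⟩
  · exact Nat.mul_pos h.pencil.pos (by omega)
  · intro P hP hP'
    by_cases hG : fst (V.jet P G) = 0
    · exact (hinf P hG).1 hP
    · obtain ⟨h1, h2⟩ := hval P hG
      rw [h1, mul_eq_zero] at hP
      rw [h2, mul_eq_zero] at hP'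
      have h3 := hP.resolve_left (pow_ne_zero _ hG)
      have h4 := hP'.resolve_left (pow_ne_zero _ hG)
      rw [h3, zero_sub, neg_eq_zero] at h4
      exact hpc _ h4 (sub_eq_zero.mp (eq_zero_of_pow_eq_zero h3))
  · exact fun t ht => (hinf t (h.eq_zero t ht)).2.1
  · intro P hP
    by_cases hG : fst (V.jet P G) = 0
    · rcases hP with hP | hP
      · exact absurd hP (hinf P hG).2.2
      · exact absurd hG (h.mem P (Or.inr hP)).1
    rcases hP with hP | hP
    · obtain ⟨y, hy⟩ := exists_eq_mul_of_fst_ne_zero (V.jet P F) hG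
      have h1 : fst (V.jet P F) / fst (V.jet P G) = fst y := by
        rw [hy, fst_mul, mul_div_cancel_right₀ _ hG]
      rw [hjF, hjG, hy, wronskian_reduction (by omega) c y hG, ← hy, div_eq_zero_iff,
        or_iff_left (pow_ne_zero _ hG), mul_eq_zero, neg_eq_zero, mul_eq_zero, mul_eq_zero,
        or_iff_right (pow_ne_zero _ hG)] at hP
      rcases hP with (hP | hP) | hP
      · have h2 : fst (V.jet P F) / fst (V.jet P G) - algebraMap k L c = 0 := by
          rw [h1]; exact eq_zero_of_pow_eq_zero hP
        obtain ⟨h3, h4⟩ := hval P hG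
        rw [h2, zero_pow (by omega)] at h3 h4
        refine ⟨?_, ?_⟩
        · rw [h4]
          refine mul_ne_zero (pow_ne_zero _ hG) ?_
          rw [zero_sub, neg_ne_zero]
          exact fun h5 => hpc _ h5 (sub_eq_zero.mp h2)
        · rw [h3, mul_zero, zero_div]
          exact Finset.mem_insert_self _ _
      · refine hmap P hG (Finset.mem_union_right _ ?_)
        rw [Multiset.mem_toFinset, mem_aroots, h1]
        exact ⟨hr0, hP⟩
      · exact hmap P hG (Finset.mem_union_left _ (h.mem P (Or.inl hP)).2)
    · exact hmap P hG (Finset.mem_union_left _ (h.mem P (Or.inr hP)).2)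
  · intro z hz
    rcases Finset.mem_insert.mp hz with rfl | hz
    · rw [hdeg0]; omega
    · obtain ⟨y, hy, rfl⟩ := Finset.mem_image.mp hz
      refine (natDegree_minpoly_reductionMap_le p c y).trans ?_
      rcases Finset.mem_union.mp hy with hy | hy
      · exact hB y hy
      · exact (hrdeg y hy).trans (by omega)
  -- Degrees do not grow, the roots of `r` have smaller degree, and `α` is sent to 1. So values of
  -- top degree come from those in `B` other than `α`.
  · have hsub : (B'.filter fun y => (minpoly k y).natDegree = N + 2) ⊆
        ((B.filter fun y => (minpoly k y).natDegree = N + 2).erase α).image (reductionMap p c) := by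
      intro z hz
      obtain ⟨hz, hzN⟩ := Finset.mem_filter.mp hz
      rcases Finset.mem_insert.mp hz with rfl | hz
      · rw [hdeg0] at hzN; omega
      · obtain ⟨y, hy, rfl⟩ := Finset.mem_image.mp hz
        have h1 := natDegree_minpoly_reductionMap_le p c y
        have hyB : y ∈ B := by
          rcases Finset.mem_union.mp hy with hy | hy
          · exact hy
          · have := hrdeg y hy
            omega
        refine Finset.mem_image_of_mem _ (Finset.mem_erase.mpr ⟨?_, Finset.mem_filter.mpr
          ⟨hyB, le_antisymm (hB y hyB) (hzN.ge.trans h1)⟩⟩)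
        rintro rfl
        rw [hα1, minpoly.one, ← C_1, natDegree_X_sub_C] at hzN
        omega
    refine (Finset.card_le_card hsub).trans_lt (Finset.card_image_le.trans_lt ?_)
    exact Finset.card_erase_lt_of_mem (Finset.mem_filter.mpr ⟨hαB, hα⟩)

/-- The degree reduction: all critical values can be made rational. -/
lemma IsPrepared.exists_rational {S T : Set V.Point} (N : ℕ) : ∀ {B : Finset L} {d : ℕ}
    {F G : MvPolynomial (Fin (n + 1)) K} (_ : V.IsPrepared S T B d F G)
    (_ : ∀ y ∈ B, (minpoly k y).natDegree ≤ N + 1),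
    ∃ (d' : ℕ) (F' G' : _) (B' : Finset L), V.IsPrepared S T B' d' F' G' ∧
      ∀ y ∈ B', y ∈ (algebraMap k L).range := by
  induction N with
  | zero =>
    intro B d F G h hB
    refine ⟨d, F, G, B, h, fun y hy => ?_⟩
    have hint : IsIntegral k y := Algebra.IsIntegral.isIntegral y
    exact minpoly.natDegree_eq_one_iff.mp (le_antisymm (hB y hy) (minpoly.natDegree_pos hint))
  | succ N ih =>
    intro B d F G h hB
    -- Inner induction on the number of values of top degree.
    induction hm : (B.filter fun y => (minpoly k y).natDegree = N + 2).card using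
      Nat.strong_induction_on generalizing B d F G with
    | _ m ihm =>
      by_cases hα : ∃ α ∈ B, (minpoly k α).natDegree = N + 2
      · obtain ⟨α, hαB, hα⟩ := hα
        obtain ⟨d', F', G', B', h', hB', hlt⟩ := h.reduce hα hB hαB
        exact ihm _ (hm ▸ hlt) h' hB' rfl
      · push Not at hα
        exact ih h fun y hy => Nat.le_of_lt_succ (lt_of_le_of_ne (hB y hy) (hα y hy))

end CurveData

/-! ### Choice of the Möbius map and of the exponents -/

section Exponents

open Polynomial

/-- Take c = x₁ + p for a prime p exceeding the numerators and denominators of all x − x₁. Then x −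
c is a p-adic unit for x ≠ x₁, while x₁ − c = −p. -/
lemma exists_padic_center {s : Finset ℚ} (hs : s.Nonempty) : ∃ c ∉ s, ∃ f : AbsoluteValue ℚ ℝ,
    ∃ x₁ ∈ s, f (x₁ - c) ≠ 1 ∧ ∀ x ∈ s, x ≠ x₁ → f (x - c) = 1 := by
  obtain ⟨x₁, hx₁⟩ := hs
  obtain ⟨p, hp, hpp⟩ := Nat.exists_infinite_primes
    ((s.sup fun x => max (x - x₁).num.natAbs (x - x₁).den) + 1)
  have : Fact p.Prime := ⟨hpp⟩
  have hp0 : padicNorm p (-(p : ℚ)) = (p : ℚ)⁻¹ := by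
    rw [padicNorm.neg, padicNorm.padicNorm_p_of_prime]
  have hp1 : (p : ℚ)⁻¹ < 1 := inv_lt_one_of_one_lt₀ (by exact_mod_cast hpp.one_lt)
  have key (x : ℚ) (hx : x ∈ s) (hne : x ≠ x₁) : padicNorm p (x - (x₁ + p)) = 1 := by
    have h1 : max (x - x₁).num.natAbs (x - x₁).den < p :=
      Nat.lt_of_succ_le ((Nat.succ_le_succ
        (Finset.le_sup (f := fun x => max (x - x₁).num.natAbs (x - x₁).den) hx)).trans hp)
    have h2 : padicNorm p (x - x₁) = 1 := by
      have h3 : padicNorm p ((x - x₁).num : ℚ) = 1 := by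
        rw [padicNorm.int_eq_one_iff]
        intro h
        have h4 := Int.natAbs_dvd_natAbs.mpr h
        rw [Int.natAbs_natCast] at h4
        have h5 := Nat.le_of_dvd (Int.natAbs_pos.mpr (Rat.num_ne_zero.mpr (sub_ne_zero.mpr hne))) h4
        omega
      have h6 : padicNorm p ((x - x₁).den : ℚ) = 1 := by
        rw [padicNorm.nat_eq_one_iff]
        intro h
        have h7 := Nat.le_of_dvd (x - x₁).den_pos h
        omega
      rw [← Rat.num_div_den (x - x₁), padicNorm.div, h3, h6, div_one]
    rw [show x - (x₁ + p) = (x - x₁) + -p by ring, padicNorm.add_eq_max_of_ne, h2, hp0]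
    · exact max_eq_left hp1.le
    · rw [h2, hp0]; exact hp1.ne'
  have hf0 : Rat.AbsoluteValue.padic p (x₁ - (x₁ + p)) ≠ 1 := by
    rw [show x₁ - (x₁ + p) = -(p : ℚ) by ring, Rat.AbsoluteValue.padic_eq_padicNorm, hp0]
    exact_mod_cast hp1.ne
  refine ⟨x₁ + p, fun hmem => ?_, Rat.AbsoluteValue.padic p, x₁, hx₁, hf0, fun x hx hne => ?_⟩
  · have h1 := key _ hmem (by simpa using hpp.ne_zero)
    rw [sub_self, padicNorm.zero] at h1
    exact zero_ne_one h1
  · rw [Rat.AbsoluteValue.padic_eq_padicNorm, key x hx hne, Rat.cast_one]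

/-- Clearing denominators makes the nodal weights integral; the factor 2 will make every zero and
pole ramified. -/
lemma exists_even_exponents (u : Finset ℚ) : ∃ (M : ℚ) (e : ℚ → ℤ), M ≠ 0 ∧ ∀ x ∈ u,
    (2 * e x : ℚ) = M * Lagrange.nodalWeight u id x ∧ e x ≠ 0 := by
  obtain ⟨b, hb⟩ := IsLocalization.exist_integer_multiples_of_finset (nonZeroDivisors ℤ)
    (u.image fun x => Lagrange.nodalWeight u id x)
  have h1 (x : ℚ) : ∃ m : ℤ, x ∈ u → (m : ℚ) = (b : ℤ) * Lagrange.nodalWeight u id x := by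
    by_cases hx : x ∈ u
    · obtain ⟨m, hm⟩ := hb _ (Finset.mem_image_of_mem _ hx)
      refine ⟨m, fun _ => ?_⟩
      rw [← zsmul_eq_mul]
      exact hm
    · exact ⟨0, fun h => absurd h hx⟩
  choose e he using h1
  have hb0 : ((b : ℤ) : ℚ) ≠ 0 := Int.cast_ne_zero.mpr (nonZeroDivisors.coe_ne_zero b)
  refine ⟨2 * (b : ℤ), e, mul_ne_zero two_ne_zero hb0, fun x hx => ⟨?_, fun h0 => ?_⟩⟩
  · rw [he x hx, mul_assoc]
  · have h2 := he x hx
    rw [h0, Int.cast_zero] at h2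
    exact mul_ne_zero hb0 (Lagrange.nodalWeight_ne_zero Function.injective_id.injOn hx) h2.symm

/-- By Lagrange interpolation the sum is the coefficient of X^m in degree |u| − 1. -/
lemma sum_nodalWeight_mul_pow {u : Finset ℚ} {m : ℕ} (hm : m + 1 < u.card) :
    ∑ x ∈ u, Lagrange.nodalWeight u id x * x ^ m = 0 := by
  have h1 := Lagrange.coeff_eq_sum (s := u) (v := id) Function.injective_id.injOn
    (P := (X : ℚ[X]) ^ m) (by rw [degree_X_pow]; exact_mod_cast (by omega : m < u.card))
  rw [coeff_X_pow, if_neg (by omega)] at h1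
  rw [h1]
  refine Finset.sum_congr rfl fun x _ => ?_
  rw [Lagrange.nodalWeight, Finset.prod_inv_distrib]
  simp [div_eq_inv_mul]

end Exponents

/-! ### Logarithmic derivatives -/

section LogDerivative

open TrivSqZeroExt

variable {L : Type*} [Field L]

/-- The logarithmic derivative. -/
def logDer (a : DualNumber L) : L := snd a / fst a

lemma logDer_mul {a b : DualNumber L} (ha : fst a ≠ 0) (hb : fst b ≠ 0) :
    logDer (a * b) = logDer a + logDer b := by
  simp [logDer]
  field_simp
  ring

lemma logDer_pow {a : DualNumber L} (ha : fst a ≠ 0) (m : ℕ) : logDer (a ^ m) = m * logDer a := by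
  induction m with
  | zero => simp [logDer]
  | succ m ih =>
    rw [pow_succ, logDer_mul (by simpa using fun h => absurd h ha) ha, ih]
    push_cast
    ring

lemma fst_prod {ι : Type*} (s : Finset ι) (a : ι → DualNumber L) :
    fst (∏ i ∈ s, a i) = ∏ i ∈ s, fst (a i) :=
  map_prod (fstHom L L L) a s

lemma logDer_prod {ι : Type*} (s : Finset ι) (a : ι → DualNumber L) (h : ∀ i ∈ s, fst (a i) ≠ 0) :
    logDer (∏ i ∈ s, a i) = ∑ i ∈ s, logDer (a i) := by
  classical
  induction s using Finset.induction_on with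
  | empty => simp [logDer]
  | insert i s hi ih =>
    have h1 := fun j hj => h j (Finset.mem_insert_of_mem hj)
    rw [Finset.prod_insert hi, Finset.sum_insert hi, logDer_mul (h i (Finset.mem_insert_self _ _)),
      ih h1]
    rw [fst_prod]
    exact Finset.prod_ne_zero_iff.mpr h1

lemma wronskian_eq_logDer {a b : DualNumber L} (ha : fst a ≠ 0) (hb : fst b ≠ 0) :
    wronskian a b = fst a * fst b * (logDer b - logDer a) := by
  simp [wronskian, logDer]
  field_simp

lemma prod_pow_eq_zero {ι : Type*} {s : Finset ι} {a : ι → DualNumber L} {m : ι → ℕ} {i : ι}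
    (hi : i ∈ s) (hm : 2 ≤ m i) (h : fst (a i) = 0) : ∏ i ∈ s, a i ^ m i = 0 := by
  refine Finset.prod_eq_zero hi ?_
  have h2 : a i ^ 2 = 0 := by ext <;> simp [h, pow_two]
  obtain ⟨k, hk⟩ := Nat.exists_eq_add_of_le hm
  rw [hk, pow_add, h2, zero_mul]

/-- With y = a/b this reads dlog(a − x b) = dlog b + dy/(y − x), where dy is minus the Wronskian
divided by b². -/
lemma logDer_sub_smul {a b : DualNumber L} {x : L} (hb : fst b ≠ 0)
    (h : fst a - x * fst b ≠ 0) :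
    logDer (a - x • b) = logDer b - wronskian a b / fst b ^ 2 * (fst a / fst b - x)⁻¹ := by
  have h1 : fst a / fst b - x = (fst a - x * fst b) / fst b := by field_simp
  rw [h1]
  simp [logDer, wronskian]
  field_simp
  ring

end LogDerivative

/-! ### From rational branch values to three branch points -/

namespace CurveData

open TrivSqZeroExt

variable {K L : Type u} [Field K] [CharZero K] [Field L] [CharZero L] [Algebra K L] {n : ℕ}
  {V : CurveData K L n}

/-- The analogue for pencils of a Belyi map with the required properties. -/
structure IsBelyi (V : CurveData K L n) (S T : Set V.Point) (d : ℕ)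
    (F G : MvPolynomial (Fin (n + 1)) K) : Prop where
  pencil : V.IsPencil d F G
  of_wronskian_eq_zero (P : V.Point) (hP : wronskian (V.jet P F) (V.jet P G) = 0) :
    fst (V.jet P F) = 0 ∨ fst (V.jet P G) = 0 ∨ fst (V.jet P F) = fst (V.jet P G)
  exists_zero : ∃ P, wronskian (V.jet P F) (V.jet P G) = 0 ∧ fst (V.jet P F) = 0
  exists_infty : ∃ P, wronskian (V.jet P F) (V.jet P G) = 0 ∧ fst (V.jet P G) = 0
  exists_one : ∃ P, wronskian (V.jet P F) (V.jet P G) = 0 ∧ fst (V.jet P F) = fst (V.jet P G)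
  ramified (P : V.Point) (hP : P ∈ S) : wronskian (V.jet P F) (V.jet P G) = 0
  notMem (P : V.Point) (hP : P ∈ T) : fst (V.jet P F) ≠ 0 ∧ fst (V.jet P G) ≠ 0 ∧
    fst (V.jet P F) ≠ fst (V.jet P G)

omit [CharZero K] in
lemma exists_isBelyi_of_finset {S T : Set V.Point} {d : ℕ} {F G : MvPolynomial (Fin (n + 1)) K}
    (h : V.IsPencil d F G) {u : Finset ℚ} (hu : 3 ≤ u.card) (hu0 : 0 ∉ u)
    (hS : ∀ P, wronskian (V.jet P F) (V.jet P G) = 0 ∨ P ∈ S →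
      ∃ x ∈ u, fst (V.jet P F) = x * fst (V.jet P G))
    (hT : ∀ t ∈ T, fst (V.jet t F) = 0) {f : AbsoluteValue ℚ ℝ} {x₁ : ℚ} (hx₁ : x₁ ∈ u)
    (hf₁ : f x₁ ≠ 1) (hf : ∀ x ∈ u, x ≠ x₁ → f x = 1) :
    ∃ (d' : ℕ) (F' G' : _), V.IsBelyi S T d' F' G' := by
  obtain ⟨M, e, hM, he⟩ := exists_even_exponents u
  have hesum (m : ℕ) (hm : m + 1 < u.card) : ∑ x ∈ u, (e x : ℚ) * x ^ m = 0 := by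
    have h1 := sum_nodalWeight_mul_pow hm
    have h2 : ∑ x ∈ u, (2 * e x : ℚ) * x ^ m = 0 := by
      rw [Finset.sum_congr rfl fun x hx => by rw [(he x hx).1, mul_assoc], ← Finset.mul_sum, h1,
        mul_zero]
    simp only [mul_assoc] at h2
    rw [← Finset.mul_sum] at h2
    exact (mul_eq_zero.mp h2).resolve_left two_ne_zero
  have hesum0 : ∑ x ∈ u, e x = 0 := by
    have := hesum 0 (by omega)
    simp only [pow_zero, mul_one] at this
    exact_mod_cast this
  -- The positive and negative parts of `2 * e` are the exponents in numerator and denominator.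
  set a : ℚ → ℕ := fun x => 2 * (e x).toNat with ha
  set b : ℚ → ℕ := fun x => 2 * (-e x).toNat with hb
  have hab (x : ℚ) : (a x : ℤ) - b x = 2 * e x := by
    simp only [ha, hb]
    push_cast
    have := Int.toNat_sub_toNat_neg (e x)
    linarith
  have habsum : ∑ x ∈ u, a x = ∑ x ∈ u, b x := by
    have h1 : ∑ x ∈ u, ((a x : ℤ) - b x) = 0 := by
      rw [Finset.sum_congr rfl fun x _ => hab x, ← Finset.mul_sum, hesum0, mul_zero]
    rw [Finset.sum_sub_distrib, sub_eq_zero] at h1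
    exact_mod_cast h1
  have hpos (x : ℚ) (hx : 0 < e x) : 2 ≤ a x ∧ b x = 0 := by
    simp only [ha, hb]; omega
  have hneg (x : ℚ) (hx : e x < 0) : a x = 0 ∧ 2 ≤ b x := by
    simp only [ha, hb]; omega
  have hexpos : ∃ x ∈ u, 0 < e x := by
    by_contra! hcon
    exact (he x₁ hx₁).2 ((Finset.sum_eq_zero_iff_of_nonpos hcon).mp hesum0 x₁ hx₁)
  have hexneg : ∃ x ∈ u, e x < 0 := by
    by_contra! hcon
    exact (he x₁ hx₁).2 ((Finset.sum_eq_zero_iff_of_nonneg hcon).mp hesum0 x₁ hx₁)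
  set t : ℚ → MvPolynomial (Fin (n + 1)) K := fun x => F - (x : K) • G with ht
  have hthom (x : ℚ) : (t x).IsHomogeneous d := by
    refine h.left.sub ?_
    rw [MvPolynomial.smul_eq_C_mul]
    exact h.right.C_mul _
  have hjt (P : V.Point) (x : ℚ) : V.jet P (t x) = V.jet P F - (x : L) • V.jet P G := by
    rw [ht, map_sub, map_smul]
    congr 1
    rw [← algebraMap_smul L, map_ratCast]
  have hjt0 (P : V.Point) (x : ℚ) :
      fst (V.jet P (t x)) = fst (V.jet P F) - x * fst (V.jet P G) := by
    rw [hjt]; simp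
  set F' := ∏ x ∈ u, t x ^ a x with hF'
  set G' := ∏ x ∈ u, t x ^ b x with hG'
  have hF'hom : F'.IsHomogeneous (d * ∑ x ∈ u, a x) := by
    rw [Finset.mul_sum]
    exact MvPolynomial.IsHomogeneous.prod _ _ _ fun x _ => (hthom x).pow _
  have hG'hom : G'.IsHomogeneous (d * ∑ x ∈ u, a x) := by
    rw [habsum, Finset.mul_sum]
    exact MvPolynomial.IsHomogeneous.prod _ _ _ fun x _ => (hthom x).pow _
  have hjF (P : V.Point) : V.jet P F' = ∏ x ∈ u, V.jet P (t x) ^ a x := by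
    simp [hF', map_prod]
  have hjG (P : V.Point) : V.jet P G' = ∏ x ∈ u, V.jet P (t x) ^ b x := by
    simp [hG', map_prod]
  have hzero (P : V.Point) (x : ℚ) (hx : x ∈ u) (hP : fst (V.jet P (t x)) = 0) :
      (0 < e x → V.jet P F' = 0) ∧ (e x < 0 → V.jet P G' = 0) := by
    rw [hjF, hjG]
    exact ⟨fun h0 => prod_pow_eq_zero hx (hpos x h0).1 hP,
      fun h0 => prod_pow_eq_zero hx (hneg x h0).2 hP⟩
  have hzero' (P : V.Point) (hP : ∃ x ∈ u, fst (V.jet P (t x)) = 0) :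
      wronskian (V.jet P F') (V.jet P G') = 0 ∧
        (fst (V.jet P F') = 0 ∨ fst (V.jet P G') = 0) := by
    obtain ⟨x, hx, hP⟩ := hP
    rcases lt_or_gt_of_ne (he x hx).2 with h0 | h0
    · have h1 := (hzero P x hx hP).2 h0
      simp [h1, wronskian]
    · have h1 := (hzero P x hx hP).1 h0
      simp [h1, wronskian]
  have hne (P : V.Point) (hP : ∀ x ∈ u, fst (V.jet P (t x)) ≠ 0) :
      fst (V.jet P F') ≠ 0 ∧ fst (V.jet P G') ≠ 0 := by
    rw [hjF, hjG, fst_prod, fst_prod]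
    simp only [fst_pow]
    exact ⟨Finset.prod_ne_zero_iff.mpr fun x hx => pow_ne_zero _ (hP x hx),
      Finset.prod_ne_zero_iff.mpr fun x hx => pow_ne_zero _ (hP x hx)⟩
  have hW (P : V.Point) (hP : ∀ x ∈ u, fst (V.jet P (t x)) ≠ 0) :
      wronskian (V.jet P F') (V.jet P G') = - (fst (V.jet P F') * fst (V.jet P G') * 2 *
        ∑ x ∈ u, (e x : L) * logDer (V.jet P (t x))) := by
    rw [wronskian_eq_logDer (hne P hP).1 (hne P hP).2]
    have h1 (m : ℚ → ℕ) : logDer (∏ x ∈ u, V.jet P (t x) ^ m x) =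
        ∑ x ∈ u, (m x : L) * logDer (V.jet P (t x)) := by
      rw [logDer_prod _ _ fun x hx => by
        rw [fst_pow]; exact pow_ne_zero _ (hP x hx)]
      exact Finset.sum_congr rfl fun x hx => logDer_pow (hP x hx) _
    have h2 : logDer (V.jet P G') - logDer (V.jet P F') =
        - (2 * ∑ x ∈ u, (e x : L) * logDer (V.jet P (t x))) := by
      rw [hjF, hjG, h1, h1, ← Finset.sum_sub_distrib, Finset.mul_sum, ← Finset.sum_neg_distrib]
      refine Finset.sum_congr rfl fun x _ => ?_
      have h3 : (a x : L) - b x = 2 * e x := by exact_mod_cast congrArg (Int.cast : ℤ → L) (hab x)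
      linear_combination -h3 * logDer (V.jet P (t x))
    rw [h2]
    ring
  -- Over ∞ the value is 1 because the exponents sum to zero; ramification needs also ∑ e x * x = 0,
  -- and this is where three elements of `u` are required.
  have hinfty (P : V.Point) (hP : fst (V.jet P G) = 0) :
      fst (V.jet P F') = fst (V.jet P G') ∧ wronskian (V.jet P F') (V.jet P G') = 0 := by
    have hF0 : fst (V.jet P F) ≠ 0 := fun h0 => h.ne_zero P h0 hP
    have h1 (x : ℚ) : fst (V.jet P (t x)) = fst (V.jet P F) := by rw [hjt0, hP]; simp
    refine ⟨?_, ?_⟩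
    · rw [hjF, hjG, fst_prod, fst_prod]
      simp only [fst_pow, h1]
      rw [Finset.prod_pow_eq_pow_sum, Finset.prod_pow_eq_pow_sum, habsum]
    · rw [hW P fun x _ => by rw [h1]; exact hF0]
      have h2 : ∑ x ∈ u, (e x : L) * logDer (V.jet P (t x)) =
          snd (V.jet P F) / fst (V.jet P F) * ((∑ x ∈ u, (e x : ℚ) * x ^ 0 : ℚ) : L) -
          snd (V.jet P G) / fst (V.jet P F) * ((∑ x ∈ u, (e x : ℚ) * x ^ 1 : ℚ) : L) := by
        push_cast
        rw [Finset.mul_sum, Finset.mul_sum, ← Finset.sum_sub_distrib]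
        refine Finset.sum_congr rfl fun x _ => ?_
        rw [logDer, h1, hjt]
        simp
        ring
      rw [h2, hesum 0 (by omega), hesum 1 (by omega)]
      simp
  have hfinite (P : V.Point) (hP : ∀ x ∈ u, fst (V.jet P (t x)) ≠ 0) (hG : fst (V.jet P G) ≠ 0) :
      wronskian (V.jet P F') (V.jet P G') ≠ 0 := by
    have hWP : wronskian (V.jet P F) (V.jet P G) ≠ 0 := by
      intro h0
      obtain ⟨x, hx, hPx⟩ := hS P (Or.inl h0)
      exact hP x hx (by rw [hjt0, hPx, sub_self])
    rw [hW P hP, neg_ne_zero]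
    refine mul_ne_zero (mul_ne_zero (mul_ne_zero (hne P hP).1 (hne P hP).2) two_ne_zero) ?_
    -- Partial fractions: up to nonzero factors this is the sum of w_x/(y − x) with nodal weights
    -- w_x, that is 1/∏ (y − x), which has no zeros.
    have h1 : 2 * ∑ x ∈ u, (e x : L) * logDer (V.jet P (t x)) =
        - (wronskian (V.jet P F) (V.jet P G) / fst (V.jet P G) ^ 2 * M *
        ∑ x ∈ u, Lagrange.nodalWeight u (fun x : ℚ => (x : L)) x *
          (fst (V.jet P F) / fst (V.jet P G) - x)⁻¹) := by
      have h2 : ∑ x ∈ u, (e x : L) * logDer (V.jet P (t x)) =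
          logDer (V.jet P G) * ((∑ x ∈ u, (e x : ℚ) * x ^ 0 : ℚ) : L) +
          ∑ x ∈ u, (e x : L) * (logDer (V.jet P (t x)) - logDer (V.jet P G)) := by
        push_cast
        rw [Finset.mul_sum, ← Finset.sum_add_distrib]
        refine Finset.sum_congr rfl fun x _ => ?_
        ring
      rw [h2, hesum 0 (by omega), Rat.cast_zero, mul_zero, zero_add, Finset.mul_sum, Finset.mul_sum,
        ← Finset.sum_neg_distrib]
      refine Finset.sum_congr rfl fun x hx => ?_
      have h3 := hP x hx
      rw [hjt0] at h3
      rw [hjt, logDer_sub_smul hG h3]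
      have h4 : (2 * e x : L) = M * Lagrange.nodalWeight u (fun x : ℚ => (x : L)) x := by
        have h5 := congrArg (Rat.cast : ℚ → L) (he x hx).1
        rw [Lagrange.nodalWeight] at h5 ⊢
        push_cast at h5
        exact h5
      linear_combination -(wronskian (V.jet P F) (V.jet P G) / fst (V.jet P G) ^ 2 *
        (fst (V.jet P F) / fst (V.jet P G) - x)⁻¹) * h4
    intro h0
    rw [h0, mul_zero, eq_comm, neg_eq_zero] at h1
    refine mul_ne_zero (mul_ne_zero (div_ne_zero hWP (pow_ne_zero _ hG)) (Rat.cast_ne_zero.mpr hM))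
      (Lagrange.sum_nodalWeight_mul_inv_sub_ne_zero Rat.cast_injective.injOn (fun x hx h0 => ?_)
        ⟨x₁, hx₁⟩) h1
    refine hP x hx ?_
    rw [hjt0, ← h0, div_mul_cancel₀ _ hG, sub_self]
  refine ⟨d * ∑ x ∈ u, a x, F', G', ⟨?_, hF'hom, hG'hom, ?_⟩, ?_, ?_, ?_, ?_, ?_, ?_⟩
  · obtain ⟨x, hx, hx0⟩ := hexpos
    refine Nat.mul_pos h.pos (Nat.pos_of_ne_zero fun h0 => ?_)
    have h1 := Finset.sum_eq_zero_iff.mp h0 x hx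
    have h2 := (hpos x hx0).1
    omega
  · intro P hP hP'
    rw [hjF, fst_prod, Finset.prod_eq_zero_iff] at hP
    rw [hjG, fst_prod, Finset.prod_eq_zero_iff] at hP'
    obtain ⟨x, hx, hPx⟩ := hP
    obtain ⟨y, hy, hPy⟩ := hP'
    rw [fst_pow] at hPx hPy
    have hx0 : a x ≠ 0 := fun h0 => by simp [h0] at hPx
    have hy0 : b y ≠ 0 := fun h0 => by simp [h0] at hPy
    have hxy : x ≠ y := by
      rintro rfl
      rcases lt_or_gt_of_ne (he x hx).2 with h0 | h0
      · exact hx0 (hneg x h0).1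
      · exact hy0 (hpos x h0).2
    have h1 := eq_zero_of_pow_eq_zero hPx
    have h2 := eq_zero_of_pow_eq_zero hPy
    rw [hjt0] at h1 h2
    have h3 : ((x : L) - y) * fst (V.jet P G) = 0 := by linear_combination h2 - h1
    have h4 := (mul_eq_zero.mp h3).resolve_left (sub_ne_zero.mpr (Rat.cast_injective.ne hxy))
    rw [h4, mul_zero, sub_zero] at h1
    exact h.ne_zero P h1 h4
  · intro P hP
    by_cases h1 : ∃ x ∈ u, fst (V.jet P (t x)) = 0
    · exact (hzero' P h1).2.elim Or.inl fun h2 => Or.inr (Or.inl h2)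
    · push Not at h1
      by_cases h2 : fst (V.jet P G) = 0
      · exact Or.inr (Or.inr (hinfty P h2).1)
      · exact absurd hP (hfinite P h1 h2)
  · obtain ⟨x, hx, hx0⟩ := hexpos
    obtain ⟨P, hP⟩ := V.exists_zero h.pos (hthom x)
    have h1 := (hzero P x hx hP).1 hx0
    exact ⟨P, by simp [h1, wronskian]⟩
  · obtain ⟨x, hx, hx0⟩ := hexneg
    obtain ⟨P, hP⟩ := V.exists_zero h.pos (hthom x)
    have h1 := (hzero P x hx hP).2 hx0
    exact ⟨P, by simp [h1, wronskian]⟩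
  · obtain ⟨P, hP⟩ := V.exists_zero h.pos h.right
    exact ⟨P, (hinfty P hP).2, (hinfty P hP).1⟩
  · intro P hP
    obtain ⟨x, hx, hPx⟩ := hS P (Or.inr hP)
    exact (hzero' P ⟨x, hx, by rw [hjt0, hPx, sub_self]⟩).1
  · intro P hP
    have hG0 : fst (V.jet P G) ≠ 0 := h.ne_zero P (hT P hP)
    have h1 (x : ℚ) : fst (V.jet P (t x)) = ((-x : ℚ) : L) * fst (V.jet P G) := by
      rw [hjt0, hT P hP]; simp
    have h2 := hne P fun x hx => by
      rw [h1]
      exact mul_ne_zero (Rat.cast_ne_zero.mpr (neg_ne_zero.mpr fun h0 => hu0 (h0 ▸ hx))) hG0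
    refine ⟨h2.1, h2.2, fun h3 => ?_⟩
    rw [hjF, hjG, fst_prod, fst_prod] at h3
    simp only [fst_pow, h1, mul_pow, Finset.prod_mul_distrib] at h3
    rw [Finset.prod_pow_eq_pow_sum, Finset.prod_pow_eq_pow_sum, habsum] at h3
    have h4 := mul_right_cancel₀ (pow_ne_zero _ hG0) h3
    -- If a point of `T` had value 1, the two products of rationals would agree. Under `f` they
    -- become powers of `f x₁ ≠ 1`, exactly one of which has exponent zero.
    have h5 : ∏ x ∈ u, (-x) ^ a x = ∏ x ∈ u, (-x) ^ b x := by
      refine Rat.cast_injective (α := L) ?_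
      rw [Rat.cast_prod, Rat.cast_prod]
      simpa only [Rat.cast_pow] using h4
    have h6 (m : ℚ → ℕ) : f (∏ x ∈ u, (-x) ^ m x) = f x₁ ^ m x₁ := by
      rw [map_prod, Finset.prod_eq_single x₁]
      · rw [map_pow, AbsoluteValue.map_neg]
      · intro x hx hne
        rw [map_pow, AbsoluteValue.map_neg, hf x hx hne, one_pow]
      · exact fun h0 => absurd hx₁ h0
    have h7 := congrArg f h5
    rw [h6, h6] at h7
    rcases lt_or_gt_of_ne (he x₁ hx₁).2 with h0 | h0
    · rw [(hneg x₁ h0).1, pow_zero, eq_comm] at h7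
      have := (hneg x₁ h0).2
      exact hf₁ ((pow_eq_one_iff_of_nonneg (f.nonneg _) (by omega)).mp h7)
    · rw [(hpos x₁ h0).2, pow_zero] at h7
      have := (hpos x₁ h0).1
      exact hf₁ ((pow_eq_one_iff_of_nonneg (f.nonneg _) (by omega)).mp h7)

/-- Every smooth curve in projective space over a field of characteristic zero which is algebraic
over the rational numbers carries a pencil with the properties of a Belyi map. -/
lemma exists_isBelyi [Algebra.IsAlgebraic ℚ L] {S T : Set V.Point} (hS : S.Finite) (hT : T.Finite)
    (hST : ∀ t ∈ T, ∀ s ∈ S, V.center t ≠ V.center s) :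
    ∃ (d : ℕ) (F G : _), V.IsBelyi S T d F G := by
  classical
  obtain ⟨d, F, G, h, hGT, hGS, hsimple⟩ := exists_pencil_simple_zeros hS hT hST
  have hWfin : {P | wronskian (V.jet P F) (V.jet P G) = 0}.Finite := by
    obtain ⟨P, hP⟩ := V.exists_zero h.pos h.left
    obtain ⟨Q, hQ⟩ := V.exists_zero h.pos h.right
    exact V.finite_wronskian h.pos h.left h.right ⟨Q, fun h0 => h.ne_zero Q h0 hQ⟩
      ⟨P, hP, h.ne_zero P hP⟩
  set B := ((hWfin.union hS).image fun P => fst (V.jet P F) / fst (V.jet P G)).toFinset with hB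
  have hprep : V.IsPrepared S T B d F G := by
    refine ⟨h, hGT, fun P hP => ⟨?_, ?_⟩⟩
    · rcases hP with hP | hP
      · intro h0
        rw [wronskian, h0, mul_zero, sub_zero, mul_eq_zero] at hP
        exact hP.elim (fun h1 => h.ne_zero P h1 h0) (hsimple P h0)
      · exact hGS P hP
    · rw [hB, Set.Finite.coe_toFinset]
      exact ⟨P, hP, rfl⟩
  obtain ⟨d, F, G, B, h, hB⟩ := hprep.exists_rational (k := ℚ)
    (B.sup fun y => (minpoly ℚ y).natDegree) fun y hy =>
      (Finset.le_sup (f := fun y => (minpoly ℚ y).natDegree) hy).trans (Nat.le_succ _)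
  choose! q hq using hB
  -- The numbers 0, 1, 2 only ensure that there are at least three elements.
  set s : Finset ℚ := B.image q ∪ {0, 1, 2} with hs
  have hscard : 3 ≤ s.card := by
    have h1 : ({0, 1, 2} : Finset ℚ).card = 3 := by decide
    rw [← h1]
    exact Finset.card_le_card Finset.subset_union_right
  obtain ⟨c, hc, f, y₁, hy₁, hfy₁, hf⟩ := exists_padic_center (s := s)
    (Finset.card_pos.mp (by omega))
  have hinj : Function.Injective fun y : ℚ => (y - c)⁻¹ :=
    inv_injective.comp sub_left_injective
  -- Composition with x ↦ 1/(x − c), which moves the image of `T` from ∞ to 0.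
  refine exists_isBelyi_of_finset (F := G) (G := F - (c : K) • G) (d := d)
    (u := s.image fun y => (y - c)⁻¹) (f := f) (x₁ := (y₁ - c)⁻¹) ?_ ?_ ?_ ?_ h.eq_zero
    (Finset.mem_image_of_mem _ hy₁) ?_ ?_
  · refine ⟨h.pencil.pos, h.pencil.right, h.pencil.left.sub ?_, fun P hP hP' => ?_⟩
    · rw [MvPolynomial.smul_eq_C_mul]
      exact h.pencil.right.C_mul _
    · rw [map_sub, map_smul, fst_sub, fst_smul, hP, smul_zero, sub_zero] at hP'
      exact h.pencil.ne_zero P hP' hP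
  · rwa [Finset.card_image_of_injective _ hinj]
  · rw [Finset.mem_image]
    rintro ⟨y, hy, h0⟩
    rw [inv_eq_zero, sub_eq_zero] at h0
    exact hc (h0 ▸ hy)
  · intro P hP
    have hj : V.jet P (F - (c : K) • G) = V.jet P F - (c : L) • V.jet P G := by
      rw [map_sub, map_smul]
      congr 1
      rw [← algebraMap_smul L, map_ratCast]
    have hP' : wronskian (V.jet P F) (V.jet P G) = 0 ∨ P ∈ S := by
      refine hP.imp_left fun h0 => ?_
      rw [hj] at h0
      simp only [wronskian, fst_sub, fst_smul, snd_sub, snd_smul, smul_eq_mul] at h0 ⊢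
      linear_combination -h0
    obtain ⟨h1, h2⟩ := h.mem P hP'
    have h3 := hq _ h2
    have h4 : q (fst (V.jet P F) / fst (V.jet P G)) ∈ s :=
      Finset.mem_union_left _ (Finset.mem_image_of_mem _ h2)
    refine ⟨_, Finset.mem_image_of_mem _ h4, ?_⟩
    rw [hj, fst_sub, fst_smul, smul_eq_mul]
    generalize hy : q (fst (V.jet P F) / fst (V.jet P G)) = y at h3 h4
    have h5 : (y : L) - c ≠ 0 := by
      rw [sub_ne_zero]
      exact fun h0 => hc (Rat.cast_injective h0 ▸ h4)
    rw [eq_ratCast, eq_div_iff h1] at h3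
    push_cast
    rw [← h3]
    field_simp
  · rwa [map_inv₀, inv_ne_one]
  · intro x hx hne
    obtain ⟨y, hy, rfl⟩ := Finset.mem_image.mp hx
    rw [map_inv₀, inv_eq_one, hf y hy]
    rintro rfl
    exact hne rfl

end CurveData

/-! ### The finite morphism defined by a pencil -/

section Gluing

open MvPolynomial

variable {K : Type u} [Field K] {n : ℕ} {X : Scheme.{u}} {ι : X ⟶ Proj (gradingByDegree K n)}

/-- Substitution of the values of two forms for the coordinates of the projective line. -/
def pencilEval {R : Type*} [CommRing R] [Algebra K R] (a : MvPolynomial (Fin (n + 1)) K →ₐ[K] R)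
    (F G : MvPolynomial (Fin (n + 1)) K) : MvPolynomial (Fin (1 + 1)) K →ₐ[K] R :=
  aeval ![a F, a G]

section

variable {R : Type*} [CommRing R] [Algebra K R] (a : MvPolynomial (Fin (n + 1)) K →ₐ[K] R)
    (F G : MvPolynomial (Fin (n + 1)) K)

@[simp]
lemma pencilEval_X_zero : pencilEval a F G (MvPolynomial.X 0) = a F := by simp [pencilEval]

@[simp]
lemma pencilEval_X_one : pencilEval a F G (MvPolynomial.X 1) = a G := by simp [pencilEval]

lemma comp_pencilEval {R' : Type*} [CommRing R'] [Algebra K R'] (ρ : R →ₐ[K] R') :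
    ρ.comp (pencilEval a F G) = pencilEval (ρ.comp a) F G := by
  ext i
  fin_cases i <;> simp [pencilEval]

end

lemma Chart.map_comp_hom (c : Chart ι) :
    c.map ≫ ι ≫ projHom K n = Spec.map (CommRingCat.ofHom (algebraMap K c.ring)) := by
  rw [← Category.assoc, c.map_comp, toProj_comp_hom]

lemma Chart.exists_algHom (c : Chart ι) {A : Type u} [CommRing A] [Algebra K A]
    (α : Spec (CommRingCat.of A) ⟶ Spec (CommRingCat.of c.ring))
    (hα : α ≫ c.map ≫ ι ≫ projHom K n = Spec.map (CommRingCat.ofHom (algebraMap K A))) :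
    ∃ ρ : c.ring →ₐ[K] A, α = Spec.map (CommRingCat.ofHom ρ.toRingHom) := by
  obtain ⟨ρ, rfl⟩ := Spec.map_surjective α
  rw [c.map_comp_hom, ← Spec.map_comp] at hα
  exact ⟨{ ρ.hom with commutes' := fun x => congrArg (fun f => f.hom x) (Spec.map_injective hα) },
    rfl⟩

variable {F G : MvPolynomial (Fin (n + 1)) K} {d : ℕ}

/-- On an overlap the coordinates of the two charts differ by a unit, so both forms change by the
`d`-th power of this unit. -/
lemma comp_toProj_pencilEval_of_isAffine (hF : F.IsHomogeneous d) (hG : G.IsHomogeneous d)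
    {c c' : Chart ι}
    (hs : Ideal.span (Set.range fun j => pencilEval c.eval F G (MvPolynomial.X j)) = ⊤)
    (hs' : Ideal.span (Set.range fun j => pencilEval c'.eval F G (MvPolynomial.X j)) = ⊤)
    {A : Type u} [CommRing A] (α : Spec (CommRingCat.of A) ⟶ Spec (CommRingCat.of c.ring))
    (β : Spec (CommRingCat.of A) ⟶ Spec (CommRingCat.of c'.ring))
    (h : α ≫ c.map = β ≫ c'.map) : α ≫ toProj _ hs = β ≫ toProj _ hs' := by
  obtain ⟨κ, hκ⟩ := Spec.map_surjective (α ≫ c.map ≫ ι ≫ projHom K n)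
  let _ : Algebra K A := κ.hom.toAlgebra
  obtain ⟨ρ, rfl⟩ := c.exists_algHom α hκ.symm
  obtain ⟨ρ', rfl⟩ := c'.exists_algHom β ((reassoc_of% h) (ι ≫ projHom K n) ▸ hκ.symm)
  have h1 := h =≫ ι
  rw [Category.assoc, Category.assoc, c.map_comp, c'.map_comp, map_toProj, map_toProj] at h1
  have hu : IsUnit ((ρ.comp c.eval) (MvPolynomial.X c.index)) := c.isUnit_eval_index.map ρ
  obtain ⟨u, hu, hu'⟩ := proportional_of_toProj_eq _ _ hu h1
  rw [map_toProj, map_toProj]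
  refine toProj_eq_of_proportional _ _ (hu.pow d) fun j => ?_
  rw [comp_pencilEval, comp_pencilEval]
  fin_cases j
  · simpa [pencilEval] using hu' d F hF
  · simpa [pencilEval] using hu' d G hG

lemma comp_toProj_pencilEval (hF : F.IsHomogeneous d) (hG : G.IsHomogeneous d)
    {c c' : Chart ι}
    (hs : Ideal.span (Set.range fun j => pencilEval c.eval F G (MvPolynomial.X j)) = ⊤)
    (hs' : Ideal.span (Set.range fun j => pencilEval c'.eval F G (MvPolynomial.X j)) = ⊤)
    {Z : Scheme.{u}} (α : Z ⟶ Spec (CommRingCat.of c.ring))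
    (β : Z ⟶ Spec (CommRingCat.of c'.ring))
    (h : α ≫ c.map = β ≫ c'.map) : α ≫ toProj _ hs = β ≫ toProj _ hs' := by
  have key (A : Type u) [CommRing A] (g : Spec (CommRingCat.of A) ⟶ Z) :
      g ≫ α ≫ toProj _ hs = g ≫ β ≫ toProj _ hs' := by
    have := comp_toProj_pencilEval_of_isAffine hF hG hs hs' (g ≫ α) (g ≫ β) (by
      rw [Category.assoc, Category.assoc, h])
    rwa [Category.assoc, Category.assoc] at this
  exact Z.affineOpenCover.openCover.hom_ext _ _ fun i => key _ (Z.affineOpenCover.f i)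

variable (ch : X → Chart ι) (hch : ∀ x, x ∈ Set.range (ch x).map)

/-- The cover by the charts. -/
def chartCover : X.OpenCover :=
  Scheme.Cover.mkOfCovers X (fun x => Spec (CommRingCat.of (ch x).ring)) (fun x => (ch x).map)
    (fun x => ⟨x, hch x⟩) fun x => (ch x).isOpenImmersion

include hch in
/-- Two forms of the same degree without common zeros define a morphism to the projective line. -/
lemma exists_map_comp_eq_toProj (hF : F.IsHomogeneous d) (hG : G.IsHomogeneous d)
    (hs : ∀ x, Ideal.span (Set.range fun j => pencilEval (ch x).eval F G (MvPolynomial.X j)) = ⊤) :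
    ∃ φ : X ⟶ Proj (gradingByDegree K 1), ∀ x, (ch x).map ≫ φ = toProj _ (hs x) := by
  refine ⟨(chartCover ch hch).glueMorphisms (fun x => toProj _ (hs x)) fun x y => ?_, fun x => ?_⟩
  · exact comp_toProj_pencilEval hF hG (hs x) (hs y) _ _ Limits.pullback.condition
  · exact (chartCover ch hch).ι_glueMorphisms _ _ x

include hch in
lemma hom_ext_of_charts {Y : Scheme.{u}} {φ ψ : X ⟶ Y} (h : ∀ x, (ch x).map ≫ φ = (ch x).map ≫ ψ) :
    φ = ψ :=
  (chartCover ch hch).hom_ext _ _ h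

section

variable {φ : X ⟶ Proj (gradingByDegree K 1)}
  {hs : ∀ x, Ideal.span (Set.range fun j => pencilEval (ch x).eval F G (MvPolynomial.X j)) = ⊤}
  (hφ : ∀ x, (ch x).map ≫ φ = toProj _ (hs x))

include hch hφ

lemma comp_projHom_eq : φ ≫ projHom K 1 = ι ≫ projHom K n := by
  refine hom_ext_of_charts ch hch fun x => ?_
  rw [(ch x).map_comp_hom, ← Category.assoc, hφ, toProj_comp_hom]

lemma preimage_basicOpen_X (hd : 0 < d) (hF : F.IsHomogeneous d) (hG : G.IsHomogeneous d)
    (j : Fin (1 + 1)) : φ ⁻¹ᵁ Proj.basicOpen (gradingByDegree K 1) (MvPolynomial.X j) =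
      ι ⁻¹ᵁ Proj.basicOpen (gradingByDegree K n) (![F, G] j) := by
  ext x
  obtain ⟨p, hp⟩ := hch x
  have h1 := (ch x).mem_basicOpen_iff p (F := ![F, G] j) hd (by fin_cases j <;> assumption)
  have h2 := toProj_mem_basicOpen_iff _ (hs x) p one_pos (X_mem_grading j)
  rw [← hφ, Scheme.Hom.comp_apply] at h2
  rw [hp] at h1 h2
  refine h2.trans (Iff.trans ?_ h1.symm)
  fin_cases j <;> simp [pencilEval]

/-- Proper because the curve is proper over K; affine because the preimages of the two standard
charts are the complements of the zeros of `F` and of `G`. -/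
lemma isFinite_of_pencil [IsClosedImmersion ι] (hd : 0 < d) (hF : F.IsHomogeneous d)
    (hG : G.IsHomogeneous d) : IsFinite φ := by
  rw [IsFinite.iff_isProper_and_isAffineHom]
  constructor
  · have : IsProper (φ ≫ projHom K 1) := by
      rw [comp_projHom_eq ch hch hφ]
      infer_instance
    exact IsProper.of_comp φ (projHom K 1)
  · refine isAffineHom_of_forall_exists_isAffineOpen _ fun y => ?_
    obtain ⟨j, hj⟩ := exists_mem_basicOpen_X y
    refine ⟨_, hj, Proj.isAffineOpen_basicOpen _ _ (X_mem_grading j) one_pos, ?_⟩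
    rw [preimage_basicOpen_X ch hch hφ hd hF hG j]
    exact (Proj.isAffineOpen_basicOpen _ (![F, G] j) (m := d) (by fin_cases j <;> assumption)
      hd).preimage ι

end

section

variable {L : Type u} [Field L] [Algebra K L]

lemma span_range_eq_top_of_ne_zero {m : ℕ} {f : MvPolynomial (Fin (m + 1)) K →ₐ[K] L}
    (j : Fin (m + 1)) (hj : f (MvPolynomial.X j) ≠ 0) :
    Ideal.span (Set.range fun j => f (MvPolynomial.X j)) = ⊤ :=
  Ideal.eq_top_of_isUnit_mem _ (Ideal.subset_span ⟨j, rfl⟩) hj.isUnit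

lemma exists_ne_zero_of_span_range_eq_top {m : ℕ} {f : MvPolynomial (Fin (m + 1)) K →ₐ[K] L}
    (h : Ideal.span (Set.range fun j => f (MvPolynomial.X j)) = ⊤) :
    ∃ j, f (MvPolynomial.X j) ≠ 0 := by
  by_contra! hcon
  simp [hcon] at h

/-- Two points of the projective line agree if and only if their coordinates are proportional. -/
lemma toProj_eq_toProj_iff {f f' : MvPolynomial (Fin (1 + 1)) K →ₐ[K] L}
    (hf : Ideal.span (Set.range fun j => f (MvPolynomial.X j)) = ⊤)
    (hf' : Ideal.span (Set.range fun j => f' (MvPolynomial.X j)) = ⊤) :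
    toProj f hf = toProj f' hf' ↔ f (MvPolynomial.X 0) * f' (MvPolynomial.X 1) =
      f (MvPolynomial.X 1) * f' (MvPolynomial.X 0) := by
  obtain ⟨j, hj⟩ := exists_ne_zero_of_span_range_eq_top hf
  obtain ⟨k, hk⟩ := exists_ne_zero_of_span_range_eq_top hf'
  constructor
  · intro h
    obtain ⟨c, -, hc⟩ := proportional_of_toProj_eq hf hf' hj.isUnit h
    rw [hc 1 _ (isHomogeneous_X K 0), hc 1 _ (isHomogeneous_X K 1)]
    ring
  · intro h
    have key : ∀ i i', f (MvPolynomial.X i) * f' (MvPolynomial.X i') =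
        f (MvPolynomial.X i') * f' (MvPolynomial.X i) := by
      intro i i'
      fin_cases i <;> fin_cases i' <;> first | rfl | exact h | exact h.symm
    have hj' : f' (MvPolynomial.X j) ≠ 0 := fun h0 => by
      have := key j k
      rw [h0, mul_zero] at this
      exact mul_ne_zero hj hk this
    refine toProj_eq_of_proportional hf hf' (c := f' (MvPolynomial.X j) / f (MvPolynomial.X j))
      (div_ne_zero hj' hj).isUnit fun i => ?_
    rw [div_mul_eq_mul_div, eq_div_iff hj, mul_comm, key j i, mul_comm]

lemma Chart.point_comp_eq {φ : X ⟶ Proj (gradingByDegree K 1)} (c : Chart ι)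
    (hs : Ideal.span (Set.range fun j => pencilEval c.eval F G (MvPolynomial.X j)) = ⊤)
    (hφ : c.map ≫ φ = toProj _ hs) (e : c.ring →ₐ[K] L) :
    c.point e ≫ φ = toProj (pencilEval (e.comp c.eval) F G) (by
      have h := span_map_eq_top hs e.toRingHom
      rw [← comp_pencilEval]
      exact h) := by
  rw [Chart.point, Category.assoc, hφ, map_toProj]
  simp only [comp_pencilEval]

/-- A maximal ideal containing both values would, by the Nullstellensatz, give a geometric point at
which both forms vanish. -/
lemma span_pencilEval_eq_top [Algebra.IsAlgebraic K L] [IsAlgClosed L] (hd : 0 < d)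
    (hF : F.IsHomogeneous d) (hG : G.IsHomogeneous d)
    (h : ∀ P : GeomPoint ι L, TrivSqZeroExt.fst (P.jet ch hch F) = 0 →
      TrivSqZeroExt.fst (P.jet ch hch G) ≠ 0) (c : Chart ι) :
    Ideal.span (Set.range fun j => pencilEval c.eval F G (MvPolynomial.X j)) = ⊤ := by
  by_contra hcon
  obtain ⟨m, hm, hle⟩ := Ideal.exists_le_maximal _ hcon
  rw [Ideal.span_le] at hle
  have h0 : c.eval F ∈ m := by simpa using hle ⟨0, rfl⟩
  have h1 : c.eval G ∈ m := by simpa using hle ⟨1, rfl⟩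
  let _ : Field (c.ring ⧸ m) := Ideal.Quotient.field m
  have hfin : Module.Finite K (c.ring ⧸ m) := finite_of_finite_type_of_isJacobsonRing K _
  let e : c.ring →ₐ[K] L := (IsAlgClosed.lift : (c.ring ⧸ m) →ₐ[K] L).comp (Ideal.Quotient.mkₐ K m)
  have he {r : c.ring} (hr : r ∈ m) : e r = 0 := by
    have : Ideal.Quotient.mk m r = 0 := Ideal.Quotient.eq_zero_iff_mem.mpr hr
    simp [e, this]
  let P : GeomPoint ι L := ⟨c.point e, by
    rw [Chart.point, Category.assoc, c.map_comp_hom, ← Spec.map_comp, ← CommRingCat.ofHom_comp]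
    congr 2
    exact e.comp_algebraMap⟩
  have hP {H : MvPolynomial (Fin (n + 1)) K} (hH : H.IsHomogeneous d) (h2 : c.eval H ∈ m) :
      TrivSqZeroExt.fst (P.jet ch hch H) = 0 := by
    rw [GeomPoint.fst_jet_eq_zero_iff ch hch _ hd hH, GeomPoint.center]
    rw [Chart.point_closedPoint, Chart.mem_basicOpen_iff _ _ hd hH, not_not]
    exact he h2
  exact h P (hP hF h0) (hP hG h1)

end

end Gluing

/-! ### The Wronskian criterion in local rings -/

section UnramifiedLocal

open TrivSqZeroExt MvPolynomial HomogeneousLocalization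

-- The tangent vector extends to the local ring, where an element with value zero and nonzero
-- derivative generates the maximal ideal.
open IsLocalRing in
lemma IsTangentDerivation.map_comap_maximalIdeal_eq_iff {K R : Type u} [Field K] [CharZero K]
    [CommRing R] [Algebra K R] [IsNoetherianRing R] {D : Derivation K R R}
    (hD : IsTangentDerivation D) {L : Type*}
    [Field L] [Algebra K L] [Algebra.IsAlgebraic K L] (e : R →ₐ[K] L) {m : Ideal R} [m.IsMaximal]
    (hm : RingHom.ker e = m) {O : Type*} [CommRing O] [IsLocalRing O] [Algebra R O]
    [Algebra K O] [IsScalarTower K R O] [IsLocalization.AtPrime O m] :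
    ∃ τ : O →ₐ[K] DualNumber L, (∀ a, τ (algebraMap R O a) = tangentHom e D a) ∧
      ∀ {R₀ : Type*} [CommRing R₀] [Algebra K R₀] (θ : R₀ →ₐ[K] O),
      ((maximalIdeal O).comap θ).map θ = maximalIdeal O ↔ ∃ z, snd (τ (θ z)) ≠ 0 := by
  have hker (a : R) : e a = 0 ↔ a ∈ m := by rw [← hm, RingHom.mem_ker]
  have hu (s : m.primeCompl) : IsUnit (tangentHom e D (s : R)) := by
    rw [isUnit_iff_isUnit_fst, fst_tangentHom, isUnit_iff_ne_zero]
    exact fun h => s.2 ((hker _).mp h)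
  let τ : O →ₐ[K] DualNumber L := IsLocalization.liftAlgHom (M := m.primeCompl) hu
  have hτ (a : R) : τ (algebraMap R O a) = tangentHom e D a := IsLocalization.lift_eq _ _
  have h0 (a : O) : fst (τ a) = 0 ↔ a ∈ maximalIdeal O := by
    constructor
    · intro h
      rw [mem_maximalIdeal, mem_nonunits_iff]
      intro hau
      have := (isUnit_iff_isUnit_fst.mp (hau.map τ)).ne_zero
      exact this h
    · intro h
      rw [← IsLocalization.AtPrime.map_eq_maximalIdeal m O] at h
      have h1 : m.map (algebraMap R O) ≤ RingHom.ker ((fstHom K L L).comp τ) := by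
        rw [Ideal.map_le_iff_le_comap]
        intro x hx
        rw [Ideal.mem_comap, RingHom.mem_ker, AlgHom.comp_apply, hτ]
        simpa using (hker x).mpr hx
      exact h1 h
  refine ⟨τ, hτ, fun θ => BelyiMap.map_comap_maximalIdeal_eq_iff τ h0 ?_ ?_ θ⟩
  · obtain ⟨a, ha, hDa⟩ := hD.exists_notMem m
    refine ⟨algebraMap R O a, (h0 _).mp ?_, ?_⟩
    · rw [hτ, fst_tangentHom, hker]; exact ha
    · rw [hτ, snd_tangentHom, Ne, hker]; exact hDa
  · intro a ha hsa
    obtain ⟨⟨x, s⟩, hx⟩ := IsLocalization.surj m.primeCompl a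
    simp only at hx
    have h1 : fst (tangentHom e D x) = 0 := by
      rw [← hτ, ← hx, map_mul, fst_mul, (h0 a).mpr ha, zero_mul]
    have h2 : snd (tangentHom e D x) ≠ 0 := by
      rw [← hτ, ← hx, map_mul, snd_mul, (h0 a).mpr ha, zero_smul, zero_add, hτ, fst_tangentHom,
        MulOpposite.smul_eq_mul_unop]
      exact mul_ne_zero hsa fun h => s.2 ((hker _).mp h)
    rw [fst_tangentHom, hker] at h1
    rw [snd_tangentHom, Ne, hker] at h2
    rw [hD.maximalIdeal_eq_span m h1 h2, ← hx,
      Ideal.span_singleton_mul_right_unit (IsLocalization.map_units O s)]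

open IsLocalRing in
/-- A morphism to the projective line is unramified where the Wronskian of its coordinates
does not vanish, in terms of local rings. -/
lemma IsTangentDerivation.map_comap_awayLift_eq_iff {K R : Type u} [Field K] [CharZero K]
    [CommRing R] [Algebra K R] [IsNoetherianRing R] {D : Derivation K R R}
    (hD : IsTangentDerivation D) {L : Type*}
    [Field L] [Algebra K L] [Algebra.IsAlgebraic K L] (e : R →ₐ[K] L) {m : Ideal R} [m.IsMaximal]
    (hm : RingHom.ker e = m) {O : Type u} [CommRing O] [IsLocalRing O] [Algebra R O]
    [IsLocalization.AtPrime O m]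
    (f : MvPolynomial (Fin (1 + 1)) K →ₐ[K] R) (j : Fin (1 + 1))
    (hj : IsUnit (((algebraMap R O).comp f.toRingHom) (X j))) :
    ((maximalIdeal O).comap (awayLift (gradingByDegree K 1) _ hj)).map
      (awayLift (gradingByDegree K 1) _ hj) = maximalIdeal O ↔
      wronskian (tangentHom e D (f (X 0))) (tangentHom e D (f (X 1))) ≠ 0 := by
  let _ : Algebra K O := ((algebraMap R O).comp (algebraMap K R)).toAlgebra
  have : IsScalarTower K R O := IsScalarTower.of_algebraMap_eq' rfl
  let _ : Algebra K (Away (gradingByDegree K 1) (X j)) :=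
    ((fromZeroRingHom (gradingByDegree K 1) (Submonoid.powers (X j))).comp
      (algebraMap K (gradingByDegree K 1 0))).toAlgebra
  set θ := awayLift (gradingByDegree K 1) _ hj with hθdef
  have hθ (k : ℕ) (H : MvPolynomial (Fin (1 + 1)) K) (hH : H ∈ gradingByDegree K 1 (k • 1)) :
      θ (Away.mk _ (X_mem_grading j) k H hH) * algebraMap R O (f (X j)) ^ k =
        algebraMap R O (f H) := awayLift_mk_mul (gradingByDegree K 1) _ hj (X_mem_grading j) k H hH
  have hK (c : K) : θ (algebraMap K _ c) = algebraMap K O c := by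
    have h1 : algebraMap K (Away (gradingByDegree K 1) (X j)) c =
        Away.mk _ (X_mem_grading j) 0 (C c) (by simp) := by
      apply HomogeneousLocalization.val_injective
      rw [Away.val_mk]
      exact congrArg (Localization.mk (C c)) (Subtype.ext (pow_zero _).symm)
    rw [h1]
    have h2 := hθ 0 (C c) (by simp)
    rw [pow_zero, mul_one] at h2
    rw [h2]
    exact congrArg (algebraMap R O) (f.commutes c)
  let θ' : Away (gradingByDegree K 1) (X j) →ₐ[K] O := { θ with commutes' := hK }
  obtain ⟨τ, hτ, h⟩ := hD.map_comap_maximalIdeal_eq_iff e hm (O := O)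
  refine (h θ').trans ?_
  have hb : fst (τ (algebraMap R O (f (X j)))) ≠ 0 :=
    (isUnit_iff_isUnit_fst.mp (hj.map τ)).ne_zero
  set b : Fin (1 + 1) → DualNumber L := fun i => tangentHom e D (f (X i)) with hbdef
  rw [hτ] at hb
  -- These are the ratios X_i/X_j along the tangent vector; by the quotient rule their derivatives
  -- are Wronskians up to a nonzero factor.
  set y : Fin (1 + 1) → DualNumber L := fun i => τ (θ (Away.mk (gradingByDegree K 1)
    (X_mem_grading j) 1 (X i) (X_mem_grading_smul i))) with hydef
  have hy (i) : y i * b j = b i := by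
    have := congrArg τ (hθ 1 (X i) (X_mem_grading_smul i))
    rwa [pow_one, map_mul, hτ, hτ] at this
  have hy' (i) : snd (y i) * fst (b j) ^ 2 = -wronskian (b i) (b j) := by
    rw [← hy i, wronskian, fst_mul, snd_mul, MulOpposite.smul_eq_mul_unop, smul_eq_mul]
    simp only [MulOpposite.unop_op]
    ring
  have hy0 : (∀ i, snd (y i) = 0) ↔ wronskian (b 0) (b 1) = 0 := by
    have h1 (i) : snd (y i) = 0 ↔ wronskian (b i) (b j) = 0 := by
      rw [← neg_eq_zero (a := wronskian _ _), ← hy' i, mul_eq_zero, or_iff_left (pow_ne_zero 2 hb)]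
    simp only [h1]
    have h2 (x z : DualNumber L) : wronskian x z = - wronskian z x := by
      rw [wronskian, wronskian]; ring
    have h3 (x : DualNumber L) : wronskian x x = 0 := by
      rw [wronskian]; ring
    fin_cases j
    · exact ⟨fun h => by rw [h2, neg_eq_zero]; exact h 1, fun h i => by
        fin_cases i
        · exact h3 _
        · exact (h2 _ _).trans (neg_eq_zero.mpr h)⟩
    · exact ⟨fun h => h 0, fun h i => by
        fin_cases i
        · exact h
        · exact h3 _⟩
  rw [← not_iff_not, not_not]
  push Not
  refine Iff.trans ?_ hy0
  refine ⟨fun h i => h _, fun h z => ?_⟩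
  obtain ⟨k, H, hH, rfl⟩ := Away.mk_surjective (gradingByDegree K 1) (X_mem_grading j) z
  have hH' : H.IsHomogeneous k := by simpa using hH
  have e1 := congrArg τ (hθ k H hH)
  rw [map_mul, map_pow, hτ, hτ] at e1
  have e2 : tangentHom e D (f H) = b j ^ k * aeval y H := by
    rw [← aeval_mul_of_isHomogeneous hH']
    rw [← AlgHom.comp_apply]
    congr 1
    ext i : 1
    rw [aeval_X, mul_comm, hy]
    rfl
  have hbu : IsUnit (b j ^ k) := (isUnit_iff_isUnit_fst.mpr hb.isUnit).pow k
  rw [e2, mul_comm] at e1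
  have e3 := hbu.mul_left_cancel e1
  change snd (τ (θ _)) = 0
  rw [e3]
  -- Ratios without derivative are constants in `L`, and then so is every function on the chart.
  have e4 : y = fun i => algebraMap L (DualNumber L) (fst (y i)) := by
    funext i
    exact TrivSqZeroExt.ext rfl (h i)
  have e5 := aeval_algebraMap_apply (DualNumber L) (fun i => fst (y i)) H
  rw [e4]
  exact congrArg snd e5

end UnramifiedLocal

/-! ### Ramification in terms of maximal ideals of stalks -/

section Stalks

open IsLocalRing

lemma one_lt_length_quotient_iff {A : Type*} [CommRing A] [IsLocalRing A] {I : Ideal A}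
    (hI : I ≤ maximalIdeal A) : 1 < Module.length A (A ⧸ I) ↔ I ≠ maximalIdeal A := by
  have h0 : Module.length A (A ⧸ I) ≠ 0 := by
    rw [Ne, Module.length_eq_zero_iff, Ideal.Quotient.subsingleton_iff]
    rintro rfl
    exact (maximalIdeal.isMaximal A).ne_top (top_le_iff.mp hI)
  have h1 : Module.length A (A ⧸ I) = 1 ↔ I = maximalIdeal A := by
    rw [Module.length_eq_one_iff, isSimpleModule_iff_isCoatom, ← Ideal.isMaximal_def]
    exact ⟨eq_maximalIdeal, fun h => h ▸ maximalIdeal.isMaximal A⟩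
  rw [Ne, ← h1, lt_iff_le_and_ne, and_iff_right (Order.one_le_iff_ne_zero.mpr h0), ne_comm]

/-- A morphism maps the maximal ideal of the local ring at the image of a point to a generating
set of the maximal ideal at this point. -/
def MapsMaximalIdeal {X Y : Scheme.{u}} (f : X ⟶ Y) (x : X) : Prop :=
  (maximalIdeal (Y.presheaf.stalk (f x))).map (f.stalkMap x).hom =
    maximalIdeal (X.presheaf.stalk x)

lemma one_lt_ramificationIndex_iff {X Y : Scheme.{u}} (f : X ⟶ Y) (x : X) :
    1 < ramificationIndex f x ↔ ¬ MapsMaximalIdeal f x := by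
  exact one_lt_length_quotient_iff (map_maximalIdeal_le (f.stalkMap x).hom)

lemma stalkMap_bijective {X Y : Scheme.{u}} (f : X ⟶ Y) [IsOpenImmersion f] (x : X) :
    Function.Bijective (f.stalkMap x).hom :=
  ConcreteCategory.bijective_of_isIso (f.stalkMap x)

lemma mapsMaximalIdeal_comp_of_right {X Y Z : Scheme.{u}} (f : X ⟶ Y) (g : Y ⟶ Z)
    [IsOpenImmersion g] (x : X) : MapsMaximalIdeal (f ≫ g) x ↔ MapsMaximalIdeal f x := by
  have h1 := map_maximalIdeal_of_surjective _ (stalkMap_bijective g (f x)).surjective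
  have h2 : ((f ≫ g).stalkMap x).hom = (f.stalkMap x).hom.comp (g.stalkMap (f x)).hom :=
    congrArg CommRingCat.Hom.hom (Scheme.Hom.stalkMap_comp f g x)
  have h3 : (maximalIdeal (Z.presheaf.stalk ((f ≫ g) x))).map ((f ≫ g).stalkMap x).hom =
      (maximalIdeal (Y.presheaf.stalk (f x))).map (f.stalkMap x).hom := by
    rw [h2, ← h1, Ideal.map_map]
    rfl
  rw [MapsMaximalIdeal, MapsMaximalIdeal, h3]

lemma mapsMaximalIdeal_comp_of_left {X Y Z : Scheme.{u}} (f : X ⟶ Y) (g : Y ⟶ Z)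
    [IsOpenImmersion f] (x : X) : MapsMaximalIdeal (f ≫ g) x ↔ MapsMaximalIdeal g (f x) := by
  have h0 := stalkMap_bijective f x
  have h1 := map_maximalIdeal_of_surjective _ h0.surjective
  have h2 : ((f ≫ g).stalkMap x).hom = (f.stalkMap x).hom.comp (g.stalkMap (f x)).hom :=
    congrArg CommRingCat.Hom.hom (Scheme.Hom.stalkMap_comp f g x)
  have h3 : (maximalIdeal (Z.presheaf.stalk ((f ≫ g) x))).map ((f ≫ g).stalkMap x).hom =
      ((maximalIdeal (Z.presheaf.stalk (g (f x)))).map (g.stalkMap (f x)).hom).map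
        (f.stalkMap x).hom := by
    rw [h2, Ideal.map_map]
    rfl
  rw [MapsMaximalIdeal, MapsMaximalIdeal, h3, ← h1]
  refine ⟨fun h => ?_, fun h => by rw [h]⟩
  have := congrArg (Ideal.comap (f.stalkMap x).hom) h
  rwa [Ideal.comap_map_of_bijective _ h0, Ideal.comap_map_of_bijective _ h0] at this

/-- The maximal ideal of the lower stalk is generated by the contraction of `q`, so only the local
ring above is needed. It is kept abstract to hide the structure sheaf. -/
lemma exists_mapsMaximalIdeal_specMap_iff {A B : Type u} [CommRing A] [CommRing B] (ρ : A →+* B)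
    (q : PrimeSpectrum B) :
    ∃ (O : Type u) (_ : CommRing O) (_ : IsLocalRing O) (_ : Algebra B O),
      IsLocalization.AtPrime O q.asIdeal ∧
      (MapsMaximalIdeal (Spec.map (CommRingCat.ofHom ρ)) q ↔
        ((maximalIdeal O).comap ((algebraMap B O).comp ρ)).map ((algebraMap B O).comp ρ) =
          maximalIdeal O) := by
  have hA : IsLocalRing ((Spec.structureSheaf A).presheaf.stalk (q.comap ρ)) :=
    IsLocalization.AtPrime.isLocalRing _ (q.comap ρ).asIdeal
  have hB : IsLocalRing ((Spec.structureSheaf B).presheaf.stalk q) :=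
    IsLocalization.AtPrime.isLocalRing _ q.asIdeal
  refine ⟨(Spec.structureSheaf B).presheaf.stalk q, inferInstance, hB, inferInstance,
    inferInstance, ?_⟩
  have h1 : ((Spec.map (CommRingCat.ofHom ρ)).stalkMap q).hom.comp
      (algebraMap A ((Spec.structureSheaf A).presheaf.stalk (q.comap ρ))) =
      (algebraMap B ((Spec.structureSheaf B).presheaf.stalk q)).comp ρ :=
    congrArg CommRingCat.Hom.hom (stalkMap_toStalk (CommRingCat.ofHom ρ) q)
  have h2 := IsLocalization.AtPrime.map_eq_maximalIdeal (q.comap ρ).asIdeal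
    ((Spec.structureSheaf A).presheaf.stalk (q.comap ρ))
  have h3 := IsLocalization.AtPrime.under_maximalIdeal
    ((Spec.structureSheaf B).presheaf.stalk q) q.asIdeal
  rw [← Ideal.comap_comap]
  have h4 : Ideal.comap ρ (Ideal.comap (algebraMap B ((Spec.structureSheaf B).presheaf.stalk q))
      (maximalIdeal _)) = (q.comap ρ).asIdeal := congrArg (Ideal.comap ρ) h3
  rw [h4, ← h1]
  refine Iff.of_eq (congrArg (· = _) ?_)
  exact (congrArg (Ideal.map _) h2.symm).trans (Ideal.map_map _ _)

end Stalks

/-! ### The Wronskian criterion for morphisms to the projective line -/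

section Ramification

open MvPolynomial

variable {K : Type u} [Field K] [CharZero K] {n : ℕ} {X : Scheme.{u}}
  {ι : X ⟶ Proj (gradingByDegree K n)} {L : Type u} [Field L] [Algebra K L]
  [Algebra.IsAlgebraic K L]

lemma mapsMaximalIdeal_iff_of_comp_eq {X Y : Scheme.{u}} {R A B : Type u} [CommRing R] [CommRing A]
    [CommRing B] (ρ : R →+* A) [IsOpenImmersion (Spec.map (CommRingCat.ofHom ρ))]
    (g : Spec (CommRingCat.of R) ⟶ X) [IsOpenImmersion g] (φ : X ⟶ Y) (θ : B →+* A)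
    (i : Spec (CommRingCat.of B) ⟶ Y) [IsOpenImmersion i]
    (h : Spec.map (CommRingCat.ofHom ρ) ≫ g ≫ φ = Spec.map (CommRingCat.ofHom θ) ≫ i)
    (q : PrimeSpectrum A) :
    MapsMaximalIdeal φ (g (q.comap ρ)) ↔ MapsMaximalIdeal (Spec.map (CommRingCat.ofHom θ)) q := by
  have h1 : g (q.comap ρ) = (Spec.map (CommRingCat.ofHom ρ) ≫ g) q :=
    (Scheme.Hom.comp_apply (Spec.map (CommRingCat.ofHom ρ)) g q).symm
  refine (Iff.of_eq (congrArg (MapsMaximalIdeal φ) h1)).trans ?_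
  refine (mapsMaximalIdeal_comp_of_left (Spec.map (CommRingCat.ofHom ρ) ≫ g) φ q).symm.trans ?_
  have h2 : (Spec.map (CommRingCat.ofHom ρ) ≫ g) ≫ φ = Spec.map (CommRingCat.ofHom θ) ≫ i := by
    rw [Category.assoc, h]
  have h3 : MapsMaximalIdeal ((Spec.map (CommRingCat.ofHom ρ) ≫ g) ≫ φ) q ↔
      MapsMaximalIdeal (Spec.map (CommRingCat.ofHom θ) ≫ i) q :=
    Iff.of_eq (congrArg (fun ψ : Spec (CommRingCat.of A) ⟶ Y => MapsMaximalIdeal ψ q) h2)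
  exact h3.trans (mapsMaximalIdeal_comp_of_right (Spec.map (CommRingCat.ofHom θ)) i q)

-- Inverting the coordinate `f (X j)` gives a neighbourhood mapped into a standard affine chart,
-- where the morphism is a ring homomorphism.
open IsLocalRing in
omit [CharZero K] in
lemma exists_mapsMaximalIdeal_iff {φ : X ⟶ Proj (gradingByDegree K n)} {R : Type u} [CommRing R]
    [Algebra K R] (g : Spec (CommRingCat.of R) ⟶ X) [IsOpenImmersion g]
    {f : MvPolynomial (Fin (n + 1)) K →ₐ[K] R}
    (hf : Ideal.span (Set.range fun j => f (MvPolynomial.X j)) = ⊤) (hφ : g ≫ φ = toProj f hf)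
    (p : PrimeSpectrum R) (j : Fin (n + 1)) (hj : f (MvPolynomial.X j) ∉ p.asIdeal) :
    ∃ (O : Type u) (_ : CommRing O) (_ : IsLocalRing O) (_ : Algebra R O)
      (hu : IsUnit (((algebraMap R O).comp f.toRingHom) (MvPolynomial.X j))),
      IsLocalization.AtPrime O p.asIdeal ∧
      (MapsMaximalIdeal φ (g p) ↔
        ((maximalIdeal O).comap (awayLift (gradingByDegree K n) _ hu)).map
          (awayLift (gradingByDegree K n) _ hu) = maximalIdeal O) := by
  generalize hr : f (MvPolynomial.X j) = r at hj
  obtain ⟨q, rfl⟩ : p ∈ Set.range (PrimeSpectrum.comap (algebraMap R (Localization.Away r))) := by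
    rw [PrimeSpectrum.localization_away_comap_range _ r]
    exact hj
  have hu : IsUnit (((algebraMap R (Localization.Away r)).comp f.toRingHom)
    (MvPolynomial.X j)) := by
    have := IsLocalization.Away.algebraMap_isUnit (S := Localization.Away r) r
    rwa [← hr] at this ⊢
  have h2 := (congrArg (_ ≫ ·) hφ).trans
    (map_toProj_eq_awayι f hf (algebraMap R (Localization.Away r)) one_pos (X_mem_grading j) hu)
  obtain ⟨O, _, _, _, hO, h3⟩ := exists_mapsMaximalIdeal_specMap_iff
    (awayLift (gradingByDegree K n) _ hu) q
  have h4 := mapsMaximalIdeal_iff_of_comp_eq (algebraMap R (Localization.Away r)) g φ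
    (awayLift (gradingByDegree K n) _ hu) (Proj.awayι _ _ _ _) h2 q
  rw [comp_awayLift] at h3
  let _ : Algebra R O :=
    ((algebraMap (Localization.Away r) O).comp (algebraMap R (Localization.Away r))).toAlgebra
  have : IsScalarTower R (Localization.Away r) O := IsScalarTower.of_algebraMap_eq' rfl
  refine ⟨O, _, inferInstance, inferInstance, hu.map (algebraMap (Localization.Away r) O),
    IsLocalization.isLocalization_isLocalization_atPrime_isLocalization
      (Submonoid.powers r) O q.asIdeal, ?_⟩
  exact h4.trans h3

/-- A morphism to the projective line is unramified where the Wronskian of its coordinates does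
not vanish. -/
lemma Chart.mapsMaximalIdeal_iff {φ : X ⟶ Proj (gradingByDegree K 1)} (c : Chart ι)
    {f : MvPolynomial (Fin (1 + 1)) K →ₐ[K] c.ring}
    (hf : Ideal.span (Set.range fun j => f (MvPolynomial.X j)) = ⊤)
    (hφ : c.map ≫ φ = toProj _ hf) (e : c.ring →ₐ[K] L) :
    MapsMaximalIdeal φ (c.point e (IsLocalRing.closedPoint L)) ↔
      wronskian (tangentHom e c.der (f (MvPolynomial.X 0)))
        (tangentHom e c.der (f (MvPolynomial.X 1))) ≠ 0 := by
  obtain ⟨j, hj⟩ := exists_ne_zero_of_span_range_eq_top (f := e.comp f)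
    (span_map_eq_top hf e.toRingHom)
  have hm := c.ker_isMaximal e
  obtain ⟨O, _, _, _, hu, hO, h⟩ :=
    exists_mapsMaximalIdeal_iff c.map hf hφ ⟨RingHom.ker e, hm.isPrime⟩ j hj
  rw [c.point_closedPoint]
  refine h.trans ?_
  exact c.isTangentDerivation.map_comap_awayLift_eq_iff e rfl f j hu

variable (ch : X → Chart ι) (hch : ∀ x, x ∈ Set.range (ch x).map)
  {F G : MvPolynomial (Fin (n + 1)) K}
  {φ : X ⟶ Proj (gradingByDegree K 1)}
  {hs : ∀ x, Ideal.span (Set.range fun j => pencilEval (ch x).eval F G (MvPolynomial.X j)) = ⊤}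
  (hφ : ∀ x, (ch x).map ≫ φ = toProj _ (hs x))

include hφ in
lemma GeomPoint.one_lt_ramificationIndex_iff (P : GeomPoint ι L) :
    1 < ramificationIndex φ P.center ↔ wronskian (P.jet ch hch F) (P.jet ch hch G) = 0 := by
  rw [BelyiMap.one_lt_ramificationIndex_iff, GeomPoint.center]
  have := (ch P.center).mapsMaximalIdeal_iff (hs P.center) (hφ _) (P.hom ch hch)
  rw [← P.eq_point ch hch] at this
  rw [this, not_not, pencilEval_X_zero, pencilEval_X_one]
  rfl

end Ramification

/-! ### Geometric points, conjugation and coordinates -/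

section RationalPoints

open TrivSqZeroExt

variable {K : Type u} [Field K] {L : Type u} [Field L] [Algebra K L]

/-- Both homomorphisms embed the same residue field into an algebraic closure of K, and an embedding
extends to an automorphism. -/
lemma exists_algEquiv_comp_eq [IsAlgClosed L] [Algebra.IsAlgebraic K L] {R : Type*} [CommRing R]
    [Algebra K R] {e e' : R →ₐ[K] L} (hm : (RingHom.ker e).IsMaximal)
    (h : RingHom.ker e = RingHom.ker e') : ∃ σ : L ≃ₐ[K] L, e' = (σ : L →ₐ[K] L).comp e := by
  let _ : Field (R ⧸ RingHom.ker e) := Ideal.Quotient.field _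
  let _ : Algebra (R ⧸ RingHom.ker e) L := (Ideal.kerLiftAlg e).toAlgebra
  have : IsScalarTower K (R ⧸ RingHom.ker e) L :=
    IsScalarTower.of_algebraMap_eq' (Ideal.kerLiftAlg e).comp_algebraMap.symm
  have : Algebra.IsAlgebraic (R ⧸ RingHom.ker e) L := Algebra.IsAlgebraic.tower_top (K := K) _
  obtain ⟨σ, hσ⟩ := IsAlgClosed.surjective_domRestrict_of_isAlgebraic (K := K) (E := L)
    (L := R ⧸ RingHom.ker e) (M := L)
    (Ideal.Quotient.liftₐ (RingHom.ker e) e' fun a ha => by rw [h] at ha; exact ha)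
  refine ⟨AlgEquiv.ofBijective σ (Algebra.IsAlgebraic.algHom_bijective σ), ?_⟩
  ext r
  exact (congrArg (fun τ => τ (Ideal.Quotient.mk _ r)) hσ).symm

lemma GeomPoint.exists_algEquiv_of_center_eq [IsAlgClosed L] [Algebra.IsAlgebraic K L] {n : ℕ}
    {X : Scheme.{u}} {ι : X ⟶ Proj (gradingByDegree K n)} (ch : X → Chart ι)
    (hch : ∀ x, x ∈ Set.range (ch x).map) {P Q : GeomPoint ι L} (h : P.center = Q.center) :
    ∃ σ : L ≃ₐ[K] L, Q.1 = Spec.map (CommRingCat.ofHom (σ : L →+* L)) ≫ P.1 := by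
  obtain ⟨e, he⟩ := (ch P.center).exists_eq_point Q.1 Q.2 (h ▸ hch P.center)
  have hP := P.eq_point ch hch
  have hker : RingHom.ker (P.hom ch hch) = RingHom.ker e := by
    rw [center, center, hP, he, Chart.point_closedPoint, Chart.point_closedPoint] at h
    exact congrArg PrimeSpectrum.asIdeal ((ch P.center).map.isOpenEmbedding.injective h)
  obtain ⟨σ, rfl⟩ := exists_algEquiv_comp_eq (Chart.ker_isMaximal _ _) hker
  refine ⟨σ, ?_⟩
  rw [he]
  refine Eq.trans ?_ (congrArg (_ ≫ ·) hP.symm)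
  change _ = Spec.map _ ≫ Spec.map _ ≫ _
  rw [← Spec.map_comp_assoc, ← CommRingCat.ofHom_comp]
  rfl

variable {n : ℕ} {C : Over (Spec (CommRingCat.of K))} {ι : C.left ⟶ Proj (gradingByDegree K n)}
  (hι : ι ≫ projHom K n = C.hom)

/-- The point of a subscheme of projective space given by a point of the corresponding scheme
over `K`. -/
def RatPoint.toGeomPoint (P : RatPoint C L) : GeomPoint ι L :=
  ⟨P.left, (congrArg (P.left ≫ ·) hι).trans (Over.w P)⟩

lemma RatPoint.toGeomPoint_bijective :
    Function.Bijective (RatPoint.toGeomPoint hι : RatPoint C L → _) := by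
  constructor
  · intro P Q h
    exact Over.OverMorphism.ext (congrArg Subtype.val h)
  · intro P
    exact ⟨Over.homMk (U := specOver K L) P.1 ((congrArg (P.1 ≫ ·) hι).symm.trans P.2), rfl⟩

variable (ch : C.left → Chart ι) (hch : ∀ x, x ∈ Set.range (ch x).map)

include hch in
lemma RatPoint.exists_conj_eq [IsAlgClosed L] [Algebra.IsAlgebraic K L] {P Q : RatPoint C L}
    (h : (P.toGeomPoint hι).center = (Q.toGeomPoint hι).center) :
    ∃ σ : L ≃ₐ[K] L, P.conj σ = Q := by
  obtain ⟨σ, hσ⟩ := GeomPoint.exists_algEquiv_of_center_eq ch hch h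
  exact ⟨σ, Over.OverMorphism.ext hσ.symm⟩

/-- A morphism from a scheme over `K` to projective space, as a morphism over `K`. -/
def overHom {m : ℕ} (φ : C.left ⟶ Proj (gradingByDegree K m)) (h : φ ≫ projHom K m = C.hom) :
    C ⟶ projectiveSpace K m :=
  Over.homMk (U := C) (V := projectiveSpace K m) φ h

variable {F G : MvPolynomial (Fin (n + 1)) K} {φ : C.left ⟶ Proj (gradingByDegree K 1)}
  (h : φ ≫ projHom K 1 = C.hom)
  {hs : ∀ x, Ideal.span (Set.range fun j => pencilEval (ch x).eval F G (MvPolynomial.X j)) = ⊤}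
  (hφ : ∀ x, (ch x).map ≫ φ = toProj _ (hs x))

include hφ

lemma RatPoint.comp_overHom_eq_coordPoint_iff (P : RatPoint C L) {v : Fin (1 + 1) → L}
    (hv : v ≠ 0) :
    P ≫ overHom φ h = coordPoint K v hv ↔ fst ((P.toGeomPoint hι).jet ch hch F) * v 1 =
      fst ((P.toGeomPoint hι).jet ch hch G) * v 0 := by
  obtain ⟨j, hj⟩ := Function.ne_iff.mp hv
  have h1 := (ch (P.toGeomPoint hι).center).point_comp_eq (hs _) (hφ _)
    ((P.toGeomPoint hι).hom ch hch)
  rw [← GeomPoint.eq_point] at h1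
  have h3 := toProj_eq_toProj_iff (K := K) (f := pencilEval (((P.toGeomPoint hι).hom ch hch).comp
    (ch (P.toGeomPoint hι).center).eval) F G) (f' := MvPolynomial.aeval v)
    (by
      rw [← comp_pencilEval]
      exact span_map_eq_top (hs _) ((P.toGeomPoint hι).hom ch hch).toRingHom)
    (span_range_eq_top_of_ne_zero j (by simpa using hj))
  have h2 : P ≫ overHom φ h = coordPoint K v hv ↔ _ :=
    ⟨fun h => h1.symm.trans (congrArg Over.Hom.left h),
      fun h => Over.OverMorphism.ext (h1.trans h)⟩
  refine (h2.trans h3).trans ?_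
  simp

lemma RatPoint.isRamifiedAt_overHom_iff [CharZero K] [Algebra.IsAlgebraic K L]
    (P : RatPoint C L) :
    IsRamifiedAt (overHom φ h) P ↔ wronskian ((P.toGeomPoint hι).jet ch hch F)
      ((P.toGeomPoint hι).jet ch hch G) = 0 :=
  (P.toGeomPoint hι).one_lt_ramificationIndex_iff ch hch hφ

end RationalPoints

/-! ### Assembly of the theorem -/

section MainTheorem

open TrivSqZeroExt

lemma mem_zeroOneInfty_iff {K : Type u} [Field K] {Q : RatPoint (projectiveSpace K 1)
    (AlgebraicClosure K)} : Q ∈ zeroOneInfty K ↔ Q = coordPoint K ![0, 1] (by simp) ∨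
      Q = coordPoint K ![1, 1] (by simp) ∨ Q = coordPoint K ![1, 0] (by simp) := by
  rfl

/-- Every curve over a number field has a Belyi map which is ramified at the points of a given
finite set and maps the points of another one outside of the branch locus. -/
lemma exists_belyi_map {K : Type u} [Field K] [NumberField K]
    {C : Over (Spec (CommRingCat.of K))} (hC : IsCurve C)
    (S T : Set (RatPoint C (AlgebraicClosure K))) (hS : S.Finite) (hT : T.Finite)
    (hST : ∀ t ∈ T, ∀ σ : AlgebraicClosure K ≃ₐ[K] AlgebraicClosure K,
      RatPoint.conj σ t ∉ S) :
    ∃ φ : C ⟶ projectiveSpace K 1, IsFinite φ.left ∧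
      branchLocus φ = zeroOneInfty K ∧
      (∀ P ∈ S, IsRamifiedAt φ P) ∧
      Disjoint ((fun P : RatPoint C (AlgebraicClosure K) => P ≫ φ) '' T)
        (zeroOneInfty K) := by
  obtain ⟨n, ι, _, hι⟩ : ∃ (n : ℕ) (ι : C.left ⟶ Proj (gradingByDegree K n)),
      IsClosedImmersion ι ∧ ι ≫ projHom K n = C.hom := by
    obtain ⟨n, i, hi⟩ := hC.projective
    exact ⟨n, i.left, hi, Over.w i⟩
  have : SmoothOfRelativeDimension 1 (ι ≫ projHom K n) := hι ▸ hC.smooth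
  have hgeom := hC.geometricallyIrreducible
  have : Subsingleton (Spec (CommRingCat.of K)) :=
    inferInstanceAs (Subsingleton (PrimeSpectrum K))
  have : Nonempty (Spec (CommRingCat.of K)) := inferInstanceAs (Nonempty (PrimeSpectrum K))
  have : IrreducibleSpace C.left := GeometricallyIrreducible.irreducibleSpace_of_subsingleton C.hom
  have : CompactSpace C.left :=
    (quasiCompact_iff_compactSpace (ι ≫ projHom K n)).mp inferInstance
  have : Algebra.IsAlgebraic ℚ (AlgebraicClosure K) := Algebra.IsAlgebraic.trans ℚ K _
  obtain ⟨ch, hfin, hch⟩ := exists_finite_charts ι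
  let V := GeomPoint.curveData (L := AlgebraicClosure K) ch hch hfin
  let pt : RatPoint C (AlgebraicClosure K) → GeomPoint ι (AlgebraicClosure K) :=
    RatPoint.toGeomPoint hι
  have hpt : Function.Bijective pt := RatPoint.toGeomPoint_bijective hι
  -- Geometric points over the same closed point are conjugate, so the hypothesis on conjugates says
  -- that no point of `T` shares its center with a point of `S`.
  obtain ⟨d, F, G, h⟩ := V.exists_isBelyi (hS.image pt) (hT.image pt) (by
    rintro _ ⟨t, ht, rfl⟩ _ ⟨s, hs, rfl⟩ heq
    obtain ⟨σ, hσ⟩ := RatPoint.exists_conj_eq hι ch hch heq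
    exact hST t ht σ (hσ ▸ hs))
  have hs (x) := span_pencilEval_eq_top ch hch h.pencil.pos h.pencil.left h.pencil.right
    h.pencil.ne_zero (ch x)
  obtain ⟨φ, hφ⟩ := exists_map_comp_eq_toProj ch hch h.pencil.left h.pencil.right hs
  have hφK : φ ≫ projHom K 1 = C.hom := (comp_projHom_eq ch hch hφ).trans hι
  have hram (P : RatPoint C (AlgebraicClosure K)) := P.isRamifiedAt_overHom_iff hι ch hch hφK hφ
  have hmem (P : RatPoint C (AlgebraicClosure K)) : P ≫ overHom φ hφK ∈ zeroOneInfty K ↔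
      fst (V.jet (pt P) F) = 0 ∨ fst (V.jet (pt P) F) = fst (V.jet (pt P) G) ∨
        fst (V.jet (pt P) G) = 0 := by
    rw [mem_zeroOneInfty_iff]
    simp only [RatPoint.comp_overHom_eq_coordPoint_iff hι ch hch hφK hφ]
    simp only [Matrix.cons_val_zero, Matrix.cons_val_one, mul_zero, mul_one,
      eq_comm (a := (0 : AlgebraicClosure K))]
    rfl
  refine ⟨overHom φ hφK, isFinite_of_pencil ch hch hφ h.pencil.pos h.pencil.left h.pencil.right,
    ?_, fun P hP => (hram P).mpr (h.ramified _ ⟨P, hP, rfl⟩), ?_⟩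
  · ext Q
    constructor
    · rintro ⟨P, hP, rfl⟩
      rw [hmem]
      rcases h.of_wronskian_eq_zero _ ((hram P).mp hP) with h0 | h0 | h0
      · exact Or.inl h0
      · exact Or.inr (Or.inr h0)
      · exact Or.inr (Or.inl h0)
    · intro hQ
      rcases mem_zeroOneInfty_iff.mp hQ with rfl | rfl | rfl
      · obtain ⟨P, hP, h0⟩ := h.exists_zero
        obtain ⟨P, rfl⟩ := hpt.surjective P
        refine ⟨P, (hram P).mpr hP, (P.comp_overHom_eq_coordPoint_iff hι ch hch hφK hφ _).mpr ?_⟩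
        simp only [Matrix.cons_val_zero, Matrix.cons_val_one, mul_zero, mul_one]
        exact h0
      · obtain ⟨P, hP, h0⟩ := h.exists_one
        obtain ⟨P, rfl⟩ := hpt.surjective P
        refine ⟨P, (hram P).mpr hP, (P.comp_overHom_eq_coordPoint_iff hι ch hch hφK hφ _).mpr ?_⟩
        simp only [Matrix.cons_val_zero, Matrix.cons_val_one, mul_one]
        exact h0
      · obtain ⟨P, hP, h0⟩ := h.exists_infty
        obtain ⟨P, rfl⟩ := hpt.surjective P
        refine ⟨P, (hram P).mpr hP, (P.comp_overHom_eq_coordPoint_iff hι ch hch hφK hφ _).mpr ?_⟩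
        simp only [Matrix.cons_val_zero, Matrix.cons_val_one, mul_zero, mul_one]
        exact h0.symm
  · rw [Set.disjoint_left]
    rintro _ ⟨P, hP, rfl⟩ hQ
    obtain ⟨h1, h2, h3⟩ := h.notMem _ ⟨P, hP, rfl⟩
    rcases (hmem P).mp hQ with h0 | h0 | h0
    exacts [h1 h0, h3 h0, h2 h0]

end MainTheorem

end BelyiMap

end

theorem theorem1p1 (K : Type u) [Field K] [NumberField K]
    (C : Over (Spec (CommRingCat.of K))) (hC : BelyiMap.IsCurve C)
    (S T : Set (BelyiMap.RatPoint C (AlgebraicClosure K))) (hS : S.Finite) (hT : T.Finite)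
    (hST : ∀ t ∈ T, ∀ σ : AlgebraicClosure K ≃ₐ[K] AlgebraicClosure K,
      BelyiMap.RatPoint.conj σ t ∉ S) :
    ∃ φ : C ⟶ BelyiMap.projectiveSpace K 1, IsFinite φ.left ∧
      BelyiMap.branchLocus φ = BelyiMap.zeroOneInfty K ∧
      (∀ P ∈ S, BelyiMap.IsRamifiedAt φ P) ∧
      Disjoint ((fun P : BelyiMap.RatPoint C (AlgebraicClosure K) => P ≫ φ) '' T)
        (BelyiMap.zeroOneInfty K) :=
  BelyiMap.exists_belyi_map hC S T hS hT hST
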